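/- **Setting.** A structured system $(\bar A,\bar B)$ consists of zero patterns $\bar A\in\{0,*\}^{n\times n}$ and $\bar B\in\{0,*\}^{n\times m}$. It is *structurally controllable* if there are real matrices $A,B$ with $A_{ij}=0$ whenever $\bar A_{ij}=0$ and $B_{ij}=0$ whenever $\bar B_{ij}=0$ such that $\dot x=Ax+Bu$ is controllable (every initial state can be driven to every final state in some finite time). For $\mathcal W\subseteq\{1,\dots,m\}$ let $\bar B_{\mathcal W}$ be the restriction of $\bar B$ to the columns in $\mathcal W$, and let $\mathcal K=\{\mathcal W:(\bar A,\bar B_{\mathcal W})\text{ is structurally controllable}\}$. Given costs $p_u(j)\ge 0$, $j=1,\dots,m$, the *minimum cost constrained input selection problem* (minCCIS) is to minimize $p(\mathcal I)=\sum_{j\in\mathcal I}p_u(j)$ over $\mathcal I\in\mathcal K$; let $p^*$ be its optimal value. Let $\mathcal D(\bar A)$ be the digraph on $x_1,\dots,x_n$ with an edge $(x_j,x_i)$ whenever $\bar A_{ij}=*$, and let $\mathcal N_1,\dots,\mathcal N_q$ be its non-top linked strongly connected components, i.e. those that no edge enters from another component. The flow network $\mathcal F(\bar A,\bar B,c)$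 has vertices $s,t,\mathcal N_1,\dots,\mathcal N_q,x'_1,\dots,x'_n,x_1,\dots,x_n,u_1,\dots,u_m,u'_1,\dots,u'_m$ and edges $(s,\mathcal N_i)$; $(s,x'_k)$; $(\mathcal N_i,u'_j)$ if $\bar B_{rj}=*$ for some $x_r\in\mathcal N_i$; $(x'_k,x_r)$ if $\bar A_{kr}=*$; $(x'_k,u_j)$ if $\bar B_{kj}=*$; $(u_j,u'_j)$; $(u'_j,t)$; $(x_r,t)$. The edges $(u'_j,t)$ have capacity $n+1$ and cost $c(u'_j,t)=p_u(j)$; all other edges have capacity $1$ and cost $0$. A feasible flow $f\ge 0$ respects the capacities and is conserved at every vertex other than $s,t$; its value is $\varphi_f=\sum_{e=(s,v)}f(e)$ and its cost is $c_f=\sum_{e:f(e)>0}c(e)$. The *minimum cost fixed flow problem* MCFF($q+n$) is to minimize $c_f$ over the feasible flows $f$ with $\varphi_f\ge q+n$; let $c^*$ be its optimal value. **Theorem.** 1. There is an algorithm (a single program for a random access machine with unit-cost additions, subtractions, comparisons, memory accesses and copies of costs) which, for all $n,m$, from $\bar A,\bar B$ (stored as arrays) and $p_u$, constructs the network $\mathcal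 F(\bar A,\bar B,c)$ (as a list of edges with capacities and costs) and the flow requirement $q+n$. For $n\ge 1$ it takes $O(n(n+m))$ steps; in particular it takes $O(n^2)$ steps when $m=O(n)$. 2. Let $(\bar A,\bar B)$ be structurally controllable and $p_u\ge0$. Both optimal values $p^*$ and $c^*$ are attained. If $f^*_M$ is an optimal solution of MCFF($q+n$) on $\mathcal F(\bar A,\bar B,c)$, then $\mathcal I_{f^*_M}=\{j:f^*_M(u'_j,t)>0\}$ is an optimal solution of minCCIS. Moreover $p^*=c^*$. -/

import Mathlib

open scoped NNReal Matrix

/-! ## Controllability and structured systems -/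

/-- The linear system `x' = A x + B u` is controllable: every initial state can be driven to every
final state in some finite time by some (continuous) input signal. -/
def Controllable {n : ℕ} {ι : Type} [Fintype ι]
    (A : Matrix (Fin n) (Fin n) ℝ) (B : Matrix (Fin n) ι ℝ) : Prop :=
  ∀ x₀ x₁ : Fin n → ℝ, ∃ T : ℝ, 0 < T ∧ ∃ (u : ℝ → ι → ℝ) (x : ℝ → Fin n → ℝ),
    ContinuousOn u (Set.Icc 0 T) ∧ x 0 = x₀ ∧ x T = x₁ ∧
    ∀ τ ∈ Set.Icc 0 T, HasDerivWithinAt x (A *ᵥ x τ + B *ᵥ u τ) (Set.Icc 0 T) τ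

/-- A zero pattern is a Boolean matrix; `true` stands for a free entry `*`, `false` for `0`.
`M` is a numerical realization of the pattern `P` if it vanishes wherever `P` does. -/
def IsRealization {ι κ : Type} (P : Matrix ι κ Bool) (M : Matrix ι κ ℝ) : Prop :=
  ∀ i j, P i j = false → M i j = 0

def StructurallyControllable {n : ℕ} {ι : Type} [Fintype ι]
    (A : Matrix (Fin n) (Fin n) Bool) (B : Matrix (Fin n) ι Bool) : Prop :=
  ∃ (A' : Matrix (Fin n) (Fin n) ℝ) (B' : Matrix (Fin n) ι ℝ),
    IsRealization A A' ∧ IsRealization B B' ∧ Controllable A' B'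

/-- The restriction of `B` to the columns in `W`. -/
def restrictCols {n m : ℕ} (B : Matrix (Fin n) (Fin m) Bool) (W : Finset (Fin m)) :
    Matrix (Fin n) {j // j ∈ W} Bool :=
  fun i j => B i j.1

/-! ## Minimum cost constrained input selection (minCCIS) -/

/-- The set `𝒦` of input sets that keep the system structurally controllable. -/
def feasibleSelections {n m : ℕ} (A : Matrix (Fin n) (Fin n) Bool)
    (B : Matrix (Fin n) (Fin m) Bool) : Set (Finset (Fin m)) :=
  {W | StructurallyControllable A (restrictCols B W)}

def selectionCost {m : ℕ} (p : Fin m → ℝ≥0) (I : Finset (Fin m)) : ℝ≥0 :=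
  ∑ j ∈ I, p j

/-- `I` is an optimal solution of minCCIS. -/
def IsOptimalSelection {n m : ℕ} (A : Matrix (Fin n) (Fin n) Bool)
    (B : Matrix (Fin n) (Fin m) Bool) (p : Fin m → ℝ≥0) (I : Finset (Fin m)) : Prop :=
  I ∈ feasibleSelections A B ∧
    ∀ J ∈ feasibleSelections A B, selectionCost p I ≤ selectionCost p J

/-- The values of the objective function of minCCIS. -/
def selectionCosts {n m : ℕ} (A : Matrix (Fin n) (Fin n) Bool)
    (B : Matrix (Fin n) (Fin m) Bool) (p : Fin m → ℝ≥0) : Set ℝ≥0 :=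
  selectionCost p '' feasibleSelections A B

/-- The optimal value `p*` of minCCIS. -/
noncomputable def pStar {n m : ℕ} (A : Matrix (Fin n) (Fin n) Bool)
    (B : Matrix (Fin n) (Fin m) Bool) (p : Fin m → ℝ≥0) : ℝ≥0 :=
  sInf (selectionCosts A B p)

/-! ## Flow networks and the minimum cost fixed flow problem (MCFF) -/

structure FlowNetwork (V : Type) where
  source : V
  sink : V
  edges : Finset (V × V)
  cap : V × V → ℝ≥0
  cost : V × V → ℝ≥0

namespace FlowNetwork

variable {V : Type} (N : FlowNetwork V)

/-- A flow vector is a nonnegative function on the edges; only its values on `N.edges` are ever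
used. It is feasible if it satisfies the capacity and flow conservation constraints. -/
def IsFeasible (f : V × V → ℝ≥0) : Prop :=
  (∀ e ∈ N.edges, f e ≤ N.cap e) ∧
  open Classical in
  ∀ v : V, v ≠ N.source → v ≠ N.sink →
    ∑ e ∈ N.edges with e.2 = v, f e = ∑ e ∈ N.edges with e.1 = v, f e

open Classical in
/-- The flow `φ_f` from the source to the sink. -/
noncomputable def value (f : V × V → ℝ≥0) : ℝ≥0 :=
  ∑ e ∈ N.edges with e.1 = N.source, f e

open Classical in
/-- The cost `c_f`: the total cost of the edges that carry positive flow. -/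
noncomputable def usedCost (f : V × V → ℝ≥0) : ℝ≥0 :=
  ∑ e ∈ N.edges with 0 < f e, N.cost e

/-- `f` is a feasible solution of MCFF(`φ`). -/
def IsMCFFFeasible (φ : ℝ≥0) (f : V × V → ℝ≥0) : Prop :=
  N.IsFeasible f ∧ φ ≤ N.value f

/-- `f` is an optimal solution of MCFF(`φ`). -/
def IsMCFFOptimal (φ : ℝ≥0) (f : V × V → ℝ≥0) : Prop :=
  N.IsMCFFFeasible φ f ∧ ∀ g, N.IsMCFFFeasible φ g → N.usedCost f ≤ N.usedCost g

/-- The values of the objective function of MCFF(`φ`). -/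
def mcffCosts (φ : ℝ≥0) : Set ℝ≥0 :=
  N.usedCost '' {f | N.IsMCFFFeasible φ f}

/-- The optimal value `c*` of MCFF(`φ`). -/
noncomputable def mcffOptimum (φ : ℝ≥0) : ℝ≥0 :=
  sInf (N.mcffCosts φ)

end FlowNetwork

/-! ## The flow network of a structured system -/

/-- Reachability in the state digraph, which has an edge `x_j → x_i` iff `A i j = *`. -/
def StateReach {n : ℕ} (A : Matrix (Fin n) (Fin n) Bool) : Fin n → Fin n → Prop :=
  Relation.ReflTransGen (fun j i => A i j = true)

/-- `S` is (the vertex set of) a strongly connected component of the state digraph. -/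
def IsSCC {n : ℕ} (A : Matrix (Fin n) (Fin n) Bool) (S : Finset (Fin n)) : Prop :=
  Maximal (fun U : Finset (Fin n) => U.Nonempty ∧ ∀ v ∈ U, ∀ w ∈ U, StateReach A v w) S

/-- An SCC is non-top linked if no edge enters it from another SCC. -/
def IsNonTopLinked {n : ℕ} (A : Matrix (Fin n) (Fin n) Bool) (S : Finset (Fin n)) : Prop :=
  IsSCC A S ∧ ∀ j, j ∉ S → ∀ i ∈ S, A i j = false

open Classical in
noncomputable def nonTopSCCs {n : ℕ} (A : Matrix (Fin n) (Fin n) Bool) :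
    Finset (Finset (Fin n)) :=
  Finset.univ.filter (IsNonTopLinked A)

/-- The number `q` of non-top linked SCCs. -/
noncomputable def numNonTop {n : ℕ} (A : Matrix (Fin n) (Fin n) Bool) : ℕ :=
  (nonTopSCCs A).card

noncomputable section

/-- Vertices: `s`, `t`, the non-top linked SCCs `𝒩_i`, the states `x_r`, their copies `x'_k`,
the inputs `u_j` and their copies `u'_j`. -/
inductive SysVertex {n : ℕ} (m : ℕ) (A : Matrix (Fin n) (Fin n) Bool) : Type
  | s
  | t
  | scc (N : {N : Finset (Fin n) // N ∈ nonTopSCCs A})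
  | x' (k : Fin n)
  | x (r : Fin n)
  | u (j : Fin m)
  | u' (j : Fin m)
  deriving DecidableEq, Fintype

end

namespace SysVertex

/-- The edges of the flow network of the structured system. -/
def IsEdge {n m : ℕ} {A : Matrix (Fin n) (Fin n) Bool} (B : Matrix (Fin n) (Fin m) Bool) :
    SysVertex m A → SysVertex m A → Prop
  | s, scc _ => True
  | s, x' _ => True
  | scc N, u' j => ∃ r ∈ N.1, B r j = true
  | x' k, x r => A k r = true
  | x' k, u j => B k j = true
  | u j, u' j' => j = j'
  | u' _, t => True
  | x _, t => True
  | _, _ => False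

/-- Edge capacities: `n + 1` on the edges `(u'_j, t)`, and `1` elsewhere. -/
def capacity {n m : ℕ} {A : Matrix (Fin n) (Fin n) Bool} :
    SysVertex m A × SysVertex m A → ℝ≥0
  | (u' _, t) => n + 1
  | _ => 1

/-- Edge costs: `p j` on the edge `(u'_j, t)`, and `0` elsewhere. -/
def edgeCost {n m : ℕ} {A : Matrix (Fin n) (Fin n) Bool} (p : Fin m → ℝ≥0) :
    SysVertex m A × SysVertex m A → ℝ≥0
  | (u' j, t) => p j
  | _ => 0

/-- Vertex numbers, given an enumeration `ν` of the non-top linked SCCs. -/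
def code {n m : ℕ} {A : Matrix (Fin n) (Fin n) Bool}
    (ν : {N : Finset (Fin n) // N ∈ nonTopSCCs A} ≃ Fin (numNonTop A)) : SysVertex m A → ℕ
  | s => 0
  | t => 1
  | x' k => 2 + k
  | x r => 2 + n + r
  | u j => 2 + 2 * n + j
  | u' j => 2 + 2 * n + m + j
  | scc N => 2 + 2 * n + 2 * m + ν N

end SysVertex

open Classical in
/-- The flow network `ℱ(A, B, c)`. -/
noncomputable def systemNetwork {n m : ℕ} (A : Matrix (Fin n) (Fin n) Bool)
    (B : Matrix (Fin n) (Fin m) Bool) (p : Fin m → ℝ≥0) : FlowNetwork (SysVertex m A) where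
  source := .s
  sink := .t
  edges := Finset.univ.filter (fun e => SysVertex.IsEdge B e.1 e.2)
  cap := SysVertex.capacity
  cost := SysVertex.edgeCost p

/-- The set `I_f = {j : f(u'_j, t) > 0}` of inputs used by a flow vector. -/
noncomputable def flowInputs {n m : ℕ} {A : Matrix (Fin n) (Fin n) Bool}
    (f : SysVertex m A × SysVertex m A → ℝ≥0) : Finset (Fin m) :=
  Finset.univ.filter (fun j => 0 < f (.u' j, .t))

/-! ## A random access machine with unit-cost steps

Programs are finite structured programs. They use finitely many integer registers, integer arrays
and arrays of weights, each given by a fixed number in the program text. The only arithmetic is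
addition, truncated subtraction and comparison of natural numbers; weights can only be copied and
set to zero. Every operation, memory access, assignment and test counts as one step. -/

namespace RAM

structure State where
  reg : ℕ → ℕ
  arr : ℕ → ℕ → ℕ
  wt : ℕ → ℕ → ℝ≥0

inductive Exp : Type
  | lit (k : ℕ)
  | reg (r : ℕ)
  | arr (a : ℕ) (i : Exp)
  | add (e₁ e₂ : Exp)
  | sub (e₁ e₂ : Exp)
  | lt (e₁ e₂ : Exp)
  | eq (e₁ e₂ : Exp)

namespace Exp

def eval (S : State) : Exp → ℕ
  | lit k => k
  | reg r => S.reg r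
  | arr a i => S.arr a (i.eval S)
  | add e₁ e₂ => e₁.eval S + e₂.eval S
  | sub e₁ e₂ => e₁.eval S - e₂.eval S
  | lt e₁ e₂ => if e₁.eval S < e₂.eval S then 1 else 0
  | eq e₁ e₂ => if e₁.eval S = e₂.eval S then 1 else 0

/-- The number of steps that the evaluation of an expression takes. -/
def steps : Exp → ℕ
  | lit _ => 1
  | reg _ => 1
  | arr _ i => i.steps + 1
  | add e₁ e₂ => e₁.steps + e₂.steps + 1
  | sub e₁ e₂ => e₁.steps + e₂.steps + 1
  | lt e₁ e₂ => e₁.steps + e₂.steps + 1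
  | eq e₁ e₂ => e₁.steps + e₂.steps + 1

end Exp

namespace State

def setReg (S : State) (r v : ℕ) : State :=
  { S with reg := Function.update S.reg r v }

def setArr (S : State) (a i v : ℕ) : State :=
  { S with arr := Function.update S.arr a (Function.update (S.arr a) i v) }

def setWt (S : State) (a i : ℕ) (w : ℝ≥0) : State :=
  { S with wt := Function.update S.wt a (Function.update (S.wt a) i w) }

end State

inductive Prog : Type
  | skip
  | setReg (r : ℕ) (e : Exp)
  | setArr (a : ℕ) (i e : Exp)
  | zeroWt (a : ℕ) (i : Exp)
  | copyWt (a : ℕ) (i : Exp) (b : ℕ) (j : Exp)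
  | seq (P Q : Prog)
  | ite (c : Exp) (P Q : Prog)
  | loop (c : Exp) (P : Prog)

/-- `Runs P S S' T`: started in the state `S`, the program `P` halts in the state `S'` after
exactly `T` steps. The conditions of `ite` and `loop` hold if their value is nonzero. -/
inductive Runs : Prog → State → State → ℕ → Prop
  | skip (S : State) : Runs .skip S S 1
  | setReg (S : State) (r : ℕ) (e : Exp) :
      Runs (.setReg r e) S (S.setReg r (e.eval S)) (e.steps + 1)
  | setArr (S : State) (a : ℕ) (i e : Exp) :
      Runs (.setArr a i e) S (S.setArr a (i.eval S) (e.eval S)) (i.steps + e.steps + 1)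
  | zeroWt (S : State) (a : ℕ) (i : Exp) :
      Runs (.zeroWt a i) S (S.setWt a (i.eval S) 0) (i.steps + 1)
  | copyWt (S : State) (a : ℕ) (i : Exp) (b : ℕ) (j : Exp) :
      Runs (.copyWt a i b j) S (S.setWt a (i.eval S) (S.wt b (j.eval S)))
        (i.steps + j.steps + 1)
  | seq {P Q : Prog} {S S' S'' : State} {T T' : ℕ} :
      Runs P S S' T → Runs Q S' S'' T' → Runs (.seq P Q) S S'' (T + T')
  | iteTrue {c : Exp} {P Q : Prog} {S S' : State} {T : ℕ} :
      c.eval S ≠ 0 → Runs P S S' T → Runs (.ite c P Q) S S' (c.steps + 1 + T)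
  | iteFalse {c : Exp} {P Q : Prog} {S S' : State} {T : ℕ} :
      c.eval S = 0 → Runs Q S S' T → Runs (.ite c P Q) S S' (c.steps + 1 + T)
  | loopTrue {c : Exp} {P : Prog} {S S' S'' : State} {T T' : ℕ} :
      c.eval S ≠ 0 → Runs P S S' T → Runs (.loop c P) S' S'' T' →
      Runs (.loop c P) S S'' (c.steps + 1 + T + T')
  | loopFalse {c : Exp} {P : Prog} {S : State} :
      c.eval S = 0 → Runs (.loop c P) S S (c.steps + 1)

/-- A Boolean matrix, stored row by row as zeros and ones. -/
def flatten {k l : ℕ} (M : Matrix (Fin k) (Fin l) Bool) (i : ℕ) : ℕ :=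
  if h : i < k * l then
    (M (finProdFinEquiv.symm ⟨i, h⟩).1 (finProdFinEquiv.symm ⟨i, h⟩).2).toNat
  else 0

/-- The input: `n` and `m` in registers 0 and 1, the patterns `A` and `B` in the integer arrays
0 and 1, the cost vector in the weight array 0, and zeros everywhere else. -/
def inputState {n m : ℕ} (A : Matrix (Fin n) (Fin n) Bool) (B : Matrix (Fin n) (Fin m) Bool)
    (p : Fin m → ℝ≥0) : State where
  reg r := if r = 0 then n else if r = 1 then m else 0
  arr a i := if a = 0 then flatten A i else if a = 1 then flatten B i else 0
  wt a i := if h : i < m then (if a = 0 then p ⟨i, h⟩ else 0) else 0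

/-- The state `S` holds the flow network `N` as an edge list, where `code` numbers the vertices
consecutively from `0`: the number of vertices, the source, the sink and the number of edges are
in registers 0 to 3; tail, head and capacity of the edges are in the integer arrays 0 to 2; their
costs are in the weight array 0. Every edge is listed exactly once. -/
def EncodesNetwork {V : Type} [Fintype V] (S : State) (N : FlowNetwork V) (code : V → ℕ) : Prop :=
  Function.Injective code ∧ (∀ v, code v < Fintype.card V) ∧
  S.reg 0 = Fintype.card V ∧ S.reg 1 = code N.source ∧ S.reg 2 = code N.sink ∧
  S.reg 3 = N.edges.card ∧
  ∃ edge : Fin N.edges.card ≃ {e // e ∈ N.edges}, ∀ k : Fin N.edges.card,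
    S.arr 0 k = code (edge k).1.1 ∧ S.arr 1 k = code (edge k).1.2 ∧
    (S.arr 2 k : ℝ≥0) = N.cap (edge k).1 ∧ S.wt 0 k = N.cost (edge k).1

/-- The state `S` holds the MCFF instance of the structured system: the network `ℱ(A, B, c)`, the
flow requirement `q + n` in register 4, and, in the integer array 3, for every state the number
of the non-top linked SCC that contains it, if there is one. -/
def HoldsInstance {n m : ℕ} (A : Matrix (Fin n) (Fin n) Bool) (B : Matrix (Fin n) (Fin m) Bool)
    (p : Fin m → ℝ≥0) (S : State) : Prop :=
  ∃ ν : {N : Finset (Fin n) // N ∈ nonTopSCCs A} ≃ Fin (numNonTop A),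
    EncodesNetwork S (systemNetwork A B p) (SysVertex.code ν) ∧
    S.reg 4 = numNonTop A + n ∧
    ∀ (r : Fin n) (N : {N : Finset (Fin n) // N ∈ nonTopSCCs A}),
      S.arr 3 r = SysVertex.code (m := m) ν (.scc N) ↔ r ∈ N.1

end RAM

/-!
The theorem combines Lin's characterization of structural controllability with a correctness proof
of a concrete program.

*Optimal flows and optimal selections.* By Lin's theorem (`structurallyControllable_iff`) a
structured system is structurally controllable iff every non-top linked component is acted on by an
input and the bipartite graph that joins every state `k` to the states and inputs with an edge into
`k` has a matching that covers all states `k`. Necessity holds because otherwise a nonzero linear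
image of the state evolves independently of the input. For sufficiency, the matching splits the
states into paths that start at inputs and into cycles. The paths are realized with unit weights;
then the cycles are added one at a time, each through one edge that enters it from the part
constructed so far, and with weights that make its eigenvalues exceed a bound beyond which that part
responds to the cycle (`StructuralRealization.Stage.exists_larger`). The realization obtained
satisfies the Hautus condition, which implies controllability (`controllable_of_hautus`).

A flow of value `q + n` saturates all edges at the source. On the edges at the copies `x'_k` such a
flow is a fractional matching that covers all states, so by Hall's theorem some of these edges form
a matching; the unit of flow through a component `N` shows that an input that is used
acts on `N`. Hence the inputs used by the flow satisfy the two conditions. Conversely, the two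
conditions for a selection yield a flow that uses no other inputs
(`exists_flow_of_mem_feasibleSelections`): a copy `u'_j` receives at most one unit from each of the
`q ≤ n` components and at most one from `u_j`, which the capacity `n + 1` admits. As the cost of a
flow is the cost of the set of inputs it uses, the two problems have the same optimal value.

*Construction of the network.* The components are found by three sweeps of breadth-first searches
that share their colours, and therefore take quadratic time each. A sweep over all states yields
roots that reach every state; every non-top linked component contains exactly one root, but there
may be roots outside these components. Their searches precede those of the roots that reach them.
A second sweep over the roots in reverse order hence keeps just one root for each non-top linked
component, and a third sweep, along reversed edges, colours the set of states from which such a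
root can be reached, which is the component itself (`RAM.Swept.exists_numbering`). The list of edges
is then written in time proportional to the number of pairs inspected; an edge from a component to
an input copy is listed once only, because for every component the last input linked to it is
recorded (`RAM.Ends.linkStep`).

The time bounds come from a program logic for the machine (`RAM.Ends`), in which loop invariants may
refer to the time elapsed.
-/

/-! ### Linear control systems -/

/-- If a linear image `L x` of the state evolves autonomously, then `L` vanishes for a controllable
system: no input can drive `L x` away from `0`. -/
theorem Controllable.eq_zero_of_autonomous {n : ℕ} {ι E : Type} [Fintype ι]
    [NormedAddCommGroup E] [NormedSpace ℝ E]
    {A : Matrix (Fin n) (Fin n) ℝ} {B : Matrix (Fin n) ι ℝ} (h : Controllable A B)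
    (L : (Fin n → ℝ) →L[ℝ] E) (K : E →L[ℝ] E)
    (hLK : ∀ x u, L (A *ᵥ x + B *ᵥ u) = K (L x)) (x₁ : Fin n → ℝ) : L x₁ = 0 := by
  obtain ⟨T, hT, u, x, -, hx0, hxT, hx⟩ := h 0 x₁
  have hd : ∀ τ ∈ Set.Icc 0 T, HasDerivWithinAt (fun τ => L (x τ)) (K (L (x τ)))
      (Set.Icc 0 T) τ := by
    intro τ hτ
    rw [← hLK _ (u τ)]
    exact L.hasFDerivAt.comp_hasDerivWithinAt τ (hx τ hτ)
  have key := ODE_solution_unique (v := fun _ y => K y) (K := ‖K‖₊) (a := 0) (b := T)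
    (f := fun τ => L (x τ)) (g := fun _ => 0) (fun _ => K.lipschitz)
    (fun τ hτ => (hd τ hτ).continuousWithinAt)
    (fun τ hτ => (hd τ ⟨hτ.1, hτ.2.le⟩).mono_of_mem_nhdsWithin
      (Icc_mem_nhdsGE_of_mem hτ))
    continuousOn_const (fun τ _ => by simpa using hasDerivWithinAt_const τ _ (0 : E))
    (by simp [hx0])
  simpa [hxT] using key (Set.right_mem_Icc.2 hT.le)

theorem Controllable.eq_zero_of_vecMul_eq_zero {n : ℕ} {ι : Type} [Fintype ι]
    {A : Matrix (Fin n) (Fin n) ℝ} {B : Matrix (Fin n) ι ℝ} (h : Controllable A B)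
    (v : Fin n → ℝ) (hA : v ᵥ* A = 0) (hB : v ᵥ* B = 0) : v = 0 := by
  have key := h.eq_zero_of_autonomous
    (LinearMap.toContinuousLinearMap (dotProductBilin ℝ ℝ v)) 0 (by
      intro x u
      simp [dotProductBilin, dotProduct_add, Matrix.dotProduct_mulVec, hA, hB]) v
  simpa [dotProductBilin] using key

/-- A nonempty set of states that no state outside it and no input acts on prevents
controllability. -/
theorem Controllable.eq_empty_of_isolated {n : ℕ} {ι : Type} [Fintype ι]
    {A : Matrix (Fin n) (Fin n) ℝ} {B : Matrix (Fin n) ι ℝ} (h : Controllable A B)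
    (N : Finset (Fin n)) (hA : ∀ i ∈ N, ∀ j ∉ N, A i j = 0) (hB : ∀ i ∈ N, ∀ j, B i j = 0) :
    N = ∅ := by
  classical
  have key := h.eq_zero_of_autonomous
    (LinearMap.toContinuousLinearMap
      (Matrix.mulVecLin (Matrix.diagonal fun i => if i ∈ N then (1 : ℝ) else 0)))
    (LinearMap.toContinuousLinearMap
      (Matrix.mulVecLin (Matrix.of fun i j => if i ∈ N then A i j else 0))) (by
      intro x u
      ext i
      by_cases hi : i ∈ N
      · simp only [LinearMap.coe_toContinuousLinearMap', Matrix.mulVecLin_apply,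
          Matrix.mulVec_diagonal, hi, if_true, one_mul, Pi.add_apply]
        simp only [Matrix.mulVec, dotProduct, Matrix.of_apply, hi, if_true, hB i hi, zero_mul,
          Finset.sum_const_zero, add_zero]
        refine Finset.sum_congr rfl fun j _ => ?_
        by_cases hj : j ∈ N
        · simp [Matrix.diagonal_apply, hj]
        · simp [hA i hi j hj]
      · simp only [LinearMap.coe_toContinuousLinearMap', Matrix.mulVecLin_apply,
          Matrix.mulVec_diagonal, hi, if_false, zero_mul]
        simp [Matrix.mulVec, dotProduct, hi]) (fun _ => 1)
  rw [Finset.eq_empty_iff_forall_notMem]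
  intro i hi
  have := congrFun key i
  simp [Matrix.mulVec_diagonal, hi] at this

section Steering

open NormedSpace intervalIntegral

variable {n : ℕ} {ι : Type} [Fintype ι]

theorem hasDerivAt_exp_smul_clm {E : Type} [NormedAddCommGroup E] [NormedSpace ℝ E]
    [CompleteSpace E] (L : E →L[ℝ] E) (t : ℝ) :
    HasDerivAt (fun u : ℝ => exp (u • L)) (L * exp (t • L)) t :=
  hasDerivAt_exp_smul_const' L t

/-- If no nonzero row vector `v` satisfies `v A ^ k B = 0` for all `k`, then the system is
controllable: the controllability Gramian is invertible, and it provides the control. -/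
theorem controllable_of_krylov (A : Matrix (Fin n) (Fin n) ℝ) (B : Matrix (Fin n) ι ℝ)
    (h : ∀ v : Fin n → ℝ, (∀ k : ℕ, v ᵥ* (A ^ k * B) = 0) → v = 0) : Controllable A B := by
  classical
  let L : (Fin n → ℝ) →L[ℝ] (Fin n → ℝ) := LinearMap.toContinuousLinearMap A.mulVecLin
  have hL : ∀ x, L x = A *ᵥ x := fun x => rfl
  let E : ℝ → (Fin n → ℝ) →L[ℝ] (Fin n → ℝ) := fun t => exp (t • L)
  have hE : ∀ t, HasDerivAt E (L * E t) t := fun t => hasDerivAt_exp_smul_clm L t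
  have hEc : Continuous E := continuous_iff_continuousAt.2 fun t => (hE t).continuousAt
  have hcomm : ∀ t, L * E t = E t * L := fun t =>
    ((Commute.refl L).smul_right t).exp_right.eq
  have hEneg : ∀ t, E t * E (-t) = 1 := by
    intro t
    have hc : Commute (t • L) ((-t) • L) := ((Commute.refl L).smul_right _).smul_left _
    let _ : NormedAlgebra ℚ ((Fin n → ℝ) →L[ℝ] (Fin n → ℝ)) := NormedAlgebra.restrictScalars ℚ ℝ _
    simp only [E]
    rw [← exp_add_of_commute hc, ← add_smul, add_neg_cancel, zero_smul, exp_zero]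
  have hEneg' : ∀ t, HasDerivAt (fun s => E (-s)) (-(L * E (-t))) t := by
    intro t
    exact ((hE (-t)).scomp t (hasDerivAt_neg t)).congr_deriv (by simp)
  have hE0 : E 0 = 1 := by simp [E]
  let b : ι → Fin n → ℝ := fun j i => B i j
  -- the control is `s ↦ w exp(-s A) B`, with `w` to be chosen; `G` maps `w` to the effect of this
  -- control on `exp(-A) x(1)`, and is the controllability Gramian
  let φ : (Fin n → ℝ) → ℝ → (Fin n → ℝ) → ℝ := fun w s X => w ⬝ᵥ E (-s) X
  have hφc : ∀ w X, Continuous fun s => φ w s X := by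
    intro w X
    have : Continuous fun s => E (-s) X := (hEc.comp continuous_neg).clm_apply continuous_const
    exact continuous_const.dotProduct this
  have hBu : ∀ u : ι → ℝ, B *ᵥ u = ∑ j, u j • b j := by
    intro u; ext i; simp [Matrix.mulVec, dotProduct, b, mul_comm]
  let g : (Fin n → ℝ) → ℝ → (Fin n → ℝ) := fun w s => E (-s) (B *ᵥ fun j => φ w s (b j))
  have hgc : ∀ w, Continuous (g w) := by
    intro w
    refine (hEc.comp continuous_neg).clm_apply ?_
    exact continuous_const.matrix_mulVec (continuous_pi fun j => hφc w (b j))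
  let G : (Fin n → ℝ) →ₗ[ℝ] (Fin n → ℝ) :=
    { toFun := fun w => ∫ s in (0:ℝ)..1, g w s
      map_add' := by
        intro w w'
        rw [← integral_add ((hgc w).intervalIntegrable _ _) ((hgc w').intervalIntegrable _ _)]
        congr 1; ext1 s
        simp only [g, φ, ← map_add, ← Matrix.mulVec_add]
        congr 2; ext j; simp [add_dotProduct]
      map_smul' := by
        intro c w
        rw [RingHom.id_apply, ← integral_smul]
        congr 1; ext1 s
        simp only [g, φ, ← map_smul, ← Matrix.mulVec_smul]
        congr 2; ext j; simp [smul_dotProduct] }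
  have hG : ∀ w, G w = ∫ s in (0:ℝ)..1, g w s := fun w => rfl
  have hinj : Function.Injective G := by
    rw [injective_iff_map_eq_zero]
    intro w hw
    have h1 : ∫ s in (0:ℝ)..1, ∑ j, (φ w s (b j)) ^ 2 = 0 := by
      have := congrArg (LinearMap.toContinuousLinearMap (dotProductBilin ℝ ℝ w)) hw
      rw [hG, ← ContinuousLinearMap.intervalIntegral_comp_comm _
        ((hgc w).intervalIntegrable _ _)] at this
      rw [map_zero] at this
      rw [← this]
      congr 1; ext1 s
      simp only [g, hBu, map_sum, map_smul]
      refine Finset.sum_congr rfl fun j _ => ?_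
      simp [dotProductBilin, φ, sq]
    have hcont : Continuous fun s => ∑ j, (φ w s (b j)) ^ 2 :=
      continuous_finsetSum _ fun j _ => (hφc w (b j)).pow 2
    have h2 : ∀ s ∈ Set.Icc (0:ℝ) 1, ∑ j, (φ w s (b j)) ^ 2 = 0 := by
      by_contra! hne
      obtain ⟨s, hs, hne⟩ := hne
      have hnn : ∀ s, 0 ≤ ∑ j, (φ w s (b j)) ^ 2 :=
        fun s => Finset.sum_nonneg fun j _ => sq_nonneg _
      have := integral_pos (a := (0:ℝ)) (b := 1) one_pos hcont.continuousOn (fun x _ => hnn x)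
        ⟨s, hs, lt_of_le_of_ne (hnn s) (Ne.symm hne)⟩
      linarith
    -- differentiate `w exp(-s A) B = 0` repeatedly
    have h3 : ∀ (k : ℕ) (j : ι), ∀ s ∈ Set.Icc (0:ℝ) 1, φ w s (A ^ k *ᵥ b j) = 0 := by
      intro k
      induction k with
      | zero =>
        intro j s hs
        have := (Finset.sum_eq_zero_iff_of_nonneg (fun j _ => sq_nonneg _)).1 (h2 s hs) j
          (Finset.mem_univ j)
        simpa using this
      | succ k ih =>
        intro j s hs
        have hd : HasDerivAt (fun s => φ w s (A ^ k *ᵥ b j)) (-(φ w s (A ^ (k + 1) *ᵥ b j))) s := by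
          have h4 := (LinearMap.toContinuousLinearMap
            (dotProductBilin ℝ ℝ w)).hasFDerivAt.comp_hasDerivAt s
              ((hEneg' s).clm_apply (hasDerivAt_const s (A ^ k *ᵥ b j)))
          refine h4.congr_deriv ?_
          rw [hcomm]
          simp [φ, dotProductBilin, hL, pow_succ']
        have hz : HasDerivWithinAt (fun s => φ w s (A ^ k *ᵥ b j)) 0 (Set.Icc 0 1) s :=
          (hasDerivWithinAt_const s _ (0:ℝ)).congr (fun x hx => ih j x hx) (ih j s hs)
        have := (uniqueDiffOn_Icc (zero_lt_one' ℝ) s hs).eq_deriv _ hd.hasDerivWithinAt hz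
        linarith
    refine h w fun k => ?_
    ext j
    have := h3 k j 0 (by simp)
    simp only [φ, neg_zero, hE0, one_apply_eq_self] at this
    rw [Pi.zero_apply, ← this]
    simp [Matrix.vecMul, Matrix.mulVec, b, Matrix.mul_apply, dotProduct]
  have hsurj : Function.Surjective G := LinearMap.surjective_of_injective hinj
  intro x₀ x₁
  obtain ⟨w, hw⟩ := hsurj (E (-1) x₁ - x₀)
  refine ⟨1, one_pos, fun s j => φ w s (b j), fun t => E t (x₀ + ∫ s in (0:ℝ)..t, g w s),
    (continuous_pi fun j => hφc w (b j)).continuousOn, by simp [hE0], ?_, ?_⟩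
  · change E 1 (x₀ + G w) = x₁
    rw [hw]
    have := congrArg (fun F => F x₁) (hEneg 1)
    simpa using this
  · intro τ _
    have h1 : HasDerivAt (fun t => x₀ + ∫ s in (0:ℝ)..t, g w s) (g w τ) τ :=
      (integral_hasDerivAt_right ((hgc w).intervalIntegrable _ _)
        (hgc w).stronglyMeasurable.stronglyMeasurableAtFilter (hgc w).continuousAt).const_add _
    have h2 := ((hE τ).clm_apply h1).hasDerivWithinAt (s := Set.Icc 0 1)
    refine h2.congr_deriv ?_
    have := congrArg (fun F => F (B *ᵥ fun j => φ w τ (b j))) (hEneg τ)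
    simp only [mul_apply_eq_comp, one_apply_eq_self] at this
    simp only [g, this]
    simp [hL]

/-- The Hautus test: if no complex left eigenvector of `A` is annihilated by `B`, then the system
is controllable. -/
theorem controllable_of_hautus (A : Matrix (Fin n) (Fin n) ℝ) (B : Matrix (Fin n) ι ℝ)
    (h : ∀ (μ : ℂ) (v : Fin n → ℂ), v ᵥ* A.map Complex.ofReal = μ • v →
      v ᵥ* B.map Complex.ofReal = 0 → v = 0) : Controllable A B := by
  refine controllable_of_krylov A B fun v hv => ?_
  by_contra hne
  let A' := A.map Complex.ofReal
  let B' := B.map Complex.ofReal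
  -- the largest invariant subspace of row vectors annihilated by `B`
  let U : Submodule ℂ (Fin n → ℂ) := ⨅ k : ℕ, LinearMap.ker (Matrix.vecMulLinear (A' ^ k * B'))
  have hU : ∀ w, w ∈ U ↔ ∀ k : ℕ, w ᵥ* (A' ^ k * B') = 0 := by
    intro w; simp [U, Submodule.mem_iInf]
  have hinv : ∀ w ∈ U, Matrix.vecMulLinear A' w ∈ U := by
    intro w hw
    rw [hU] at hw ⊢
    intro k
    rw [Matrix.vecMulLinear_apply, Matrix.vecMul_vecMul, ← Matrix.mul_assoc, ← pow_succ']
    exact hw (k + 1)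
  have hvU : (fun i => (v i : ℂ)) ∈ U := by
    rw [hU]
    intro k
    have h1 : A' ^ k * B' = (A ^ k * B).map Complex.ofReal := by
      have h2 : (A ^ k).map Complex.ofReal = A' ^ k := Matrix.map_pow A Complex.ofRealHom k
      have h3 := Matrix.map_mul (L := A ^ k) (M := B) (f := Complex.ofRealHom)
      rw [← h2]
      exact h3.symm
    rw [h1]
    ext j
    have := congrFun (hv k) j
    simp only [Matrix.vecMul, dotProduct, Matrix.map_apply, Pi.zero_apply] at this ⊢
    exact_mod_cast this
  have hnt : Nontrivial U := by
    refine ⟨⟨⟨_, hvU⟩, 0, fun h0 => hne ?_⟩⟩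
    ext i
    have := congrFun (congrArg Subtype.val h0) i
    simpa using this
  obtain ⟨μ, hμ⟩ := Module.End.exists_eigenvalue ((Matrix.vecMulLinear A').restrict hinv)
  obtain ⟨w, hw⟩ := hμ.exists_hasEigenvector
  have h1 := congrArg Subtype.val hw.apply_eq_smul
  refine hw.2 (Subtype.ext ?_)
  refine h μ w.1 (by simpa using h1) ?_
  have := (hU w.1).1 w.2 0
  simpa [A', B'] using this

end Steering

/-! ### Realizations of an accessible pattern with a perfect matching -/

namespace StructuralRealization

variable {V ι : Type}

/-- The value at a vertex of a vector of states, extended by `0` to the inputs. -/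
def extend (v : V → ℂ) : V ⊕ ι → ℂ := Sum.elim v 0

/-- `y` is an input or a state in `S`. -/
def Known (S : Set V) : V ⊕ ι → Prop := Sum.elim (· ∈ S) (fun _ => True)

@[simp] theorem extend_inl (v : V → ℂ) (k : V) : extend (ι := ι) v (.inl k) = v k := rfl
@[simp] theorem extend_inr (v : V → ℂ) (j : ι) : extend v (.inr j) = 0 := rfl
@[simp] theorem known_inl (S : Set V) (k : V) : Known (ι := ι) S (.inl k) ↔ k ∈ S := Iff.rfl
@[simp] theorem known_inr (S : Set V) (j : ι) : Known S (.inr j) := trivial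

/-- A partial realization `[A B]`, supported on a set `S` of states that is a union of paths
starting at inputs and cycles of the matching `σ`. It passes the Hautus test on `S`, and for
`|μ| > L` the response of the inputs to an excitation `c` of a vertex `y₀` of `S`, with complex
frequency `μ`, is nonzero. The second property is what allows another cycle with an eigenvalue
of modulus greater than `L` to be attached to `y₀`. -/
structure Stage [Fintype V] (E : V → V ⊕ ι → Prop) (σ : V → V ⊕ ι) (S : Set V)
    (M : Matrix V (V ⊕ ι) ℝ) (L : ℝ) : Prop where
  closed : ∀ k, k ∈ S ↔ Known S (σ k)
  edge : ∀ k y, M k y ≠ 0 → E k y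
  row : ∀ k ∉ S, ∀ y, M k y = 0
  col : ∀ k, ∀ r ∉ S, M k (.inl r) = 0
  nonneg : 0 ≤ L
  hautus : ∀ (μ : ℂ) (v : V → ℂ),
    (∀ y, Known S y → ∑ k, v k * (M k y : ℂ) = μ * extend v y) → ∀ k ∈ S, v k = 0
  response : ∀ μ : ℂ, L < ‖μ‖ → ∀ (v : V → ℂ) (y₀ : V ⊕ ι) (c : ℂ), Known S y₀ →
    (∀ y, Known S y → ∃ d : ℂ, (y = y₀ → d = c) ∧ (y ≠ y₀ → d = 0) ∧
      μ * extend v y = ∑ k, v k * (M k y : ℂ) + d) → c = 0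

/-- The paths of the matching that start at inputs, with unit weights, form a `Stage`. -/
theorem exists_stage_of_matching [Fintype V] (E : V → V ⊕ ι → Prop) (σ : V → V ⊕ ι)
    (hσ : Function.Injective σ) (hE : ∀ k, E k (σ k)) :
    ∃ S M L, Stage E σ S M L := by
  classical
  let step : V ⊕ ι → V ⊕ ι := Sum.elim σ .inr
  let S : Set V := {k | ∃ i, (step^[i] (.inl k)).isRight}
  -- the distance of a state from the input at which its path starts
  let d : V → ℕ := fun k => if h : ∃ i, (step^[i] (.inl k)).isRight then Nat.find h else 0
  have hclosed : ∀ k, k ∈ S ↔ Known S (σ k) := by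
    intro k
    rcases hk : σ k with r | j
    · simp only [S, known_inl, Set.mem_ofPred_eq]
      constructor
      · rintro ⟨i, hi⟩
        cases i with
        | zero => simp at hi
        | succ i => exact ⟨i, by simpa [step, hk] using hi⟩
      · rintro ⟨i, hi⟩
        exact ⟨i + 1, by simpa [step, hk] using hi⟩
    · simp only [known_inr, iff_true]
      exact ⟨1, by simp [step, hk]⟩
  have hd : ∀ k ∈ S, ∀ r, σ k = .inl r → d r < d k := by
    intro k hk r hr
    have hrS : r ∈ S := by simpa [hr] using (hclosed k).1 hk
    have e1 : d k = Nat.find hk := dif_pos hk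
    have e2 : d r = Nat.find hrS := dif_pos hrS
    rw [e1, e2]
    obtain ⟨i, hi⟩ : ∃ i, Nat.find hk = i + 1 := by
      refine Nat.exists_eq_succ_of_ne_zero fun h0 => ?_
      have := Nat.find_spec hk
      rw [h0] at this
      simp at this
    rw [hi, Nat.lt_succ_iff]
    refine Nat.find_min' hrS ?_
    have := Nat.find_spec hk
    rw [hi] at this
    simpa [step, hr] using this
  let M : Matrix V (V ⊕ ι) ℝ := fun k y => if k ∈ S ∧ σ k = y then 1 else 0
  have hsum : ∀ (v : V → ℂ), ∀ k ∈ S, ∑ k', v k' * (M k' (σ k) : ℂ) = v k := by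
    intro v k hk
    rw [Finset.sum_eq_single k]
    · simp [M, hk]
    · intro b _ hb
      have : σ b ≠ σ k := fun h => hb (hσ h)
      simp [M, this]
    · simp
  refine ⟨S, M, 1, hclosed, ?_, ?_, ?_, zero_le_one, ?_, ?_⟩
  · intro k y h
    by_cases h' : k ∈ S ∧ σ k = y
    · exact h'.2 ▸ hE k
    · simp [M, h'] at h
  · intro k hk y; simp [M, hk]
  · intro k r hr
    have : ¬ (k ∈ S ∧ σ k = .inl r) := by
      rintro ⟨hk, h⟩
      exact hr (by simpa [h] using (hclosed k).1 hk)
    simp [M, this]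
  · intro μ v h k
    induction hn : d k using Nat.strong_induction_on generalizing k with
    | _ n ih =>
      intro hk
      have h1 := h (σ k) ((hclosed k).1 hk)
      rw [hsum v k hk] at h1
      rw [h1]
      rcases hr : σ k with r | j
      · have := ih (d r) (hn ▸ hd k hk r hr) r rfl (by simpa [hr] using (hclosed k).1 hk)
        simp [this]
      · simp
  · intro μ hμ v y₀ c hy₀ h
    by_contra hc
    have hμ0 : μ ≠ 0 := by
      rintro rfl; simp at hμ; linarith
    let Z : Finset V := Finset.univ.filter fun k => k ∈ S ∧ v k ≠ 0
    have hZ : Z.Nonempty := by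
      by_contra hZ
      have hv : ∀ k ∈ S, v k = 0 := by
        intro k hk
        by_contra h0
        exact hZ ⟨k, by simp [Z, hk, h0]⟩
      obtain ⟨e, he, -, h1⟩ := h y₀ hy₀
      have h2 : extend v y₀ = 0 := by
        rcases y₀ with r | j
        · exact hv r hy₀
        · rfl
      rw [h2, mul_zero, he rfl, Finset.sum_eq_zero, zero_add] at h1
      · exact hc h1.symm
      · intro k _
        by_cases hk : k ∈ S
        · simp [hv k hk]
        · simp [M, hk]
    -- the last state of a path with a nonzero value is the excited one
    obtain ⟨k, hk, hmax⟩ := Z.exists_max_image d hZ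
    simp only [Z, Finset.mem_filter, Finset.mem_univ, true_and] at hk hmax
    have hky : .inl k = y₀ := by
      by_contra hne
      obtain ⟨e, -, he, h1⟩ := h (.inl k) hk.1
      rw [he hne, Finset.sum_eq_zero, add_zero] at h1
      · exact hk.2 ((mul_eq_zero.1 h1).resolve_left hμ0)
      · intro k' _
        by_cases hk' : k' ∈ S ∧ σ k' = .inl k
        · have : v k' = 0 := by
            by_contra h0
            have := hmax k' ⟨hk'.1, h0⟩
            have := hd k' hk'.1 k hk'.2
            omega
          simp [this]
        · simp [M, hk']
    -- the first one would be excited by its predecessor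
    obtain ⟨l, hl, hmin⟩ := Z.exists_min_image d hZ
    simp only [Z, Finset.mem_filter, Finset.mem_univ, true_and] at hl hmin
    have hl0 : extend v (σ l) = 0 := by
      rcases hr : σ l with r | j
      · by_contra h0
        have := hmin r ⟨by simpa [hr] using (hclosed l).1 hl.1, h0⟩
        have := hd l hl.1 r hr
        omega
      · rfl
    have hne : σ l ≠ y₀ := by
      intro h0
      rw [h0, ← hky] at hl0
      exact hk.2 hl0
    obtain ⟨e, -, he, h1⟩ := h (σ l) ((hclosed l).1 hl.1)
    rw [hl0, he hne, hsum v l hl.1, mul_zero, add_zero] at h1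
    exact hl.2 h1.symm

/-- A `Stage` that does not cover all states can be enlarged by a cycle of the matching, if some
edge enters the uncovered states. -/
theorem Stage.exists_larger [Fintype V] {E : V → V ⊕ ι → Prop} {σ : V → V ⊕ ι} {S : Set V}
    {M : Matrix V (V ⊕ ι) ℝ} {L : ℝ} (h : Stage E σ S M L)
    (hσ : Function.Injective σ) (hE : ∀ k, E k (σ k))
    {k₀ : V} (hk₀ : k₀ ∉ S) {y₁ : V ⊕ ι} (hy₁ : Known S y₁) (hedge : E k₀ y₁) :
    ∃ S' M' L', S ⊂ S' ∧ Stage E σ S' M' L' := by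
  classical
  have hnext : ∀ x : {x // x ∉ S}, ∃ r : {x // x ∉ S}, σ x = .inl r.1 := by
    rintro ⟨x, hx⟩
    rcases hr : σ x with r | j
    · exact ⟨⟨r, fun hr' => hx ((h.closed x).2 (by simpa [hr] using hr'))⟩, rfl⟩
    · exact absurd ((h.closed x).2 (by simp [hr])) hx
  choose f hf using hnext
  have hfinj : Function.Injective f := by
    intro x y hxy
    exact Subtype.ext (hσ (by rw [hf, hf, hxy]))
  let π : Equiv.Perm {x // x ∉ S} := Equiv.ofBijective f (Finite.injective_iff_bijective.1 hfinj)
  have hπ : ∀ x, σ x.1 = .inl (π x).1 := hf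
  let z : {x // x ∉ S} := ⟨k₀, hk₀⟩
  let C : Set V := {x | ∃ hx : x ∉ S, π.SameCycle z ⟨x, hx⟩}
  have hCS : ∀ x ∈ C, x ∉ S := fun x hx => hx.1
  have hCπ : ∀ x : {x // x ∉ S}, (π x).1 ∈ C ↔ x.1 ∈ C := by
    intro x
    constructor
    · rintro ⟨_, hx⟩; exact ⟨x.2, Equiv.Perm.sameCycle_apply_right.1 hx⟩
    · rintro ⟨_, hx⟩; exact ⟨(π x).2, Equiv.Perm.sameCycle_apply_right.2 hx⟩
  have hzC : k₀ ∈ C := ⟨hk₀, Equiv.Perm.SameCycle.refl _ _⟩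
  -- a property that is inherited along the cycle holds everywhere on it
  have hcyc : ∀ (P : V → Prop) (r : V), r ∈ C → P r →
      (∀ x : {x // x ∉ S}, x.1 ∈ C → P x.1 → P (π x).1) → ∀ x ∈ C, P x := by
    intro P r hr hPr hstep x hx
    have hs : π.SameCycle ⟨r, hr.1⟩ ⟨x, hx.1⟩ := hr.2.symm.trans hx.2
    obtain ⟨i, -, hi⟩ := hs.exists_pow_eq'
    have key : ∀ i : ℕ, ((π ^ i) ⟨r, hr.1⟩).1 ∈ C ∧ P ((π ^ i) ⟨r, hr.1⟩).1 := by
      intro i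
      induction i with
      | zero => exact ⟨hr, hPr⟩
      | succ i ih =>
        rw [pow_succ', Equiv.Perm.mul_apply]
        exact ⟨(hCπ _).2 ih.1, hstep _ ih.1 ih.2⟩
    have := (key i).2
    rwa [hi] at this
  let a : ℝ := L + 1
  have ha : 0 < a := by have := h.nonneg; positivity
  have ha' : (a : ℂ) ≠ 0 := by exact_mod_cast ha.ne'
  let M' : Matrix V (V ⊕ ι) ℝ := fun k y =>
    if k ∈ S then M k y else if k ∈ C ∧ σ k = y then a else if k = k₀ ∧ y = y₁ then 1 else 0
  have hσC : ∀ x ∈ C, ¬ Known S (σ x) := fun x hx hk => hCS x hx ((h.closed x).2 hk)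
  have hsumS : ∀ (v : V → ℂ) (y : V ⊕ ι), Known S y →
      ∑ k, v k * (M' k y : ℂ) = ∑ k, v k * (M k y : ℂ) + if y = y₁ then v k₀ else 0 := by
    intro v y hy
    have : ∀ k, v k * (M' k y : ℂ) = v k * (M k y : ℂ) +
        if k = k₀ then (if y = y₁ then v k₀ else 0) else 0 := by
      intro k
      by_cases hk : k ∈ S
      · have : k ≠ k₀ := fun h' => hk₀ (h' ▸ hk)
        simp [M', hk, this]
      · have h1 : ¬ (k ∈ C ∧ σ k = y) := fun h' => hσC k h'.1 (h'.2 ▸ hy)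
        by_cases hkk : k = k₀
        · subst hkk
          by_cases hyy : y = y₁
          · rw [hyy] at h1 ⊢
            simp [M', hk, h1, h.row k hk]
          · simp [M', hk, h1, h.row k hk, hyy]
        · simp [M', hk, h1, h.row k hk, hkk]
    simp_rw [this, Finset.sum_add_distrib]
    simp
  have hsumC : ∀ (v : V → ℂ) (x : {x // x ∉ S}), x.1 ∈ C →
      ∑ k, v k * (M' k (.inl (π x).1) : ℂ) = a * v x.1 := by
    intro v x hx
    have hne : .inl (π x).1 ≠ y₁ := fun h' => (π x).2 (by simpa [← h'] using hy₁)
    rw [Finset.sum_eq_single x.1]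
    · simp [M', x.2, hx, hπ, mul_comm]
    · intro b _ hb
      by_cases hbS : b ∈ S
      · simp [M', hbS, h.col b _ (π x).2]
      · have : ¬ (b ∈ C ∧ σ b = .inl (π x).1) := by
          rintro ⟨_, h'⟩
          rw [← hπ] at h'
          exact hb (hσ h')
        simp [M', hbS, this, hne]
    · simp
  have hknown : ∀ y : V ⊕ ι, Known (S ∪ C) y ↔ Known S y ∨ ∃ x : {x // x ∉ S}, x.1 ∈ C ∧
      y = .inl (π x).1 := by
    intro y
    rcases y with r | j
    · simp only [known_inl, Set.mem_union]
      refine or_congr_right ⟨fun hr => ?_, ?_⟩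
      · refine ⟨π.symm ⟨r, hr.1⟩, ?_, by simp⟩
        rw [← hCπ]; simpa using hr
      · rintro ⟨x, hx, h'⟩
        rw [Sum.inl.injEq] at h'
        rw [h']
        exact (hCπ x).2 hx
    · simp
  -- off its eigenvalues the cycle has no nonzero unexcited states
  have hzero : ∀ (μ : ℂ) (v : V → ℂ), (∀ x : {x // x ∉ S}, x.1 ∈ C → μ * v (π x).1 = a * v x.1) →
      ‖μ‖ ≠ a → ∀ x ∈ C, v x = 0 := by
    intro μ v hv hμ
    let g : {x // x ∉ S} → ℝ := fun x => if x.1 ∈ C then ‖v x.1‖ else 0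
    have hg : ∀ x, ‖μ‖ * g (π x) = a * g x := by
      intro x
      by_cases hx : x.1 ∈ C
      · have := congrArg norm (hv x hx)
        rw [norm_mul, norm_mul, Complex.norm_real, Real.norm_of_nonneg ha.le] at this
        simpa [g, hx, (hCπ x).2 hx] using this
      · have hx' : (π x).1 ∉ C := fun h' => hx ((hCπ x).1 h')
        simp [g, hx, hx']
    have hs : ‖μ‖ * ∑ x, g x = a * ∑ x, g x := by
      rw [Finset.mul_sum, Finset.mul_sum, ← Finset.sum_congr rfl fun x _ => hg x]
      exact (Equiv.sum_comp π fun x => ‖μ‖ * g x).symm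
    have hs0 : ∑ x, g x = 0 := by
      by_contra h0
      exact hμ (mul_right_cancel₀ h0 hs)
    have hg0 : ∀ x, 0 ≤ g x := by
      intro x; simp only [g]; split_ifs <;> simp
    intro x hx
    have := (Finset.sum_eq_zero_iff_of_nonneg fun x _ => hg0 x).1 hs0 ⟨x, hx.1⟩
      (Finset.mem_univ _)
    simpa [g, hx] using this
  refine ⟨S ∪ C, M', L + 1, ?_, ?_, ?_, ?_, ?_, by have := h.nonneg; positivity, ?_, ?_⟩
  · exact Set.ssubset_iff_of_subset Set.subset_union_left |>.2 ⟨k₀, Or.inr hzC, hk₀⟩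
  · intro k
    by_cases hk : k ∈ S
    · simp only [Set.mem_union, hk, true_or, true_iff]
      exact (hknown _).2 (Or.inl ((h.closed k).1 hk))
    · rw [hπ ⟨k, hk⟩]
      simp only [Set.mem_union, known_inl, hk, false_or]
      rw [hCπ ⟨k, hk⟩]
      simp [(π ⟨k, hk⟩).2]
  · intro k y hky
    by_cases hk : k ∈ S
    · exact h.edge k y (by simpa [M', hk] using hky)
    · by_cases h1 : k ∈ C ∧ σ k = y
      · exact h1.2 ▸ hE k
      · by_cases h2 : k = k₀ ∧ y = y₁
        · rw [h2.1, h2.2]; exact hedge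
        · simp [M', hk, h1, h2] at hky
  · intro k hk y
    have h1 : k ∉ S := fun h' => hk (Or.inl h')
    have h2 : k ∉ C := fun h' => hk (Or.inr h')
    have h3 : k ≠ k₀ := fun h' => h2 (h' ▸ hzC)
    simp [M', h1, h2, h3]
  · intro k r hr
    have h1 : r ∉ S := fun h' => hr (Or.inl h')
    have h2 : r ∉ C := fun h' => hr (Or.inr h')
    have h3 : .inl r ≠ y₁ := fun h' => h1 (by simpa [← h'] using hy₁)
    by_cases hk : k ∈ S
    · simp [M', hk, h.col k r h1]
    · have h4 : ¬ (k ∈ C ∧ σ k = .inl r) := by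
        rintro ⟨hkC, h'⟩
        rw [hπ ⟨k, hk⟩, Sum.inl.injEq] at h'
        exact h2 (h' ▸ (hCπ ⟨k, hk⟩).2 hkC)
      simp [M', hk, h4, h3]
  · intro μ v hv
    have hvC : ∀ x : {x // x ∉ S}, x.1 ∈ C → μ * v (π x).1 = a * v x.1 := by
      intro x hx
      rw [← hsumC v x hx]
      exact (hv _ ((hknown _).2 (Or.inr ⟨x, hx, rfl⟩))).symm
    have hvk : ∀ x ∈ C, v x = 0 := by
      by_contra! hne
      obtain ⟨r, hr, hvr⟩ := hne
      have hall : ∀ x ∈ C, v x ≠ 0 := by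
        refine hcyc _ r hr hvr fun x hx hvx h0 => hvx ?_
        have := hvC x hx
        rw [h0, mul_zero] at this
        exact (mul_eq_zero.1 this.symm).resolve_left ha'
      by_cases hμ : ‖μ‖ = a
      · refine hall k₀ hzC (h.response μ (by rw [hμ]; exact lt_add_one L) v y₁ (v k₀) hy₁ ?_)
        intro y hy
        refine ⟨if y = y₁ then v k₀ else 0, fun h' => if_pos h', fun h' => if_neg h', ?_⟩
        rw [← hsumS v y hy]
        exact (hv y ((hknown y).2 (Or.inl hy))).symm
      · exact hvr (hzero μ v hvC hμ r hr)
    rintro k (hk | hk)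
    · refine h.hautus μ v (fun y hy => ?_) k hk
      rw [← hv y ((hknown y).2 (Or.inl hy)), hsumS v y hy, hvk k₀ hzC]
      simp
    · exact hvk k hk
  · intro μ hμ v y₀ c hy₀ hv
    have hL : L < ‖μ‖ := (lt_add_one L).trans hμ
    have hμ0 : μ ≠ 0 := by
      rintro rfl
      have := h.nonneg
      simp at hL; linarith
    rcases (hknown y₀).1 hy₀ with hy | ⟨x₀, hx₀, rfl⟩
    · have hvC : ∀ x : {x // x ∉ S}, x.1 ∈ C → μ * v (π x).1 = a * v x.1 := by
        intro x hx
        obtain ⟨d, -, hd, h1⟩ := hv _ ((hknown _).2 (Or.inr ⟨x, hx, rfl⟩))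
        have hne : .inl (π x).1 ≠ y₀ := fun h' => (π x).2 (by simpa [← h'] using hy)
        rw [hd hne, add_zero, hsumC v x hx] at h1
        exact h1
      have hk0 := hzero μ v hvC hμ.ne' k₀ hzC
      refine h.response μ hL v y₀ c hy fun y hyS => ?_
      obtain ⟨d, hd1, hd2, h1⟩ := hv y ((hknown y).2 (Or.inl hyS))
      refine ⟨d, hd1, hd2, ?_⟩
      rw [h1, hsumS v y hyS, hk0]
      simp
    · by_contra hc
      have hr : (π x₀).1 ∈ C := (hCπ x₀).2 hx₀
      have hvC : ∀ x : {x // x ∉ S}, x.1 ∈ C → (π x).1 ≠ (π x₀).1 → μ * v (π x).1 = a * v x.1 := by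
        intro x hx hne
        obtain ⟨d, -, hd, h1⟩ := hv _ ((hknown _).2 (Or.inr ⟨x, hx, rfl⟩))
        rw [hd (fun h' => hne (Sum.inl.inj h')), add_zero, hsumC v x hx] at h1
        exact h1
      have hvr : μ * v (π x₀).1 = a * v x₀.1 + c := by
        obtain ⟨d, hd, -, h1⟩ := hv _ ((hknown _).2 (Or.inr ⟨x₀, hx₀, rfl⟩))
        rw [hd rfl, hsumC v x₀ hx₀] at h1
        exact h1
      have hk0 : v k₀ ≠ 0 := by
        by_cases h0 : v (π x₀).1 = 0
        · have hall : ∀ x ∈ C, v x = 0 := by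
            refine hcyc _ _ hr h0 fun x hx hvx => ?_
            by_cases hne : (π x).1 = (π x₀).1
            · rw [hne]; exact h0
            · have := hvC x hx hne
              rw [hvx, mul_zero] at this
              exact (mul_eq_zero.1 this).resolve_left hμ0
          rw [h0, hall x₀.1 hx₀] at hvr
          exact absurd (by simpa using hvr.symm) hc
        · have hall : ∀ x ∈ C, v x ≠ 0 := by
            refine hcyc _ _ hr h0 fun x hx hvx => ?_
            by_cases hne : (π x).1 = (π x₀).1
            · rw [hne]; exact h0
            · have := hvC x hx hne
              intro h'
              rw [h', mul_zero] at this
              exact hvx ((mul_eq_zero.1 this.symm).resolve_left ha')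
          exact hall k₀ hzC
      refine hk0 (h.response μ hL v y₁ (v k₀) hy₁ fun y hy => ?_)
      refine ⟨if y = y₁ then v k₀ else 0, fun h' => if_pos h', fun h' => if_neg h', ?_⟩
      rw [← hsumS v y hy]
      obtain ⟨d, -, hd, h1⟩ := hv y ((hknown y).2 (Or.inl hy))
      rw [h1, hd, add_zero]
      rintro rfl
      exact (π x₀).2 hy

/-- A pattern with a perfect matching `σ` in which every proper set of states that contains the
paths from the inputs is left by an edge has a realization that passes the Hautus test. -/
theorem exists_hautus_realization [Fintype V] (E : V → V ⊕ ι → Prop) (σ : V → V ⊕ ι)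
    (hσ : Function.Injective σ) (hE : ∀ k, E k (σ k))
    (hacc : ∀ S : Set V, S ≠ Set.univ → ∃ k ∉ S, ∃ y, Known S y ∧ E k y) :
    ∃ M : Matrix V (V ⊕ ι) ℝ, (∀ k y, M k y ≠ 0 → E k y) ∧
      ∀ (μ : ℂ) (v : V → ℂ), (∀ y, ∑ k, v k * (M k y : ℂ) = μ * extend v y) → v = 0 := by
  obtain ⟨S, hS⟩ := (Set.toFinite {S : Set V | ∃ M L, Stage E σ S M L}).exists_maximal
    (exists_stage_of_matching E σ hσ hE)
  obtain ⟨M, L, h⟩ := hS.prop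
  have huniv : S = Set.univ := by
    by_contra hne
    obtain ⟨k, hk, y, hy, hky⟩ := hacc S hne
    obtain ⟨S', M', L', hlt, h'⟩ := h.exists_larger hσ hE hk hy hky
    exact hlt.not_subset (hS.le_of_ge ⟨M', L', h'⟩ hlt.subset)
  refine ⟨M, h.edge, fun μ v hv => funext fun k => h.hautus μ v (fun y _ => hv y) k ?_⟩
  rw [huniv]; trivial

end StructuralRealization

/-! ### Non-top linked components and Lin's theorem -/

section Components

variable {n : ℕ} {A : Matrix (Fin n) (Fin n) Bool}

open Classical in
/-- The strongly connected component of the state `k`. -/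
noncomputable def sccOf (A : Matrix (Fin n) (Fin n) Bool) (k : Fin n) : Finset (Fin n) :=
  Finset.univ.filter fun x => StateReach A x k ∧ StateReach A k x

theorem mem_sccOf {k x : Fin n} : x ∈ sccOf A k ↔ StateReach A x k ∧ StateReach A k x := by
  simp [sccOf]

theorem isSCC_sccOf (k : Fin n) : IsSCC A (sccOf A k) := by
  refine ⟨⟨⟨k, mem_sccOf.2 ⟨.refl, .refl⟩⟩, fun v hv w hw => ?_⟩, ?_⟩
  · exact (mem_sccOf.1 hv).1.trans (mem_sccOf.1 hw).2
  · rintro U ⟨-, hU⟩ hle x hx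
    have hk : k ∈ U := hle (mem_sccOf.2 ⟨.refl, .refl⟩)
    exact mem_sccOf.2 ⟨hU x hx k hk, hU k hk x hx⟩

theorem IsSCC.eq_sccOf {S : Finset (Fin n)} (h : IsSCC A S) {k : Fin n} (hk : k ∈ S) :
    S = sccOf A k :=
  h.eq_of_le (isSCC_sccOf k).prop fun x hx =>
    mem_sccOf.2 ⟨h.prop.2 x hx k hk, h.prop.2 k hk x hx⟩

theorem mem_nonTopSCCs {N : Finset (Fin n)} : N ∈ nonTopSCCs A ↔ IsNonTopLinked A N := by
  simp [nonTopSCCs]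

theorem eq_of_mem_nonTopSCCs {N N' : Finset (Fin n)} (hN : N ∈ nonTopSCCs A)
    (hN' : N' ∈ nonTopSCCs A) {k : Fin n} (hk : k ∈ N) (hk' : k ∈ N') : N = N' := by
  rw [(mem_nonTopSCCs.1 hN).1.eq_sccOf hk, (mem_nonTopSCCs.1 hN').1.eq_sccOf hk']

theorem nonempty_of_mem_nonTopSCCs {N : Finset (Fin n)} (hN : N ∈ nonTopSCCs A) : N.Nonempty :=
  (mem_nonTopSCCs.1 hN).1.prop.1

/-- A non-top linked component is closed under predecessors. -/
theorem mem_of_stateReach_of_mem_nonTopSCCs {N : Finset (Fin n)} (hN : N ∈ nonTopSCCs A)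
    {x y : Fin n} (hx : x ∈ N) (h : StateReach A y x) : y ∈ N := by
  induction h using Relation.ReflTransGen.head_induction_on with
  | refl => exact hx
  | head h _ ih =>
    by_contra hn
    simp [(mem_nonTopSCCs.1 hN).2 _ hn _ ih] at h

theorem mem_nonTopSCCs_iff_stateReach {N : Finset (Fin n)} (hN : N ∈ nonTopSCCs A)
    {k : Fin n} (hk : k ∈ N) (x : Fin n) : x ∈ N ↔ StateReach A x k :=
  ⟨fun hx => (mem_nonTopSCCs.1 hN).1.prop.2 x hx k hk,
    fun h => mem_of_stateReach_of_mem_nonTopSCCs hN hk h⟩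

theorem sccOf_mem_nonTopSCCs {k : Fin n}
    (h : ∀ x, StateReach A x k → StateReach A k x) : sccOf A k ∈ nonTopSCCs A := by
  refine mem_nonTopSCCs.2 ⟨isSCC_sccOf k, fun j hj i hi => ?_⟩
  by_contra hij
  rw [Bool.not_eq_false] at hij
  have hjk : StateReach A j k := (mem_sccOf.1 hi).1.head hij
  exact hj (mem_sccOf.2 ⟨hjk, h j hjk⟩)

/-- Every state is reachable from a non-top linked component. -/
theorem exists_nonTopSCC_stateReach (A : Matrix (Fin n) (Fin n) Bool) (k : Fin n) :
    ∃ N ∈ nonTopSCCs A, ∃ r ∈ N, StateReach A r k := by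
  classical
  let anc : Fin n → Finset (Fin n) := fun x => Finset.univ.filter fun y => StateReach A y x
  have hanc : ∀ {x y}, y ∈ anc x ↔ StateReach A y x := by simp [anc]
  obtain ⟨x, hx, hmin⟩ := (anc k).exists_min_image (fun x => (anc x).card)
    ⟨k, hanc.2 .refl⟩
  have hxk : StateReach A x k := hanc.1 hx
  refine ⟨sccOf A x, sccOf_mem_nonTopSCCs fun y hy => ?_, x, mem_sccOf.2 ⟨.refl, .refl⟩, hxk⟩
  by_contra hn
  have hlt : anc y ⊂ anc x := by
    exact Finset.ssubset_iff_of_subset (fun z hz => hanc.2 ((hanc.1 hz).trans hy)) |>.2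
      ⟨x, hanc.2 .refl, fun h => hn (hanc.1 h)⟩
  have := hmin y (hanc.2 (hy.trans hxk))
  exact absurd (Finset.card_lt_card hlt) (not_lt.2 this)

/-- Disjointness of the components bounds their number. -/
theorem numNonTop_le (A : Matrix (Fin n) (Fin n) Bool) : numNonTop A ≤ n := by
  have hne : ∀ N : {N // N ∈ nonTopSCCs A}, ∃ r, r ∈ N.1 :=
    fun N => nonempty_of_mem_nonTopSCCs N.2
  choose f hf using hne
  have hinj : Function.Injective f := fun N N' h =>
    Subtype.ext (eq_of_mem_nonTopSCCs N.2 N'.2 (hf N) (h ▸ hf N'))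
  have := Fintype.card_le_of_injective f hinj
  simpa [numNonTop] using this

end Components

section Lin

variable {n : ℕ} {ι : Type}

/-- The edges into the state `k` of the digraph of the structured system. -/
def SysEdge (A : Matrix (Fin n) (Fin n) Bool) (B : Matrix (Fin n) ι Bool) (k : Fin n)
    (y : Fin n ⊕ ι) : Prop :=
  Sum.elim (A k) (B k) y = true

/-- The combinatorial form of structural controllability: every non-top linked component is
entered by an input, and the states can be matched to distinct predecessors. -/
def IsAccessibleMatchable (A : Matrix (Fin n) (Fin n) Bool) (B : Matrix (Fin n) ι Bool) : Prop :=
  (∀ N ∈ nonTopSCCs A, ∃ r ∈ N, ∃ j, B r j = true) ∧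
    ∃ σ : Fin n → Fin n ⊕ ι, Function.Injective σ ∧ ∀ k, SysEdge A B k (σ k)

variable {A : Matrix (Fin n) (Fin n) Bool} {B : Matrix (Fin n) ι Bool} [Fintype ι]

theorem StructurallyControllable.isAccessibleMatchable (h : StructurallyControllable A B) :
    IsAccessibleMatchable A B := by
  classical
  obtain ⟨A', B', hA, hB, hc⟩ := h
  constructor
  · intro N hN
    by_contra! hne
    have := hc.eq_empty_of_isolated N
      (fun i hi j hj => hA i j ((mem_nonTopSCCs.1 hN).2 j hj i hi))
      (fun i hi j => hB i j (by simpa using hne i hi j))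
    exact (nonempty_of_mem_nonTopSCCs hN).ne_empty this
  · let t : Fin n → Finset (Fin n ⊕ ι) := fun k => Finset.univ.filter (SysEdge A B k)
    have hall : ∀ S : Finset (Fin n), S.card ≤ (S.biUnion t).card := by
      intro S
      -- the rows of `[A' B']` are linearly independent, and those in `S` are supported on the
      -- neighbours of `S`
      let row : Fin n → Fin n ⊕ ι → ℝ := fun k => Sum.elim (A' k) (B' k)
      have hrow : ∀ k y, ¬ SysEdge A B k y → row k y = 0 := by
        rintro k (r | j) hky
        · exact hA k r (by simpa [SysEdge] using hky)
        · exact hB k j (by simpa [SysEdge] using hky)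
      let M : S → (S.biUnion t) → ℝ := fun k y => row k.1 y.1
      have hli : LinearIndependent ℝ M := by
        rw [Fintype.linearIndependent_iff]
        intro g hg
        let v : Fin n → ℝ := fun k => if hk : k ∈ S then g ⟨k, hk⟩ else 0
        have hv : ∀ y, ∑ k, v k * row k y = 0 := by
          intro y
          have h1 : ∑ k, v k * row k y = ∑ k : S, g k * row k.1 y := by
            rw [← Finset.sum_subset (Finset.subset_univ S) fun k _ hk => by simp [v, hk],
              Finset.univ_eq_attach, ← Finset.sum_attach]
            exact Finset.sum_congr rfl fun k _ => by simp [v]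
          rw [h1]
          by_cases hy : y ∈ S.biUnion t
          · simpa [M] using congrFun hg ⟨y, hy⟩
          · refine Finset.sum_eq_zero fun k _ => ?_
            rw [hrow k.1 y, mul_zero]
            exact fun h => hy (Finset.mem_biUnion.2 ⟨k.1, k.2, by simpa [t] using h⟩)
        have := hc.eq_zero_of_vecMul_eq_zero v
          (by ext r; simpa [Matrix.vecMul, dotProduct, row] using hv (.inl r))
          (by ext j; simpa [Matrix.vecMul, dotProduct, row] using hv (.inr j))
        intro k
        simpa [v] using congrFun this k.1
      have := hli.fintype_card_le_finrank
      rwa [Module.finrank_fintype_fun_eq_card, Fintype.card_coe, Fintype.card_coe] at this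
    obtain ⟨σ, hσ, hσt⟩ := (Finset.all_card_le_biUnion_card_iff_exists_injective t).1 hall
    exact ⟨σ, hσ, fun k => by simpa [t] using hσt k⟩

open StructuralRealization in
theorem IsAccessibleMatchable.structurallyControllable (h : IsAccessibleMatchable A B) :
    StructurallyControllable A B := by
  obtain ⟨hacc, σ, hσ, hσE⟩ := h
  obtain ⟨M, hM, hh⟩ := exists_hautus_realization (SysEdge A B) σ hσ hσE (by
    intro S hS
    by_contra! hne
    obtain ⟨k, hk⟩ := (Set.ne_univ_iff_exists_notMem S).1 hS
    -- the complement of `S` is closed under predecessors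
    have hpred : ∀ x y, StateReach A x y → y ∉ S → x ∉ S := by
      intro x y hxy
      induction hxy using Relation.ReflTransGen.head_induction_on with
      | refl => exact id
      | head h _ ih => exact fun hy hx => hne _ (ih hy) (.inl _) hx h
    obtain ⟨N, hN, r, hr, hrk⟩ := exists_nonTopSCC_stateReach A k
    obtain ⟨r', hr', j, hj⟩ := hacc N hN
    have hr'S : r' ∉ S := hpred r' k
      (((mem_nonTopSCCs_iff_stateReach hN hr r').1 hr').trans hrk) hk
    exact hne r' hr'S (.inr j) trivial hj)
  refine ⟨fun i j => M i (.inl j), fun i j => M i (.inr j), ?_, ?_, ?_⟩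
  · intro i j hij
    by_contra h0
    have := hM _ _ h0
    simp [SysEdge, hij] at this
  · intro i j hij
    by_contra h0
    have := hM _ _ h0
    simp [SysEdge, hij] at this
  · refine controllable_of_hautus _ _ fun μ v hA hB => hh μ v ?_
    rintro (r | j)
    · exact congrFun hA r
    · exact (congrFun hB j).trans (mul_zero μ).symm

/-- Lin's theorem. -/
theorem structurallyControllable_iff :
    StructurallyControllable A B ↔ IsAccessibleMatchable A B :=
  ⟨fun h => h.isAccessibleMatchable, fun h => h.structurallyControllable⟩

end Lin

/-! ### Flows and input selections -/

/-- A fractional perfect matching of a bipartite graph yields a perfect matching. -/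
theorem exists_injective_of_fractional_matching {α β : Type} [Fintype α] [Fintype β]
    (E : α → β → Prop) (F : α → β → ℝ≥0) (hE : ∀ a b, F a b ≠ 0 → E a b)
    (hrow : ∀ a, ∑ b, F a b = 1) (hcol : ∀ b, ∑ a, F a b ≤ 1) :
    ∃ σ : α → β, Function.Injective σ ∧ ∀ a, E a (σ a) := by
  classical
  let t : α → Finset β := fun a => Finset.univ.filter (E a)
  have hall : ∀ S : Finset α, S.card ≤ (S.biUnion t).card := by
    intro S
    have h1 : (S.card : ℝ≥0) = ∑ a ∈ S, ∑ b ∈ S.biUnion t, F a b := by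
      rw [Finset.card_eq_sum_ones, Nat.cast_sum]
      refine Finset.sum_congr rfl fun a ha => ?_
      rw [Nat.cast_one, ← hrow a]
      refine (Finset.sum_subset (Finset.subset_univ _) fun b _ hb => ?_).symm
      by_contra h0
      exact hb (Finset.mem_biUnion.2 ⟨a, ha, by simpa [t] using hE a b h0⟩)
    have h2 : (S.card : ℝ≥0) ≤ ((S.biUnion t).card : ℝ≥0) := by
      rw [h1, Finset.sum_comm, Finset.card_eq_sum_ones, Nat.cast_sum]
      refine Finset.sum_le_sum fun b _ => ?_
      rw [Nat.cast_one]
      exact (Finset.sum_le_univ_sum_of_nonneg fun _ => zero_le).trans (hcol b)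
    exact_mod_cast h2
  obtain ⟨σ, hσ, hσt⟩ := (Finset.all_card_le_biUnion_card_iff_exists_injective t).1 hall
  exact ⟨σ, hσ, fun a => by simpa [t] using hσt a⟩

namespace SysVertex

variable {n m : ℕ} {A : Matrix (Fin n) (Fin n) Bool}

/-- The vertices, sorted by kind. -/
def equivSum : SysVertex m A ≃ (Unit ⊕ Unit) ⊕ {N : Finset (Fin n) // N ∈ nonTopSCCs A} ⊕
    (Fin n ⊕ Fin n) ⊕ (Fin m ⊕ Fin m) where
  toFun
    | s => .inl (.inl ())
    | t => .inl (.inr ())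
    | scc N => .inr (.inl N)
    | x' k => .inr (.inr (.inl (.inl k)))
    | x r => .inr (.inr (.inl (.inr r)))
    | u j => .inr (.inr (.inr (.inl j)))
    | u' j => .inr (.inr (.inr (.inr j)))
  invFun
    | .inl (.inl ()) => s
    | .inl (.inr ()) => t
    | .inr (.inl N) => scc N
    | .inr (.inr (.inl (.inl k))) => x' k
    | .inr (.inr (.inl (.inr r))) => x r
    | .inr (.inr (.inr (.inl j))) => u j
    | .inr (.inr (.inr (.inr j))) => u' j
  left_inv v := by cases v <;> rfl
  right_inv v := by rcases v with (_ | _) | _ | (_ | _) | _ | _ <;> rfl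

theorem sum_univ {M : Type} [AddCommMonoid M] (g : SysVertex m A → M) :
    ∑ v, g v = g s + g t + (∑ N, g (scc N) + (∑ k, g (x' k) + ∑ r, g (x r) +
      (∑ j, g (u j) + ∑ j, g (u' j)))) := by
  rw [← equivSum.symm.sum_comp]
  simp only [Fintype.sum_sum_type, equivSum, Equiv.coe_fn_symm_mk, Finset.univ_unique,
    Finset.sum_singleton]

theorem card_eq : Fintype.card (SysVertex m A) = 2 + 2 * n + 2 * m + numNonTop A := by
  rw [Fintype.card_congr equivSum]
  simp [numNonTop]
  ring

end SysVertex

section Network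

variable {n m : ℕ} {A : Matrix (Fin n) (Fin n) Bool} {B : Matrix (Fin n) (Fin m) Bool}
  {p : Fin m → ℝ≥0}

open SysVertex

open Classical in
/-- The flow along an edge, and `0` for pairs of vertices that are not joined by an edge. -/
noncomputable def edgeFlow (B : Matrix (Fin n) (Fin m) Bool)
    (f : SysVertex m A × SysVertex m A → ℝ≥0) (v w : SysVertex m A) : ℝ≥0 :=
  if IsEdge B v w then f (v, w) else 0

section EdgeFlow

variable (f : SysVertex m A × SysVertex m A → ℝ≥0)

theorem edgeFlow_scc_u' (N : {N // N ∈ nonTopSCCs A}) (j : Fin m) :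
    edgeFlow B f (scc N) (u' j) = if ∃ r ∈ N.1, B r j = true then f (scc N, u' j) else 0 := by
  unfold edgeFlow IsEdge; congr

theorem edgeFlow_x'_x (k r : Fin n) :
    edgeFlow B f (x' k) (x r) = if A k r = true then f (x' k, x r) else 0 := by
  unfold edgeFlow IsEdge; congr

theorem edgeFlow_x'_u (k : Fin n) (j : Fin m) :
    edgeFlow B f (x' k) (u j) = if B k j = true then f (x' k, u j) else 0 := by
  unfold edgeFlow IsEdge; congr

theorem edgeFlow_u_u' (i j : Fin m) :
    edgeFlow B f (u i) (u' j) = if i = j then f (u i, u' j) else 0 := by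
  unfold edgeFlow IsEdge; congr

theorem sum_edges_in (v : SysVertex m A)
    [DecidablePred fun e : SysVertex m A × SysVertex m A => e.2 = v] :
    ∑ e ∈ (systemNetwork A B p).edges with e.2 = v, f e = ∑ w, edgeFlow B f w v := by
  rw [Finset.sum_filter, systemNetwork, Finset.sum_filter, Fintype.sum_prod_type]
  refine Finset.sum_congr rfl fun w _ => ?_
  rw [Finset.sum_eq_single v]
  · simp [edgeFlow]
  · intro b _ hb; simp [hb]
  · simp

theorem sum_edges_out (v : SysVertex m A)
    [DecidablePred fun e : SysVertex m A × SysVertex m A => e.1 = v] :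
    ∑ e ∈ (systemNetwork A B p).edges with e.1 = v, f e = ∑ w, edgeFlow B f v w := by
  rw [Finset.sum_filter, systemNetwork, Finset.sum_filter, Fintype.sum_prod_type]
  rw [Finset.sum_eq_single v]
  · simp [edgeFlow]
  · intro b _ hb; simp [hb]
  · simp

end EdgeFlow

theorem mem_edges {e : SysVertex m A × SysVertex m A} :
    e ∈ (systemNetwork A B p).edges ↔ IsEdge B e.1 e.2 := by
  simp [systemNetwork]

theorem value_eq (f : SysVertex m A × SysVertex m A → ℝ≥0) :
    (systemNetwork A B p).value f = ∑ N, f (s, scc N) + ∑ k, f (s, x' k) := by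
  rw [FlowNetwork.value, sum_edges_out]
  change ∑ w, edgeFlow B f s w = _
  simp [sum_univ, edgeFlow, IsEdge]

/-- Feasibility of a flow, spelled out for every kind of vertex and edge. -/
theorem isFeasible_iff (f : SysVertex m A × SysVertex m A → ℝ≥0) :
    (systemNetwork A B p).IsFeasible f ↔
      (∀ e ∈ (systemNetwork A B p).edges, f e ≤ capacity e) ∧
      (∀ N, f (s, scc N) = ∑ j, if ∃ r ∈ N.1, B r j = true then f (scc N, u' j) else 0) ∧
      (∀ k, f (s, x' k) = (∑ r, if A k r = true then f (x' k, x r) else 0) +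
        ∑ j, if B k j = true then f (x' k, u j) else 0) ∧
      (∀ r, (∑ k, if A k r = true then f (x' k, x r) else 0) = f (x r, t)) ∧
      (∀ j, (∑ k, if B k j = true then f (x' k, u j) else 0) = f (u j, u' j)) ∧
      (∀ j, (∑ N, if ∃ r ∈ N.1, B r j = true then f (scc N, u' j) else 0) +
        f (u j, u' j) = f (u' j, t)) := by
  rw [FlowNetwork.IsFeasible]
  refine and_congr Iff.rfl ?_
  simp only [sum_edges_in, sum_edges_out, sum_univ]
  constructor
  · intro h
    refine ⟨fun N => ?_, fun k => ?_, fun r => ?_, fun j => ?_, fun j => ?_⟩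
    · have := h (scc N) nofun nofun
      simp only [edgeFlow_scc_u'] at this
      simpa [edgeFlow, IsEdge] using this
    · have := h (x' k) nofun nofun
      simp only [edgeFlow_x'_x, edgeFlow_x'_u] at this
      simpa [edgeFlow, IsEdge] using this
    · have := h (x r) nofun nofun
      simp only [edgeFlow_x'_x] at this
      simpa [edgeFlow, IsEdge] using this
    · have := h (u j) nofun nofun
      simp only [edgeFlow_x'_u, edgeFlow_u_u'] at this
      simpa [edgeFlow, IsEdge] using this
    · have := h (u' j) nofun nofun
      simp only [edgeFlow_scc_u', edgeFlow_u_u'] at this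
      simpa [edgeFlow, IsEdge] using this
  · rintro ⟨h1, h2, h3, h4, h5⟩ (_ | _ | N | k | r | j | j) hs ht
    · exact absurd rfl hs
    · exact absurd rfl ht
    · simp only [edgeFlow_scc_u']
      simpa [edgeFlow, IsEdge] using h1 N
    · simp only [edgeFlow_x'_x, edgeFlow_x'_u]
      simpa [edgeFlow, IsEdge] using h2 k
    · simp only [edgeFlow_x'_x]
      simpa [edgeFlow, IsEdge] using h3 r
    · simp only [edgeFlow_x'_u, edgeFlow_u_u']
      simpa [edgeFlow, IsEdge] using h4 j
    · simp only [edgeFlow_scc_u', edgeFlow_u_u']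
      simpa [edgeFlow, IsEdge] using h5 j

theorem mem_flowInputs {f : SysVertex m A × SysVertex m A → ℝ≥0} {j : Fin m} :
    j ∈ flowInputs f ↔ 0 < f (u' j, t) := by
  simp [flowInputs]

open Classical in
/-- Only the edges from the copies of the inputs to the sink have a cost. -/
theorem usedCost_eq (f : SysVertex m A × SysVertex m A → ℝ≥0) :
    (systemNetwork A B p).usedCost f = selectionCost p (flowInputs f) := by
  let φ : Fin m ↪ SysVertex m A × SysVertex m A :=
    ⟨fun j => (u' j, t), fun i j h => by simpa using h⟩
  have h1 : selectionCost p (flowInputs f) = ∑ e ∈ (flowInputs f).map φ, edgeCost p e := by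
    rw [Finset.sum_map]; rfl
  rw [h1]
  refine (Finset.sum_subset (fun e he => ?_) fun e he hne => ?_).symm
  · obtain ⟨j, hj, rfl⟩ := Finset.mem_map.1 he
    exact Finset.mem_filter.2 ⟨mem_edges.2 trivial, mem_flowInputs.1 hj⟩
  · rw [Finset.mem_filter] at he
    have h0 : ∀ j, e ≠ (u' j, t) := by
      rintro j rfl
      exact hne (Finset.mem_map.2 ⟨j, mem_flowInputs.2 he.2, rfl⟩)
    rcases e with ⟨_ | _ | _ | _ | _ | _ | j, _ | _ | _ | _ | _ | _ | _⟩ <;>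
      first | rfl | exact absurd rfl (h0 j)

/-- The inputs that a flow of value `q + n` uses keep the system structurally controllable. -/
theorem flowInputs_mem_feasibleSelections {f : SysVertex m A × SysVertex m A → ℝ≥0}
    (hf : (systemNetwork A B p).IsMCFFFeasible ((numNonTop A + n : ℕ) : ℝ≥0) f) :
    flowInputs f ∈ feasibleSelections A B := by
  classical
  obtain ⟨hfeas, hval⟩ := hf
  obtain ⟨hcap, h1, h2, h3, h4, h5⟩ := (isFeasible_iff f).1 hfeas
  have cN : ∀ N, f (s, scc N) ≤ 1 := fun N => hcap (s, scc N) (mem_edges.2 trivial)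
  have cX : ∀ k, f (s, x' k) ≤ 1 := fun k => hcap (s, x' k) (mem_edges.2 trivial)
  have cx : ∀ r, f (x r, t) ≤ 1 := fun r => hcap (x r, t) (mem_edges.2 trivial)
  have cu : ∀ j, f (u j, u' j) ≤ 1 := fun j => hcap (u j, u' j) (mem_edges.2 rfl)
  -- all edges at the source are saturated
  rw [value_eq] at hval
  have sN : ∑ N : {N // N ∈ nonTopSCCs A}, f (s, scc N) ≤ numNonTop A := by
    refine (Finset.sum_le_sum fun N _ => cN N).trans ?_
    simp [numNonTop]
  have sX : ∑ k : Fin n, f (s, x' k) ≤ n := by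
    refine (Finset.sum_le_sum fun k _ => cX k).trans ?_
    simp
  push_cast at hval
  have eN : ∀ N, f (s, scc N) = 1 := by
    by_contra! hne
    obtain ⟨N, hN⟩ := hne
    have hlt : ∑ N : {N // N ∈ nonTopSCCs A}, f (s, scc N) < numNonTop A := by
      refine (Finset.sum_lt_sum (fun N _ => cN N)
        ⟨N, Finset.mem_univ _, lt_of_le_of_ne (cN N) hN⟩).trans_le ?_
      simp [numNonTop]
    exact absurd hval (not_le.2 (add_lt_add_of_lt_of_le hlt sX))
  have eX : ∀ k, f (s, x' k) = 1 := by
    by_contra! hne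
    obtain ⟨k, hk⟩ := hne
    have hlt : ∑ k : Fin n, f (s, x' k) < n := by
      refine (Finset.sum_lt_sum (fun k _ => cX k)
        ⟨k, Finset.mem_univ _, lt_of_le_of_ne (cX k) hk⟩).trans_le ?_
      simp
    exact absurd hval (not_le.2 (add_lt_add_of_le_of_lt sN hlt))
  refine structurallyControllable_iff.2 ⟨fun N hN => ?_, ?_⟩
  · have := (h1 ⟨N, hN⟩).symm.trans (eN _)
    obtain ⟨j, -, hj⟩ := Finset.exists_ne_zero_of_sum_ne_zero (this.trans_ne one_ne_zero)
    rw [ne_eq, ite_eq_right_iff, Classical.not_imp] at hj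
    obtain ⟨⟨r, hr, hrj⟩, hpos⟩ := hj
    refine ⟨r, hr, ⟨j, mem_flowInputs.2 ?_⟩, hrj⟩
    rw [← h5 j]
    refine lt_of_lt_of_le (pos_iff_ne_zero.2 hpos) (le_add_right ?_)
    refine le_trans ?_ (Finset.single_le_sum (fun _ _ => zero_le)
      (Finset.mem_univ (⟨N, hN⟩ : {N // N ∈ nonTopSCCs A})))
    rw [if_pos ⟨r, hr, hrj⟩]
  · refine exists_injective_of_fractional_matching _ (fun k => Sum.elim
      (fun r => if A k r = true then f (x' k, x r) else 0)
      (fun j : {j // j ∈ flowInputs f} => if B k j = true then f (x' k, u j) else 0)) ?_ ?_ ?_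
    · rintro k (r | j) h0
      · by_contra h; exact h0 (if_neg h)
      · by_contra h; exact h0 (if_neg h)
    · intro k
      rw [← eX k, h2 k, Fintype.sum_sum_type]
      congr 1
      refine (Finset.sum_coe_sort (flowInputs f)
        (fun j => if B k j = true then f (x' k, u j) else 0)).trans ?_
      refine Finset.sum_subset (Finset.subset_univ _) fun j _ hj => ?_
      -- an input that carries no flow to the sink receives none from `x'_k`
      rw [mem_flowInputs, not_lt, nonpos_iff_eq_zero, ← h5 j, add_eq_zero, ← h4 j] at hj
      exact (Finset.sum_eq_zero_iff.1 hj.2) k (Finset.mem_univ _)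
    · rintro (r | j)
      · exact (h3 r).trans_le (cx r)
      · exact (h4 j).trans_le (cu j)

/-- Every feasible selection contains the inputs of some flow of value `q + n`. -/
theorem exists_flow_of_mem_feasibleSelections {W : Finset (Fin m)}
    (hW : W ∈ feasibleSelections A B) :
    ∃ f, (systemNetwork A B p).IsMCFFFeasible ((numNonTop A + n : ℕ) : ℝ≥0) f ∧
      flowInputs f ⊆ W := by
  classical
  obtain ⟨hacc, σ, hσ, hσE⟩ := structurallyControllable_iff.1 hW
  have hacc' : ∀ N : {N // N ∈ nonTopSCCs A}, ∃ j ∈ W, ∃ r ∈ N.1, B r j = true := by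
    intro N
    obtain ⟨r, hr, j, hj⟩ := hacc N.1 N.2
    exact ⟨j.1, j.2, r, hr, hj⟩
  choose g hgW hg using hacc'
  let τ : Fin n → Fin n ⊕ Fin m := fun k => Sum.map id Subtype.val (σ k)
  have hτ : Function.Injective τ :=
    (Sum.map_injective.2 ⟨Function.injective_id, Subtype.val_injective⟩).comp hσ
  have hτA : ∀ k r, τ k = .inl r → A k r = true := by
    intro k r h
    rcases hk : σ k with r' | j
    · have := hσE k
      have e : r' = r := by simpa [τ, hk] using h
      simpa [SysEdge, hk, e] using this
    · simp [τ, hk] at h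
  have hτB : ∀ k j, τ k = .inr j → j ∈ W ∧ B k j = true := by
    intro k j h
    rcases hk : σ k with r' | j'
    · simp [τ, hk] at h
    · have := hσE k
      have e : j'.1 = j := by simpa [τ, hk] using h
      refine ⟨e ▸ j'.2, ?_⟩
      rw [← e]
      simpa [SysEdge, hk, restrictCols] using this
  -- the number of states matched to `y`
  let c : Fin n ⊕ Fin m → ℝ≥0 := fun y => ∑ k, if τ k = y then 1 else 0
  have hc : ∀ y, c y ≤ 1 := by
    intro y
    by_cases hy : ∃ k, τ k = y
    · obtain ⟨k, rfl⟩ := hy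
      simp only [c, hτ.eq_iff]
      rw [Fintype.sum_ite_eq']
    · push Not at hy
      simp [c, hy]
  -- one unit through every component `N`, to an input `g N` that acts on it, and one unit from
  -- `x'_k` to the vertex matched to `k`
  let f : SysVertex m A × SysVertex m A → ℝ≥0 := fun e =>
    match e with
    | (s, scc _) => 1
    | (s, x' _) => 1
    | (scc N, u' j) => if g N = j then 1 else 0
    | (x' k, x r) => if τ k = .inl r then 1 else 0
    | (x' k, u j) => if τ k = .inr j then 1 else 0
    | (x r, t) => c (.inl r)
    | (u j, u' _) => c (.inr j)
    | (u' j, t) => (∑ N, if g N = j then 1 else 0) + c (.inr j)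
    | _ => 0
  refine ⟨f, ⟨(isFeasible_iff f).2 ⟨?_, ?_, ?_, ?_, ?_, ?_⟩, ?_⟩, ?_⟩
  · have hq : ∀ j, (∑ N : {N // N ∈ nonTopSCCs A}, if g N = j then (1 : ℝ≥0) else 0) ≤ n := by
      intro j
      refine (Finset.sum_le_sum (g := fun _ => (1 : ℝ≥0)) fun N _ => ?_).trans ?_
      · split_ifs <;> simp
      · have := numNonTop_le A
        rw [numNonTop] at this
        simpa using this
    rintro ⟨_ | _ | _ | _ | _ | _ | _, _ | _ | _ | _ | _ | _ | _⟩ he <;>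
      first
      | exact absurd (mem_edges.1 he) id
      | exact le_refl (1 : ℝ≥0)
      | exact hc _
      | exact add_le_add (hq _) (hc _)
      | (simp only [f, capacity]; split_ifs <;> simp)
  · intro N
    rw [Finset.sum_eq_single (g N)]
    · have := hg N
      simp only [this, if_true, f]
    · intro j _ hj
      simp [f, hj.symm]
    · simp
  · intro k
    rcases hk : τ k with r | j
    · rw [Finset.sum_eq_single r, Finset.sum_eq_zero]
      · simp [f, hk, hτA k r hk]
      · intro j _; simp [f, hk]
      · intro r' _ hr; simp [f, hk, hr.symm]
      · simp
    · rw [Finset.sum_eq_zero, Finset.sum_eq_single j]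
      · simp [f, hk, (hτB k j hk).2]
      · intro j' _ hj; simp [f, hk, hj.symm]
      · simp
      · intro r _; simp [f, hk]
  · intro r
    refine Finset.sum_congr rfl fun k _ => ?_
    by_cases h : τ k = .inl r
    · simp [f, h, hτA k r h]
    · simp [f, h]
  · intro j
    refine Finset.sum_congr rfl fun k _ => ?_
    by_cases h : τ k = .inr j
    · simp [f, h, (hτB k j h).2]
    · simp [f, h]
  · intro j
    refine congrArg (· + c (.inr j)) (Finset.sum_congr rfl fun N _ => ?_)
    by_cases h : g N = j
    · have := hg N
      rw [h] at this
      simp only [this, if_true, f]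
    · simp [f, h]
  · rw [value_eq]
    simp [f, numNonTop]
  · intro j hj
    rw [mem_flowInputs] at hj
    by_contra hjW
    refine hj.ne' (add_eq_zero.2 ⟨Finset.sum_eq_zero fun N _ => ?_,
      Finset.sum_eq_zero fun k _ => ?_⟩)
    · exact if_neg fun h : g N = j => hjW (h ▸ hgW N)
    · exact if_neg fun h : τ k = .inr j => hjW (hτB k j h).1

theorem isOptimalSelection_flowInputs {f : SysVertex m A × SysVertex m A → ℝ≥0}
    (hf : (systemNetwork A B p).IsMCFFOptimal ((numNonTop A + n : ℕ) : ℝ≥0) f) :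
    IsOptimalSelection A B p (flowInputs f) := by
  refine ⟨flowInputs_mem_feasibleSelections hf.1, fun J hJ => ?_⟩
  obtain ⟨g, hg, hgJ⟩ := exists_flow_of_mem_feasibleSelections (p := p) hJ
  have := hf.2 g hg
  rw [usedCost_eq, usedCost_eq] at this
  exact this.trans (Finset.sum_le_sum_of_subset hgJ)

/-- A nonempty set of values of the selection cost has a least element, its infimum. -/
theorem isLeast_sInf_of_subset_range {X : Set ℝ≥0} (hX : X.Nonempty)
    (h : X ⊆ Set.range (selectionCost p)) : IsLeast X (sInf X) :=
  ⟨hX.csInf_mem ((Set.finite_range _).subset h), fun _ hx => csInf_le' hx⟩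

theorem isLeast_pStar (h : StructurallyControllable A B) :
    IsLeast (selectionCosts A B p) (pStar A B p) := by
  refine isLeast_sInf_of_subset_range (p := p) ?_ (Set.image_subset_range _ _)
  refine ⟨_, Finset.univ, ?_, rfl⟩
  obtain ⟨hacc, σ, hσ, hσE⟩ := structurallyControllable_iff.1 h
  refine structurallyControllable_iff.2 ⟨fun N hN => ?_, ?_⟩
  · obtain ⟨r, hr, j, hj⟩ := hacc N hN
    exact ⟨r, hr, ⟨j, Finset.mem_univ j⟩, hj⟩
  · refine ⟨fun k => Sum.map id (fun j => ⟨j, Finset.mem_univ j⟩) (σ k),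
      (Sum.map_injective.2 ⟨Function.injective_id, fun i j h => by simpa using h⟩).comp hσ,
      fun k => ?_⟩
    have := hσE k
    rcases hk : σ k with r | j <;> simpa [SysEdge, hk, restrictCols] using this

theorem isLeast_mcffOptimum (h : StructurallyControllable A B) :
    IsLeast ((systemNetwork A B p).mcffCosts ((numNonTop A + n : ℕ) : ℝ≥0))
      ((systemNetwork A B p).mcffOptimum ((numNonTop A + n : ℕ) : ℝ≥0)) := by
  refine isLeast_sInf_of_subset_range (p := p) ?_ ?_
  · obtain ⟨I, hI, -⟩ := (isLeast_pStar (p := p) h).1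
    obtain ⟨f, hf, -⟩ := exists_flow_of_mem_feasibleSelections (p := p) hI
    exact ⟨_, f, hf, rfl⟩
  · rintro _ ⟨f, -, rfl⟩
    exact ⟨_, (usedCost_eq f).symm⟩

theorem pStar_eq_mcffOptimum (h : StructurallyControllable A B) :
    pStar A B p = (systemNetwork A B p).mcffOptimum ((numNonTop A + n : ℕ) : ℝ≥0) := by
  have h1 := isLeast_pStar (p := p) h
  have h2 := isLeast_mcffOptimum (p := p) h
  refine le_antisymm ?_ ?_
  · obtain ⟨f, hf, hc⟩ := h2.1
    rw [← hc, usedCost_eq]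
    exact h1.2 ⟨_, flowInputs_mem_feasibleSelections hf, rfl⟩
  · obtain ⟨I, hI, hc⟩ := h1.1
    obtain ⟨f, hf, hfI⟩ := exists_flow_of_mem_feasibleSelections (p := p) hI
    rw [← hc]
    refine (h2.2 ⟨f, hf, rfl⟩).trans ?_
    rw [usedCost_eq]
    exact Finset.sum_le_sum_of_subset hfI

end Network

/-! ### A program logic for the machine -/

namespace RAM

namespace State

theorem reg_setReg (S : State) (r v r' : ℕ) :
    (S.setReg r v).reg r' = if r' = r then v else S.reg r' := by
  simp [setReg, Function.update_apply]

@[simp] theorem arr_setReg (S : State) (r v : ℕ) : (S.setReg r v).arr = S.arr := rfl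
@[simp] theorem wt_setReg (S : State) (r v : ℕ) : (S.setReg r v).wt = S.wt := rfl
@[simp] theorem reg_setArr (S : State) (a i v : ℕ) : (S.setArr a i v).reg = S.reg := rfl
@[simp] theorem wt_setArr (S : State) (a i v : ℕ) : (S.setArr a i v).wt = S.wt := rfl
@[simp] theorem reg_setWt (S : State) (a i : ℕ) (w : ℝ≥0) : (S.setWt a i w).reg = S.reg := rfl
@[simp] theorem arr_setWt (S : State) (a i : ℕ) (w : ℝ≥0) : (S.setWt a i w).arr = S.arr := rfl

theorem arr_setArr (S : State) (a i v a' : ℕ) :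
    (S.setArr a i v).arr a' = if a' = a then Function.update (S.arr a) i v else S.arr a' := by
  simp [setArr, Function.update_apply]

theorem wt_setWt (S : State) (a i : ℕ) (w : ℝ≥0) (a' : ℕ) :
    (S.setWt a i w).wt a' = if a' = a then Function.update (S.wt a) i w else S.wt a' := by
  simp [setWt, Function.update_apply]

end State

namespace Prog

/-- The registers that a program may write. -/
def regs : Prog → List ℕ
  | skip => []
  | setReg r _ => [r]
  | setArr _ _ _ => []
  | zeroWt _ _ => []
  | copyWt _ _ _ _ => []
  | seq P Q => P.regs ++ Q.regs
  | ite _ P Q => P.regs ++ Q.regs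
  | loop _ P => P.regs

/-- The integer arrays that a program may write. -/
def arrs : Prog → List ℕ
  | skip => []
  | setReg _ _ => []
  | setArr a _ _ => [a]
  | zeroWt _ _ => []
  | copyWt _ _ _ _ => []
  | seq P Q => P.arrs ++ Q.arrs
  | ite _ P Q => P.arrs ++ Q.arrs
  | loop _ P => P.arrs

/-- The weight arrays that a program may write. -/
def wts : Prog → List ℕ
  | skip => []
  | setReg _ _ => []
  | setArr _ _ _ => []
  | zeroWt a _ => [a]
  | copyWt a _ _ _ => [a]
  | seq P Q => P.wts ++ Q.wts
  | ite _ P Q => P.wts ++ Q.wts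
  | loop _ P => P.wts

end Prog

/-- `S` and `S'` differ at most in what `P` may write. -/
structure Frame (P : Prog) (S S' : State) : Prop where
  reg : ∀ r, r ∉ P.regs → S'.reg r = S.reg r
  arr : ∀ a, a ∉ P.arrs → S'.arr a = S.arr a
  wt : ∀ a, a ∉ P.wts → S'.wt a = S.wt a

theorem Frame.refl (P : Prog) (S : State) : Frame P S S :=
  ⟨fun _ _ => rfl, fun _ _ => rfl, fun _ _ => rfl⟩

theorem Frame.trans {P : Prog} {S S' S'' : State} (h : Frame P S S') (h' : Frame P S' S'') :
    Frame P S S'' :=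
  ⟨fun r hr => (h'.reg r hr).trans (h.reg r hr), fun a ha => (h'.arr a ha).trans (h.arr a ha),
    fun a ha => (h'.wt a ha).trans (h.wt a ha)⟩

theorem Frame.mono {P Q : Prog} {S S' : State} (h : Frame P S S') (hr : P.regs ⊆ Q.regs)
    (ha : P.arrs ⊆ Q.arrs) (hw : P.wts ⊆ Q.wts) : Frame Q S S' :=
  ⟨fun r h' => h.reg r fun h'' => h' (hr h''), fun a h' => h.arr a fun h'' => h' (ha h''),
    fun a h' => h.wt a fun h'' => h' (hw h'')⟩

theorem Runs.frame {P : Prog} {S S' : State} {T : ℕ} (h : Runs P S S' T) : Frame P S S' := by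
  induction h with
  | skip S => exact .refl _ _
  | setReg S r e =>
    exact ⟨fun r' h => by simp_all [State.reg_setReg, Prog.regs], fun _ _ => rfl, fun _ _ => rfl⟩
  | setArr S a i e =>
    exact ⟨fun _ _ => rfl, fun a' h => by simp_all [State.arr_setArr, Prog.arrs], fun _ _ => rfl⟩
  | zeroWt S a i =>
    exact ⟨fun _ _ => rfl, fun _ _ => rfl, fun a' h => by simp_all [State.wt_setWt, Prog.wts]⟩
  | copyWt S a i b j =>
    exact ⟨fun _ _ => rfl, fun _ _ => rfl, fun a' h => by simp_all [State.wt_setWt, Prog.wts]⟩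
  | seq _ _ ih ih' =>
    exact (ih.mono (List.subset_append_left _ _) (List.subset_append_left _ _)
      (List.subset_append_left _ _)).trans (ih'.mono (List.subset_append_right _ _)
      (List.subset_append_right _ _) (List.subset_append_right _ _))
  | iteTrue _ _ ih =>
    exact ih.mono (List.subset_append_left _ _) (List.subset_append_left _ _)
      (List.subset_append_left _ _)
  | iteFalse _ _ ih =>
    exact ih.mono (List.subset_append_right _ _) (List.subset_append_right _ _)
      (List.subset_append_right _ _)
  | loopTrue _ _ _ ih ih' => exact ⟨(ih.trans ⟨ih'.reg, ih'.arr, ih'.wt⟩).reg,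
      (ih.trans ⟨ih'.reg, ih'.arr, ih'.wt⟩).arr, (ih.trans ⟨ih'.reg, ih'.arr, ih'.wt⟩).wt⟩
  | loopFalse _ => exact .refl _ _

/-- Started in `S`, the program `P` halts, and the final state and the running time satisfy `Φ`. -/
def Ends (P : Prog) (S : State) (Φ : State → ℕ → Prop) : Prop :=
  ∃ S' T, Runs P S S' T ∧ Φ S' T

theorem Ends.mono {P : Prog} {S : State} {Φ Ψ : State → ℕ → Prop} (h : Ends P S Φ)
    (hΦ : ∀ S' T, Frame P S S' → Φ S' T → Ψ S' T) : Ends P S Ψ := by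
  obtain ⟨S', T, hr, hS⟩ := h
  exact ⟨S', T, hr, hΦ _ _ hr.frame hS⟩

theorem Ends.skip {S : State} {Φ : State → ℕ → Prop} (h : Φ S 1) : Ends .skip S Φ :=
  ⟨_, _, .skip S, h⟩

theorem Ends.setReg {S : State} {r : ℕ} {e : Exp} {Φ : State → ℕ → Prop}
    (h : Φ (S.setReg r (e.eval S)) (e.steps + 1)) : Ends (.setReg r e) S Φ :=
  ⟨_, _, .setReg S r e, h⟩

theorem Ends.setArr {S : State} {a : ℕ} {i e : Exp} {Φ : State → ℕ → Prop}
    (h : Φ (S.setArr a (i.eval S) (e.eval S)) (i.steps + e.steps + 1)) :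
    Ends (.setArr a i e) S Φ :=
  ⟨_, _, .setArr S a i e, h⟩

theorem Ends.zeroWt {S : State} {a : ℕ} {i : Exp} {Φ : State → ℕ → Prop}
    (h : Φ (S.setWt a (i.eval S) 0) (i.steps + 1)) : Ends (.zeroWt a i) S Φ :=
  ⟨_, _, .zeroWt S a i, h⟩

theorem Ends.copyWt {S : State} {a b : ℕ} {i j : Exp} {Φ : State → ℕ → Prop}
    (h : Φ (S.setWt a (i.eval S) (S.wt b (j.eval S))) (i.steps + j.steps + 1)) :
    Ends (.copyWt a i b j) S Φ :=
  ⟨_, _, .copyWt S a i b j, h⟩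

theorem Ends.seq {P Q : Prog} {S : State} {Φ : State → ℕ → Prop}
    (h : Ends P S fun S' T => Ends Q S' fun S'' T' => Φ S'' (T + T')) : Ends (.seq P Q) S Φ := by
  obtain ⟨S', T, hP, S'', T', hQ, hΦ⟩ := h
  exact ⟨_, _, .seq hP hQ, hΦ⟩

theorem Ends.ite {c : Exp} {P Q : Prog} {S : State} {Φ : State → ℕ → Prop}
    (h₁ : c.eval S ≠ 0 → Ends P S fun S' T => Φ S' (c.steps + 1 + T))
    (h₂ : c.eval S = 0 → Ends Q S fun S' T => Φ S' (c.steps + 1 + T)) :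
    Ends (.ite c P Q) S Φ := by
  by_cases hc : c.eval S = 0
  · obtain ⟨S', T, h, hΦ⟩ := h₂ hc
    exact ⟨_, _, .iteFalse hc h, hΦ⟩
  · obtain ⟨S', T, h, hΦ⟩ := h₁ hc
    exact ⟨_, _, .iteTrue hc h, hΦ⟩

/-- The loop rule. The invariant may depend on the time elapsed since the loop was entered, which
accommodates amortized bounds; `d` decreases with every round. -/
theorem Ends.loop {c : Exp} {P : Prog} {S₀ : State} (Inv : State → ℕ → Prop) (d : State → ℕ)
    (hstep : ∀ S t, Frame P S₀ S → Inv S t → c.eval S ≠ 0 →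
      Ends P S fun S' T => d S' < d S ∧ Inv S' (t + (c.steps + 1 + T)))
    (h₀ : Inv S₀ 0) {Φ : State → ℕ → Prop}
    (hΦ : ∀ S t, Frame P S₀ S → Inv S t → c.eval S = 0 → Φ S (t + (c.steps + 1))) :
    Ends (.loop c P) S₀ Φ := by
  suffices H : ∀ k S t, d S = k → Frame P S₀ S → Inv S t →
      Ends (.loop c P) S fun S' T => Φ S' (t + T) by
    simpa using H _ S₀ 0 rfl (.refl _ _) h₀
  intro k
  induction k using Nat.strong_induction_on with
  | _ k ih =>
    intro S t hk hF hI
    by_cases hc : c.eval S = 0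
    · exact ⟨_, _, .loopFalse hc, hΦ S t hF hI hc⟩
    · obtain ⟨S', T, hr, hd, hI'⟩ := hstep S t hF hI hc
      obtain ⟨S'', T', hr', hΦ'⟩ := ih _ (hk ▸ hd) S' _ rfl (hF.trans hr.frame) hI'
      refine ⟨_, _, .loopTrue hc hr hr', ?_⟩
      convert hΦ' using 1
      ring

/-- `for r := 0, …, N - 1 do P`, where `N` is the value of `e`. -/
def Prog.forTo (r : ℕ) (e : Exp) (P : Prog) : Prog :=
  .seq (.setReg r (.lit 0))
    (.loop (.lt (.reg r) e) (.seq P (.setReg r (.add (.reg r) (.lit 1)))))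

theorem Ends.forTo {r N : ℕ} {e : Exp} {P : Prog} {S₀ : State} (Inv : ℕ → State → ℕ → Prop)
    (hr : r ∉ P.regs)
    (he : ∀ S, Frame (Prog.forTo r e P) S₀ S → e.eval S = N)
    (h₀ : Inv 0 (S₀.setReg r 0) 0)
    (hstep : ∀ i S t, i < N → Frame (Prog.forTo r e P) S₀ S → S.reg r = i → Inv i S t →
      Ends P S fun S' T => Inv (i + 1) (S'.setReg r (i + 1)) (t + (e.steps + 7 + T)))
    {Φ : State → ℕ → Prop}
    (hΦ : ∀ S t, Frame (Prog.forTo r e P) S₀ S → Inv N S t → Φ S (t + (e.steps + 5))) :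
    Ends (Prog.forTo r e P) S₀ Φ := by
  have hF₀ : Frame (Prog.forTo r e P) S₀ (S₀.setReg r 0) :=
    (Runs.setReg S₀ r (.lit 0)).frame.mono (by simp [Prog.forTo, Prog.regs])
      (by simp [Prog.arrs]) (by simp [Prog.wts])
  have hFl : ∀ S, Frame (.seq P (.setReg r (.add (.reg r) (.lit 1)))) (S₀.setReg r 0) S →
      Frame (Prog.forTo r e P) S₀ S := fun S hS =>
    hF₀.trans (hS.mono (by simp [Prog.forTo, Prog.regs]) (by simp [Prog.forTo, Prog.arrs])
      (by simp [Prog.forTo, Prog.wts]))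
  refine Ends.seq (Ends.setReg ?_)
  refine Ends.loop (fun S t => S.reg r ≤ N ∧ Inv (S.reg r) S t) (fun S => N - S.reg r) ?_ ?_ ?_
  · rintro S t hF ⟨hle, hI⟩ hc
    have hF' := hFl S hF
    have hlt : S.reg r < N := by
      by_contra hn
      exact hc (by simp [Exp.eval, he S hF', hn])
    refine Ends.seq ((hstep _ S t hlt hF' rfl hI).mono fun S' T hP hI' => Ends.setReg ?_)
    have hr' : S'.reg r = S.reg r := hP.reg r hr
    have e1 : (Exp.add (.reg r) (.lit 1)).eval S' = S.reg r + 1 := by simp [Exp.eval, hr']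
    rw [e1]
    have e2 : (S'.setReg r (S.reg r + 1)).reg r = S.reg r + 1 := by simp [State.reg_setReg]
    rw [e2]
    refine ⟨by omega, by omega, ?_⟩
    convert hI' using 1
    simp [Exp.steps]; ring
  · have e2 : (S₀.setReg r 0).reg r = 0 := by simp [State.reg_setReg]
    simp only [Exp.eval, e2]
    exact ⟨Nat.zero_le _, h₀⟩
  · rintro S t hF ⟨hle, hI⟩ hc
    have hF' := hFl S hF
    have heq : S.reg r = N := by
      by_contra hn
      have : S.reg r < N := lt_of_le_of_ne hle hn
      simp [Exp.eval, he S hF', this] at hc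
    rw [heq] at hI
    convert hΦ S t hF' hI using 1
    simp [Exp.steps]; ring

end RAM

/-! ### Sweeping a digraph by breadth-first searches -/

namespace RAM

/-- The state of a breadth-first search from `v` with colour `c`, in a digraph `R` with vertices
`0, …, n - 1`, some of which have the nonzero colours `M₀` from earlier searches. The first `tail`
entries of the queue are the coloured vertices. -/
structure Search (n : ℕ) (R : ℕ → ℕ → Prop) (M₀ : ℕ → ℕ) (v c : ℕ) (mark queue : ℕ → ℕ)
    (tail : ℕ) : Prop where
  lt : ∀ k < tail, queue k < n
  marked : ∀ k < tail, mark (queue k) ≠ 0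
  inj : ∀ k < tail, ∀ l < tail, queue k = queue l → k = l
  surj : ∀ y < n, mark y ≠ 0 → ∃ k < tail, queue k = y
  sound : ∀ y, mark y ≠ M₀ y → mark y = c ∧ M₀ y = 0 ∧ Relation.ReflTransGen R v y

namespace Search

variable {n : ℕ} {R : ℕ → ℕ → Prop} {M₀ mark queue : ℕ → ℕ} {v c tail : ℕ}

theorem tail_le (h : Search n R M₀ v c mark queue tail) : tail ≤ n := by
  have := Fintype.card_le_of_injective (fun k : Fin tail => (⟨queue k, h.lt k k.2⟩ : Fin n))
    (fun k l hkl => Fin.ext (h.inj k k.2 l l.2 (by simpa using hkl)))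
  simpa using this

theorem push (h : Search n R M₀ v c mark queue tail) (hc : c ≠ 0) {y : ℕ} (hy : y < n)
    (hmark : mark y = 0) (hR : Relation.ReflTransGen R v y) :
    Search n R M₀ v c (Function.update mark y c) (Function.update queue tail y) (tail + 1) := by
  have hq : ∀ k < tail, Function.update queue tail y k = queue k := fun k hk =>
    Function.update_of_ne hk.ne _ _
  have hne : ∀ k < tail, queue k ≠ y := fun k hk h' => h.marked k hk (h' ▸ hmark)
  have hsplit : ∀ k < tail + 1, k < tail ∨ k = tail := fun k hk => by omega
  refine ⟨fun k hk => ?_, fun k hk => ?_, fun k hk l hl hkl => ?_, fun z hz hm => ?_,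
    fun z hz => ?_⟩
  · rcases hsplit k hk with hk | rfl
    · rw [hq k hk]; exact h.lt k hk
    · simpa using hy
  · rcases hsplit k hk with hk | rfl
    · rw [hq k hk, Function.update_of_ne (hne k hk)]; exact h.marked k hk
    · simpa using hc
  · rcases hsplit k hk with hk | rfl <;> rcases hsplit l hl with hl | rfl
    · rw [hq k hk, hq l hl] at hkl; exact h.inj k hk l hl hkl
    · rw [hq k hk, Function.update_self] at hkl; exact absurd hkl (hne k hk)
    · rw [hq l hl, Function.update_self] at hkl; exact absurd hkl.symm (hne l hl)
    · rfl
  · by_cases hzy : z = y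
    · exact ⟨tail, by omega, by simp [hzy]⟩
    · rw [Function.update_of_ne hzy] at hm
      obtain ⟨k, hk, hkz⟩ := h.surj z hz hm
      exact ⟨k, by omega, by rw [hq k hk, hkz]⟩
  · by_cases hzy : z = y
    · subst hzy
      refine ⟨by simp, ?_, hR⟩
      by_contra h0
      exact h0 (h.sound z (by rw [hmark]; exact Ne.symm h0)).2.1
    · rw [Function.update_of_ne hzy] at hz ⊢
      exact h.sound z hz

/-- When all coloured vertices have been scanned, exactly the vertices reachable from `v` that had
no colour before have obtained the colour `c`. -/
theorem mark_eq (h : Search n R M₀ v c mark queue tail) (hR : ∀ x y, R x y → y < n)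
    (hv : v < n) (hmv : mark v ≠ 0)
    (hscan : ∀ k < tail, ∀ y, R (queue k) y → mark y ≠ 0) (y : ℕ) :
    (M₀ y = 0 → Relation.ReflTransGen R v y → mark y = c) ∧
      (M₀ y = 0 → ¬ Relation.ReflTransGen R v y → mark y = 0) ∧
      (M₀ y ≠ 0 → mark y = M₀ y) := by
  refine ⟨fun h0 hvy => ?_, fun h0 hvy => ?_, fun h0 => ?_⟩
  · have hne : mark y ≠ 0 ∧ y < n := by
      clear h0
      induction hvy with
      | refl => exact ⟨hmv, hv⟩
      | tail _ hxy ih =>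
        obtain ⟨k, hk, hkx⟩ := h.surj _ ih.2 ih.1
        exact ⟨hscan k hk _ (hkx ▸ hxy), hR _ _ hxy⟩
    exact (h.sound y (by rw [h0]; exact hne.1)).1
  · by_contra hne
    exact hvy (h.sound y (by rw [h0]; exact hne)).2.2
  · by_contra hne
    exact h0 (h.sound y hne).2.1

end Search

/-- Give the vertex in register `r` the colour in register 6 and append it to the queue (array 6,
length in register 8). -/
def pushProg (Mk r : ℕ) : Prog :=
  .seq (.setArr Mk (.reg r) (.reg 6))
    (.seq (.setArr 6 (.reg 8) (.reg r)) (.setReg 8 (.add (.reg 8) (.lit 1))))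

/-- Push the uncoloured successors of the vertex in register 11. The expression `adj` tests the
adjacency of the vertices in registers 11 and 12. -/
def scanProg (Mk : ℕ) (adj : Exp) : Prog :=
  .forTo 12 (.reg 0)
    (.ite adj (.ite (.eq (.arr Mk (.reg 12)) (.lit 0)) (pushProg Mk 12) .skip) .skip)

/-- Scan the vertices in the queue from position `reg 7` on. -/
def searchProg (Mk : ℕ) (adj : Exp) : Prog :=
  .loop (.lt (.reg 7) (.reg 8))
    (.seq (.setReg 11 (.arr 6 (.reg 7)))
      (.seq (.setReg 7 (.add (.reg 7) (.lit 1))) (scanProg Mk adj)))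

/-- Treat the vertex `pick` (an expression in register 9): if it satisfies `cand` and has no
colour, then record it as a root in the array `Rt` and search from it with a new colour. -/
def sweepStep (Mk Rt : ℕ) (adj pick cand : Exp) : Prog :=
  .seq (.setReg 10 pick)
    (.ite cand
      (.ite (.eq (.arr Mk (.reg 10)) (.lit 0))
        (.seq (.setArr Rt (.reg 10) (.lit 1))
          (.seq (pushProg Mk 10)
            (.seq (searchProg Mk adj) (.setReg 6 (.add (.reg 6) (.lit 1))))))
        .skip)
      .skip)

/-- Search from all candidates, in the order given by `pick`. The colours are consecutive numbers
that start with the content of register 5. -/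
def sweep (Mk Rt : ℕ) (adj pick cand : Exp) : Prog :=
  .seq (.setReg 6 (.reg 5)) (.seq (.setReg 7 (.lit 0)) (.seq (.setReg 8 (.lit 0))
    (.forTo 9 (.reg 0) (sweepStep Mk Rt adj pick cand))))

theorem Ends.pushProg {Mk r : ℕ} (hMk : Mk ≠ 6) {S : State} {Φ : State → ℕ → Prop}
    (h : ∀ S', S'.arr Mk = Function.update (S.arr Mk) (S.reg r) (S.reg 6) →
      S'.arr 6 = Function.update (S.arr 6) (S.reg 8) (S.reg r) → S'.reg 8 = S.reg 8 + 1 →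
      Φ S' 10) : Ends (pushProg Mk r) S Φ := by
  refine Ends.seq (Ends.setArr (Ends.seq (Ends.setArr (Ends.setReg ?_))))
  refine h _ ?_ ?_ ?_
  · simp [State.arr_setArr, hMk, Exp.eval]
  · simp [State.arr_setArr, hMk.symm, Exp.eval]
  · simp [State.reg_setReg, Exp.eval]

theorem sweep_regs (Mk Rt : ℕ) (adj pick cand : Exp) :
    (sweep Mk Rt adj pick cand).regs ⊆ [6, 7, 8, 9, 10, 11, 12] := by
  simp [sweep, sweepStep, searchProg, scanProg, Prog.forTo, RAM.pushProg, Prog.regs]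

theorem sweep_arrs (Mk Rt : ℕ) (adj pick cand : Exp) :
    (sweep Mk Rt adj pick cand).arrs ⊆ [6, Mk, Rt] := by
  simp [sweep, sweepStep, searchProg, scanProg, Prog.forTo, RAM.pushProg, Prog.arrs]

theorem sweep_wts (Mk Rt : ℕ) (adj pick cand : Exp) :
    (sweep Mk Rt adj pick cand).wts = [] := by
  simp [sweep, sweepStep, searchProg, scanProg, Prog.forTo, RAM.pushProg, Prog.wts]

section Sweep

variable {n : ℕ} {R : ℕ → ℕ → Prop} {Mk Rt : ℕ} {adj pick cand : Exp}

theorem scanProg_frame {S S' : State} (h : Frame (scanProg Mk adj) S S') :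
    Frame (sweep Mk Rt adj pick cand) S S' := by
  refine h.mono ?_ ?_ ?_ <;>
    simp [sweep, sweepStep, searchProg, scanProg, Prog.forTo, RAM.pushProg, Prog.regs, Prog.arrs,
      Prog.wts]

theorem searchProg_frame {S S' : State} (h : Frame (searchProg Mk adj) S S') :
    Frame (sweep Mk Rt adj pick cand) S S' := by
  refine h.mono ?_ ?_ ?_ <;>
    simp [sweep, sweepStep, searchProg, scanProg, Prog.forTo, RAM.pushProg, Prog.regs, Prog.arrs,
      Prog.wts]

/-- What a sweep presupposes: `Env` describes the part of the memory that a sweep does not write,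
and determines the number of vertices and the meaning of the expressions. -/
structure SweepSetup (n base : ℕ) (R : ℕ → ℕ → Prop) (Mk Rt : ℕ) (adj pick cand : Exp)
    (next : ℕ → ℕ) (K : ℕ → Prop) (Env : State → Prop) : Prop where
  mk_ne : Mk ≠ 6
  rt_ne : Rt ≠ 6
  mk_rt : Mk ≠ Rt
  base_ne : base ≠ 0
  lt : ∀ x y, R x y → x < n ∧ y < n
  next_lt : ∀ i < n, next i < n
  next_next : ∀ i < n, next (next i) = i
  frame : ∀ S S', Frame (sweep Mk Rt adj pick cand) S S' → Env S → Env S'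
  reg0 : ∀ S, Env S → S.reg 0 = n
  reg5 : ∀ S, Env S → S.reg 5 = base
  adj_iff : ∀ S, Env S → S.reg 11 < n → S.reg 12 < n →
    (adj.eval S ≠ 0 ↔ R (S.reg 11) (S.reg 12))
  pick_eq : ∀ S, Env S → pick.eval S = next (S.reg 9)
  cand_iff : ∀ S, Env S → S.reg 10 < n → (cand.eval S ≠ 0 ↔ K (S.reg 10))

variable {base : ℕ} {next : ℕ → ℕ} {K : ℕ → Prop} {Env : State → Prop}

/-- A scan of a coloured vertex `x` preserves the search invariant and colours all successors of
`x`. The hypothesis `hM₀` says that the earlier searches are complete; hence every new vertex is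
reached from `v`, even if `x` was coloured earlier. -/
theorem SweepSetup.scanProg (h : SweepSetup n base R Mk Rt adj pick cand next K Env)
    {S₀ : State} (hE : Env S₀) {M₀ : ℕ → ℕ} {v c : ℕ} (hc : c ≠ 0) (hreg : S₀.reg 6 = c)
    (hM₀ : ∀ x y, M₀ x ≠ 0 → R x y → M₀ y ≠ 0)
    (hS : Search n R M₀ v c (S₀.arr Mk) (S₀.arr 6) (S₀.reg 8))
    (hx : S₀.reg 11 < n) (hmx : S₀.arr Mk (S₀.reg 11) ≠ 0) :
    Ends (scanProg Mk adj) S₀ fun S T => Search n R M₀ v c (S.arr Mk) (S.arr 6) (S.reg 8) ∧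
      (∀ y, R (S₀.reg 11) y → S.arr Mk y ≠ 0) ∧ (∀ y, S₀.arr Mk y ≠ 0 → S.arr Mk y ≠ 0) ∧
      (∀ k < S₀.reg 8, S.arr 6 k = S₀.arr 6 k) ∧ S₀.reg 8 ≤ S.reg 8 ∧
      T ≤ n * (adj.steps + 30) + 6 := by
  have hr8 : ∀ (S : State) (i : ℕ), (S.setReg 12 i).reg 8 = S.reg 8 := by
    simp [State.reg_setReg]
  refine Ends.forTo (N := n) (fun i S t => Search n R M₀ v c (S.arr Mk) (S.arr 6) (S.reg 8) ∧
      (∀ y < i, R (S₀.reg 11) y → S.arr Mk y ≠ 0) ∧ (∀ y, S₀.arr Mk y ≠ 0 → S.arr Mk y ≠ 0) ∧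
      (∀ k < S₀.reg 8, S.arr 6 k = S₀.arr 6 k) ∧ S₀.reg 8 ≤ S.reg 8 ∧
      t ≤ i * (adj.steps + 30)) ?_ ?_ ?_ ?_ ?_
  · simp [RAM.pushProg, Prog.regs]
  · intro S hF
    exact h.reg0 S (h.frame _ _ (scanProg_frame hF) hE)
  · simpa [State.reg_setReg] using hS
  · rintro i S t hi hF hr ⟨h1, h2, h3, h4, h5, h6⟩
    have hES := h.frame _ _ (scanProg_frame hF) hE
    have r11 : S.reg 11 = S₀.reg 11 := hF.reg 11 (by
      simp [Prog.forTo, RAM.pushProg, Prog.regs])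
    have r6 : S.reg 6 = c := (hF.reg 6 (by
      simp [Prog.forTo, RAM.pushProg, Prog.regs])).trans hreg
    have hadj := h.adj_iff S hES (r11 ▸ hx) (hr ▸ hi)
    rw [r11, hr] at hadj
    have ht : ∀ T, T ≤ adj.steps + 18 →
        t + ((Exp.reg 0).steps + 7 + T) ≤ (i + 1) * (adj.steps + 30) := by
      intro T hT
      simp only [Exp.steps]
      rw [add_mul, one_mul]; omega
    -- all cases in which nothing is pushed
    have hskip : ∀ T, T ≤ adj.steps + 18 → (R (S₀.reg 11) i → S.arr Mk i ≠ 0) →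
        Search n R M₀ v c (S.arr Mk) (S.arr 6) (S.reg 8) ∧
        (∀ y < i + 1, R (S₀.reg 11) y → S.arr Mk y ≠ 0) ∧
        (∀ y, S₀.arr Mk y ≠ 0 → S.arr Mk y ≠ 0) ∧
        (∀ k < S₀.reg 8, S.arr 6 k = S₀.arr 6 k) ∧ S₀.reg 8 ≤ S.reg 8 ∧
        t + ((Exp.reg 0).steps + 7 + T) ≤ (i + 1) * (adj.steps + 30) := by
      refine fun T hT hi' => ⟨h1, fun y hy hRy => ?_, h3, h4, h5, ht T hT⟩
      rcases Nat.lt_succ_iff_lt_or_eq.1 hy with hy | rfl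
      · exact h2 y hy hRy
      · exact hi' hRy
    refine Ends.ite (fun hc1 => Ends.ite (fun hc2 => Ends.pushProg h.mk_ne ?_)
      (fun hc2 => Ends.skip ?_)) (fun hc1 => Ends.skip ?_)
    · have hmi : S.arr Mk i = 0 := by
        by_contra h0
        simp [Exp.eval, hr, h0] at hc2
      have hRi := hadj.1 hc1
      have hreach : Relation.ReflTransGen R v i := by
        by_cases h0 : M₀ (S₀.reg 11) = 0
        · exact (h1.sound (S₀.reg 11) (by rw [h0]; exact h3 _ hmx)).2.2.tail hRi
        · have := h1.sound i (by rw [hmi]; exact (hM₀ _ _ h0 hRi).symm)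
          exact absurd this.2.1 (hM₀ _ _ h0 hRi)
      intro S' e1 e2 e3
      rw [hr, r6] at e1
      rw [hr] at e2
      have hmono : ∀ y, S.arr Mk y ≠ 0 → S'.arr Mk y ≠ 0 := by
        intro y hy
        rw [e1]
        by_cases hyi : y = i
        · simpa [hyi] using hc
        · rwa [Function.update_of_ne hyi]
      simp only [State.arr_setReg, hr8]
      refine ⟨?_, fun y hy hRy => ?_, fun y hy => hmono y (h3 y hy), fun k hk => ?_, by omega,
        ht _ ?_⟩
      · rw [e1, e2, e3]
        exact h1.push hc hi hmi hreach
      · rcases Nat.lt_succ_iff_lt_or_eq.1 hy with hy | rfl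
        · exact hmono y (h2 y hy hRy)
        · rw [e1]; simpa using hc
      · rw [e2, Function.update_of_ne (by omega)]
        exact h4 k hk
      · simp [Exp.steps]
    · simp only [State.arr_setReg, hr8]
      refine hskip _ ?_ fun _ h0 => ?_
      · simp [Exp.steps]
      · simp [Exp.eval, hr, h0] at hc2
    · simp only [State.arr_setReg, hr8]
      refine hskip _ ?_ fun hRi => absurd hc1 (hadj.2 hRi)
      omega
  · rintro S t hF ⟨h1, h2, h3, h4, h5, h6⟩
    refine ⟨h1, fun y hy => h2 y (h.lt _ _ hy).2 hy, h3, h4, h5, ?_⟩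
    simp only [Exp.steps]
    omega

/-- At the end of a search the whole queue has been scanned. The running time is bounded by the
advance of the head of the queue (register 7), so that the times of successive searches add up to
the time for scanning every vertex once. -/
theorem SweepSetup.searchProg (h : SweepSetup n base R Mk Rt adj pick cand next K Env)
    {S₀ : State} (hE : Env S₀) {M₀ : ℕ → ℕ} {v c : ℕ} (hc : c ≠ 0) (hreg : S₀.reg 6 = c)
    (hM₀ : ∀ x y, M₀ x ≠ 0 → R x y → M₀ y ≠ 0)
    (hS : Search n R M₀ v c (S₀.arr Mk) (S₀.arr 6) (S₀.reg 8))
    (hscan : ∀ k < S₀.reg 7, ∀ y, R (S₀.arr 6 k) y → S₀.arr Mk y ≠ 0)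
    (hle : S₀.reg 7 ≤ S₀.reg 8) (hmv : S₀.arr Mk v ≠ 0) :
    Ends (searchProg Mk adj) S₀ fun S T => Search n R M₀ v c (S.arr Mk) (S.arr 6) (S.reg 8) ∧
      (∀ k < S.reg 8, ∀ y, R (S.arr 6 k) y → S.arr Mk y ≠ 0) ∧ S.reg 7 = S.reg 8 ∧
      S.arr Mk v ≠ 0 ∧
      T + S₀.reg 7 * (n * (adj.steps + 30) + 20) ≤
        S.reg 7 * (n * (adj.steps + 30) + 20) + 4 := by
  set W := n * (adj.steps + 30) + 20 with hW
  refine Ends.loop (fun S t => Search n R M₀ v c (S.arr Mk) (S.arr 6) (S.reg 8) ∧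
      (∀ k < S.reg 7, ∀ y, R (S.arr 6 k) y → S.arr Mk y ≠ 0) ∧ S.reg 7 ≤ S.reg 8 ∧
      S.arr Mk v ≠ 0 ∧ t + S₀.reg 7 * W ≤ S.reg 7 * W) (fun S => n - S.reg 7) ?_ ?_ ?_
  · rintro S t hF ⟨h1, h2, h3, h4, h5⟩ hcnd
    have hES := h.frame _ _ (searchProg_frame ⟨hF.reg, hF.arr, hF.wt⟩) hE
    have hlt : S.reg 7 < S.reg 8 := by
      by_contra h0
      simp [Exp.eval, h0] at hcnd
    have r6 : S.reg 6 = c := (hF.reg 6 (by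
      simp [RAM.scanProg, Prog.forTo, RAM.pushProg, Prog.regs])).trans hreg
    refine Ends.seq (Ends.setReg (Ends.seq (Ends.setReg ?_)))
    set S₁ := (S.setReg 11 ((Exp.arr 6 (.reg 7)).eval S)).setReg 7
      ((Exp.add (.reg 7) (.lit 1)).eval (S.setReg 11 ((Exp.arr 6 (.reg 7)).eval S))) with hS₁
    have hFS₁ : Frame (sweep Mk Rt adj pick cand) S S₁ := by
      refine ⟨fun r hr => ?_, fun a _ => rfl, fun a _ => rfl⟩
      have : r ≠ 7 ∧ r ≠ 11 := by
        constructor <;> rintro rfl <;> exact hr (by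
          simp [sweep, sweepStep, RAM.searchProg, RAM.scanProg, Prog.forTo, RAM.pushProg,
            Prog.regs])
      simp [hS₁, State.reg_setReg, this.1, this.2]
    have s11 : S₁.reg 11 = S.arr 6 (S.reg 7) := by simp [hS₁, State.reg_setReg, Exp.eval]
    have s7 : S₁.reg 7 = S.reg 7 + 1 := by simp [hS₁, State.reg_setReg, Exp.eval]
    have s8 : S₁.reg 8 = S.reg 8 := by simp [hS₁, State.reg_setReg]
    have s6 : S₁.reg 6 = c := by simpa [hS₁, State.reg_setReg] using r6
    have sarr : S₁.arr = S.arr := rfl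
    refine (h.scanProg (S₀ := S₁) (h.frame _ _ hFS₁ hES) hc s6 hM₀
      (by rw [sarr, s8]; exact h1) (by rw [s11]; exact h1.lt _ hlt)
      (by rw [s11, sarr]; exact h1.marked _ hlt)).mono ?_
    rintro S' T hF' ⟨g1, g2, g3, g4, g5, g6⟩
    have t7 : S'.reg 7 = S.reg 7 + 1 := (hF'.reg 7 (by
      simp [RAM.scanProg, Prog.forTo, RAM.pushProg, Prog.regs])).trans s7
    have hn := h1.tail_le
    rw [s11, sarr] at *
    rw [s8] at g4 g5
    refine ⟨by omega, g1, fun k hk y hRy => ?_, by omega, g3 v h4, ?_⟩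
    · rw [t7] at hk
      rw [g4 k (by omega)] at hRy
      rcases Nat.lt_succ_iff_lt_or_eq.1 hk with hk | rfl
      · exact g3 y (h2 k hk y hRy)
      · exact g2 y hRy
    · rw [t7, add_mul, one_mul]
      simp only [Exp.steps]
      omega
  · exact ⟨hS, hscan, hle, hmv, by omega⟩
  · rintro S t hF ⟨h1, h2, h3, h4, h5⟩ hcnd
    have heq : S.reg 7 = S.reg 8 := by
      by_contra h0
      have : S.reg 7 < S.reg 8 := lt_of_le_of_ne h3 h0
      simp [Exp.eval, this] at hcnd
    refine ⟨h1, fun k hk => h2 k (heq ▸ hk), heq, h4, ?_⟩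
    simp only [Exp.steps]
    omega

end Sweep

end RAM

namespace RAM

/-- The outcome of a sweep that has treated the vertices `next 0, …, next (i - 1)`: `ρ` lists the
roots in the order of their discovery, and the colour `base + k` of a vertex tells that `ρ[k]` is
the first root from which it is reachable. -/
structure Swept (n base : ℕ) (R : ℕ → ℕ → Prop) (next : ℕ → ℕ) (K : ℕ → Prop) (i : ℕ)
    (ρ : List ℕ) (mark root : ℕ → ℕ) : Prop where
  root_iff : ∀ v, root v ≠ 0 ↔ v ∈ ρ
  mem : ∀ r ∈ ρ, r < n ∧ K r ∧ next r < i
  pairwise : ρ.Pairwise fun a b => ¬ Relation.ReflTransGen R a b ∧ next a < next b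
  cover : ∀ v < n, next v < i → K v → ∃ r ∈ ρ, Relation.ReflTransGen R r v ∧ next r ≤ next v
  colour : ∀ y, mark y ≠ 0 → ∃ (k : ℕ) (h : k < ρ.length), mark y = base + k ∧
    Relation.ReflTransGen R ρ[k] y
  least : ∀ (k : ℕ) (h : k < ρ.length) (y : ℕ), Relation.ReflTransGen R ρ[k] y →
    mark y ≠ 0 ∧ mark y ≤ base + k

namespace Swept

variable {n base : ℕ} {R : ℕ → ℕ → Prop} {next : ℕ → ℕ} {K : ℕ → Prop} {i : ℕ} {ρ : List ℕ}
  {mark root : ℕ → ℕ}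

theorem zero (mark root : ℕ → ℕ) (hm : ∀ y, mark y = 0) (hr : ∀ y, root y = 0) :
    Swept n base R next K 0 [] mark root := by
  refine ⟨?_, ?_, ?_, ?_, ?_, ?_⟩ <;> simp [hm, hr]

/-- A vertex that is no candidate or that has a colour already is passed over. -/
theorem skip (h : Swept n base R next K i ρ mark root)
    (hnn : ∀ v < n, next (next v) = v) (hv : K (next i) → mark (next i) ≠ 0) :
    Swept n base R next K (i + 1) ρ mark root := by
  refine ⟨h.root_iff, fun r hr => ?_, h.pairwise, fun v hvn hvi hK => ?_, h.colour, h.least⟩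
  · obtain ⟨h1, h2, h3⟩ := h.mem r hr
    exact ⟨h1, h2, by omega⟩
  · rcases Nat.lt_succ_iff_lt_or_eq.1 hvi with hlt | rfl
    · exact h.cover v hvn hlt hK
    · rw [hnn v hvn] at hv
      obtain ⟨k, hk, -, hreach⟩ := h.colour v (hv hK)
      exact ⟨_, List.getElem_mem hk, hreach, (h.mem _ (List.getElem_mem hk)).2.2.le⟩

/-- An uncoloured candidate becomes a root, and the uncoloured vertices it reaches get its
colour. -/
theorem snoc (h : Swept n base R next K i ρ mark root) (hb : base ≠ 0)
    (hnn : ∀ v < n, next (next v) = v) (hin : i < n) (hvn : next i < n) (hK : K (next i))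
    (hm0 : mark (next i) = 0) {mark' root' : ℕ → ℕ}
    (hroot : root' = Function.update root (next i) 1)
    (hm : ∀ y, (mark y = 0 → Relation.ReflTransGen R (next i) y → mark' y = base + ρ.length) ∧
      (mark y = 0 → ¬ Relation.ReflTransGen R (next i) y → mark' y = 0) ∧
      (mark y ≠ 0 → mark' y = mark y)) :
    Swept n base R next K (i + 1) (ρ ++ [next i]) mark' root' := by
  have hni : next (next i) = i := hnn i hin
  refine ⟨fun v => ?_, fun r hr => ?_, ?_, fun v hv hvi hKv => ?_, fun y hy => ?_,
    fun k hk y hy => ?_⟩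
  · rw [hroot, List.mem_append, List.mem_singleton]
    by_cases hvi : v = next i
    · simp [hvi]
    · rw [Function.update_of_ne hvi, h.root_iff]
      simp [hvi]
  · rcases List.mem_append.1 hr with hr | hr
    · obtain ⟨h1, h2, h3⟩ := h.mem r hr
      exact ⟨h1, h2, by omega⟩
    · rw [List.mem_singleton] at hr
      subst hr
      exact ⟨hvn, hK, by omega⟩
  · rw [List.pairwise_append]
    refine ⟨h.pairwise, List.pairwise_singleton _ _, fun a ha b hb' => ?_⟩
    rw [List.mem_singleton] at hb'
    subst hb'
    refine ⟨fun hab => ?_, by rw [hni]; exact (h.mem a ha).2.2⟩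
    -- a vertex reached by an earlier root would have a colour
    obtain ⟨k, hk, rfl⟩ := List.getElem_of_mem ha
    exact (h.least k hk _ hab).1 hm0
  · rcases Nat.lt_succ_iff_lt_or_eq.1 hvi with hlt | rfl
    · obtain ⟨r, hr, h1, h2⟩ := h.cover v hv hlt hKv
      exact ⟨r, List.mem_append_left _ hr, h1, h2⟩
    · rw [hnn v hv]
      exact ⟨v, by simp, .refl, le_rfl⟩
  · by_cases h0 : mark y = 0
    · by_cases hr : Relation.ReflTransGen R (next i) y
      · exact ⟨ρ.length, by simp, (hm y).1 h0 hr, by simpa using hr⟩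
      · exact absurd ((hm y).2.1 h0 hr) hy
    · obtain ⟨k, hk, h1, h2⟩ := h.colour y h0
      refine ⟨k, by simp; omega, by rw [(hm y).2.2 h0, h1], ?_⟩
      rwa [List.getElem_append_left hk]
  · by_cases hk' : k < ρ.length
    · rw [List.getElem_append_left hk'] at hy
      obtain ⟨h1, h2⟩ := h.least k hk' y hy
      rw [(hm y).2.2 h1]
      exact ⟨h1, h2⟩
    · have hkl : k = ρ.length := by simp at hk; omega
      subst hkl
      have hy' : Relation.ReflTransGen R (next i) y := by simpa using hy
      by_cases h0 : mark y = 0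
      · rw [(hm y).1 h0 hy']; omega
      · rw [(hm y).2.2 h0]
        obtain ⟨k', hk', h1, -⟩ := h.colour y h0
        omega

/-- Of two different roots, the one that is treated first does not reach the other. -/
theorem not_reach (h : Swept n base R next K i ρ mark root) {a b : ℕ} (ha : a ∈ ρ) (hb : b ∈ ρ)
    (hlt : next a < next b) : ¬ Relation.ReflTransGen R a b := by
  have hp : ρ.Pairwise fun a b => (next a < next b → ¬ Relation.ReflTransGen R a b) ∧
      (next b < next a → ¬ Relation.ReflTransGen R b a) := by
    refine h.pairwise.imp fun {a b} h' => ⟨fun _ => h'.1, fun h'' => ?_⟩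
    omega
  exact (hp.forall_of_forall_of_flip
    (fun a _ => ⟨fun h' => absurd h' (lt_irrefl _), fun h' => absurd h' (lt_irrefl _)⟩)
    (hp.imp fun h' => ⟨h'.2, h'.1⟩) ha hb).1 hlt

end Swept

variable {n base : ℕ} {R : ℕ → ℕ → Prop} {Mk Rt : ℕ} {adj pick cand : Exp}
  {next : ℕ → ℕ} {K : ℕ → Prop} {Env : State → Prop}

/-- A sweep ends in quadratic time: each vertex is scanned at most once, which accounts for the
first summand of the bound. -/
theorem SweepSetup.sweep (h : SweepSetup n base R Mk Rt adj pick cand next K Env)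
    {S₀ : State} (hE : Env S₀) (hMk : ∀ y, S₀.arr Mk y = 0) (hRt : ∀ y, S₀.arr Rt y = 0) :
    Ends (sweep Mk Rt adj pick cand) S₀ fun S T =>
      (∃ ρ, Swept n base R next K n ρ (S.arr Mk) (S.arr Rt) ∧ S.reg 6 = base + ρ.length) ∧
      T ≤ n * (n * (adj.steps + 30) + 20) + n * (pick.steps + cand.steps + 60) + 20 := by
  set W := n * (adj.steps + 30) + 20 with hW
  set W' := pick.steps + cand.steps + 60 with hW'
  refine Ends.seq (Ends.setReg (Ends.seq (Ends.setReg (Ends.seq (Ends.setReg ?_)))))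
  set S₁ := ((S₀.setReg 6 ((Exp.reg 5).eval S₀)).setReg 7 0).setReg 8 0 with hS₁
  change Ends _ S₁ _
  have hFS₁ : Frame (RAM.sweep Mk Rt adj pick cand) S₀ S₁ := by
    refine ⟨fun r hr => ?_, fun a _ => rfl, fun a _ => rfl⟩
    have : r ≠ 6 ∧ r ≠ 7 ∧ r ≠ 8 := by
      refine ⟨?_, ?_, ?_⟩ <;> rintro rfl <;> exact hr (by simp [RAM.sweep, Prog.regs])
    simp [hS₁, State.reg_setReg, this.1, this.2.1, this.2.2]
  have hE₁ := h.frame _ _ hFS₁ hE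
  have hfor : ∀ {S S'}, Frame (Prog.forTo 9 (.reg 0) (sweepStep Mk Rt adj pick cand)) S S' →
      Frame (RAM.sweep Mk Rt adj pick cand) S S' := fun hF =>
    hF.mono (fun r hr => by simp [RAM.sweep, Prog.regs, hr]) (by simp [RAM.sweep, Prog.arrs])
      (by simp [RAM.sweep, Prog.wts])
  have hr9 : ∀ (S : State) (i r : ℕ), r ≠ 9 → (S.setReg 9 i).reg r = S.reg r := by
    intro S i r hr
    simp [State.reg_setReg, hr]
  have hnn : ∀ v < n, next (next v) = v := h.next_next
  -- between two searches nothing has been coloured since the colouring `S.arr Mk`, so the search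
  -- invariant holds with a dummy root and a dummy colour
  refine Ends.forTo (N := n) (fun i S t =>
    (∃ ρ, Swept n base R next K i ρ (S.arr Mk) (S.arr Rt) ∧ S.reg 6 = base + ρ.length) ∧
    Search n R (S.arr Mk) 0 0 (S.arr Mk) (S.arr 6) (S.reg 8) ∧ S.reg 7 = S.reg 8 ∧
    (∀ k < S.reg 8, ∀ y, R (S.arr 6 k) y → S.arr Mk y ≠ 0) ∧
    t ≤ i * W' + S.reg 7 * W) ?_ ?_ ?_ ?_ ?_
  · simp [sweepStep, RAM.searchProg, RAM.scanProg, Prog.forTo, RAM.pushProg, Prog.regs]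
  · intro S hF
    exact h.reg0 S (h.frame _ _ (hfor hF) hE₁)
  · have e6 : S₁.reg 6 = base := by
      simp [hS₁, State.reg_setReg, Exp.eval, h.reg5 S₀ hE]
    have e7 : S₁.reg 7 = 0 := by simp [hS₁, State.reg_setReg]
    have e8 : S₁.reg 8 = 0 := by simp [hS₁, State.reg_setReg]
    simp only [State.arr_setReg, hr9 S₁ 0 6 (by decide), hr9 S₁ 0 7 (by decide),
      hr9 S₁ 0 8 (by decide), e6, e7, e8]
    refine ⟨⟨[], Swept.zero _ _ hMk hRt, by simp⟩, ⟨by simp, by simp, by simp, ?_, by simp⟩,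
      trivial, by simp, by simp⟩
    intro y _ hy
    exact absurd (hMk y) hy
  · rintro i S t hi hF hr ⟨⟨ρ, h1, h6⟩, h2, h78, h3, ht⟩
    have hES := h.frame _ _ (hfor hF) hE₁
    refine Ends.seq (Ends.setReg ?_)
    rw [h.pick_eq S hES, hr]
    set S₂ := S.setReg 10 (next i) with hS₂
    have hFS₂ : Frame (RAM.sweep Mk Rt adj pick cand) S S₂ := by
      refine ⟨fun r hr => ?_, fun a _ => rfl, fun a _ => rfl⟩
      have : r ≠ 10 := by
        rintro rfl
        exact hr (by simp [RAM.sweep, sweepStep, Prog.forTo, Prog.regs])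
      simp [hS₂, State.reg_setReg, this]
    have hES₂ := h.frame _ _ hFS₂ hES
    have e10 : S₂.reg 10 = next i := by simp [hS₂, State.reg_setReg]
    have e6 : S₂.reg 6 = S.reg 6 := by simp [hS₂, State.reg_setReg]
    have e7 : S₂.reg 7 = S.reg 7 := by simp [hS₂, State.reg_setReg]
    have e8 : S₂.reg 8 = S.reg 8 := by simp [hS₂, State.reg_setReg]
    have earr : S₂.arr = S.arr := rfl
    have hvn := h.next_lt i hi
    have hcand := h.cand_iff S₂ hES₂ (e10 ▸ hvn)
    rw [e10] at hcand
    -- the cases in which no search is started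
    have hskip : ∀ T, T ≤ W' → (K (next i) → S.arr Mk (next i) ≠ 0) →
        (∃ ρ, Swept n base R next K (i + 1) ρ ((S₂.setReg 9 (i + 1)).arr Mk)
          ((S₂.setReg 9 (i + 1)).arr Rt) ∧ (S₂.setReg 9 (i + 1)).reg 6 = base + ρ.length) ∧
        Search n R ((S₂.setReg 9 (i + 1)).arr Mk) 0 0 ((S₂.setReg 9 (i + 1)).arr Mk)
          ((S₂.setReg 9 (i + 1)).arr 6) ((S₂.setReg 9 (i + 1)).reg 8) ∧
        (S₂.setReg 9 (i + 1)).reg 7 = (S₂.setReg 9 (i + 1)).reg 8 ∧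
        (∀ k < (S₂.setReg 9 (i + 1)).reg 8, ∀ y, R ((S₂.setReg 9 (i + 1)).arr 6 k) y →
          (S₂.setReg 9 (i + 1)).arr Mk y ≠ 0) ∧
        t + T ≤ (i + 1) * W' + (S₂.setReg 9 (i + 1)).reg 7 * W := by
      intro T hT hK
      simp only [State.arr_setReg, hr9 S₂ (i + 1) 6 (by decide), hr9 S₂ (i + 1) 7 (by decide),
        hr9 S₂ (i + 1) 8 (by decide), e6, e7, e8, earr]
      refine ⟨⟨ρ, h1.skip hnn hK, h6⟩, h2, h78, h3, ?_⟩
      rw [add_mul, one_mul]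
      omega
    refine Ends.ite (fun hc1 => Ends.ite (fun hc2 => ?_) (fun hc2 => Ends.skip ?_))
      (fun hc1 => Ends.skip ?_)
    · have hK := hcand.1 hc1
      have hm0 : S.arr Mk (next i) = 0 := by
        by_contra h0
        simp [Exp.eval, e10, earr, h0] at hc2
      have hc : base + ρ.length ≠ 0 := by have := h.base_ne; omega
      refine Ends.seq (Ends.setArr (Ends.seq (Ends.mono (Ends.pushProg h.mk_ne
        (Φ := fun S' T => S'.arr Mk = Function.update (S.arr Mk) (next i) (base + ρ.length) ∧
          S'.arr 6 = Function.update (S.arr 6) (S.reg 8) (next i) ∧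
          S'.reg 8 = S.reg 8 + 1 ∧ T = 10) ?_) ?_)))
      · intro S' f1 f2 f3
        simp only [State.reg_setArr, e10, e8, e6] at f1 f2 f3
        rw [State.arr_setArr, if_neg h.mk_rt, earr, h6] at f1
        rw [State.arr_setArr, if_neg h.rt_ne.symm, earr] at f2
        exact ⟨f1, f2, f3, rfl⟩
      · rintro S₃ T hF₃ ⟨f1, f2, f3, rfl⟩
        have hpush : ∀ r, r ≠ 8 → S₃.reg r = S₂.reg r := fun r hr =>
          hF₃.reg r (by simpa [RAM.pushProg, Prog.regs] using hr)
        have f4 : S₃.arr Rt = Function.update (S.arr Rt) (next i) 1 := by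
          rw [hF₃.arr Rt (by simp [RAM.pushProg, Prog.arrs, h.mk_rt.symm, h.rt_ne])]
          simp [State.arr_setArr, Exp.eval, e10, earr]
        have hFS₃ : Frame (RAM.sweep Mk Rt adj pick cand) S₂ S₃ := by
          refine Frame.trans (Frame.mono (Runs.setArr S₂ Rt (.reg 10) (.lit 1)).frame
            ?_ ?_ ?_) (hF₃.mono ?_ ?_ ?_) <;>
          simp [RAM.sweep, sweepStep, RAM.searchProg, RAM.scanProg, Prog.forTo, RAM.pushProg,
            Prog.regs, Prog.arrs, Prog.wts]
        have hS₃ : Search n R (S.arr Mk) (next i) (base + ρ.length) (S₃.arr Mk) (S₃.arr 6)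
            (S₃.reg 8) := by
          rw [f1, f2, f3]
          refine Search.push ⟨h2.lt, h2.marked, h2.inj, h2.surj, ?_⟩ hc hvn hm0 .refl
          intro y hy
          exact absurd rfl hy
        have hmono : ∀ y, S.arr Mk y ≠ 0 → S₃.arr Mk y ≠ 0 := by
          intro y hy
          rw [f1]
          by_cases hyi : y = next i
          · simpa [hyi] using hc
          · rwa [Function.update_of_ne hyi]
        have g7 : S₃.reg 7 = S.reg 7 := by rw [hpush 7 (by decide), e7]
        have g6 : S₃.reg 6 = base + ρ.length := by rw [hpush 6 (by decide), e6, h6]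
        refine Ends.seq ((h.searchProg (S₀ := S₃) (h.frame _ _ hFS₃ hES₂) hc g6
          (M₀ := S.arr Mk) (v := next i) ?_ hS₃ ?_ (by omega) ?_).mono ?_)
        · intro x y hx hxy
          obtain ⟨k, hk, rfl⟩ := h2.surj x (h.lt _ _ hxy).1 hx
          exact h3 k hk y hxy
        · intro k hk y hRy
          rw [g7, h78] at hk
          rw [f2, Function.update_of_ne (by omega)] at hRy
          exact hmono y (h3 k hk y hRy)
        · rw [f1]; simpa using hc
        · rintro S₄ T hF₄ ⟨q1, q2, q3, q4, q5⟩
          refine Ends.setReg ?_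
          set S₅ := (S₄.setReg 6 ((Exp.add (.reg 6) (.lit 1)).eval S₄)).setReg 9 (i + 1)
            with hS₅
          have s6 : S₅.reg 6 = base + (ρ ++ [next i]).length := by
            have : S₄.reg 6 = S₃.reg 6 := hF₄.reg 6 (by
              simp [RAM.searchProg, RAM.scanProg, Prog.forTo, RAM.pushProg, Prog.regs])
            simp [hS₅, State.reg_setReg, Exp.eval, this, g6]
            ring
          have s7 : S₅.reg 7 = S₄.reg 7 := by simp [hS₅, State.reg_setReg]
          have s8 : S₅.reg 8 = S₄.reg 8 := by simp [hS₅, State.reg_setReg]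
          have sarr : S₅.arr = S₄.arr := rfl
          rw [s6, s7, s8, sarr]
          refine ⟨⟨_, h1.snoc h.base_ne hnn hi hvn hK hm0 ?_
            (q1.mark_eq (fun x y hxy => (h.lt x y hxy).2) hvn q4 q2), rfl⟩,
            ⟨q1.lt, q1.marked, q1.inj, q1.surj, fun y hy => absurd rfl hy⟩, q3, q2, ?_⟩
          · rw [← f4]
            exact hF₄.arr Rt (by
              simp [RAM.searchProg, RAM.scanProg, Prog.forTo, RAM.pushProg, Prog.arrs,
                h.mk_rt.symm, h.rt_ne])
          · rw [g7, ← hW] at q5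
            rw [add_mul, one_mul]
            simp only [Exp.steps]
            omega
    · refine hskip _ ?_ fun _ h0 => ?_
      · simp only [Exp.steps]; omega
      · simp [Exp.eval, e10, earr, h0] at hc2
    · refine hskip _ ?_ fun hK => absurd hc1 (hcand.2 hK)
      simp only [Exp.steps]; omega
  · rintro S t hF ⟨h1, h2, h78, -, ht⟩
    refine ⟨h1, ?_⟩
    have : S.reg 7 * W ≤ n * W := Nat.mul_le_mul_right _ (h78 ▸ h2.tail_le)
    simp only [Exp.steps]
    omega

end RAM

/-! ### Finding the non-top linked components by three sweeps -/

namespace RAM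

variable {n : ℕ}

/-- The state digraph on the numbers `0, …, n - 1`. -/
def Adj (A : Matrix (Fin n) (Fin n) Bool) (x y : ℕ) : Prop :=
  ∃ (hx : x < n) (hy : y < n), A ⟨y, hy⟩ ⟨x, hx⟩ = true

theorem reach_adj_iff {A : Matrix (Fin n) (Fin n) Bool} {x y : Fin n} :
    Relation.ReflTransGen (Adj A) x y ↔ StateReach A x y := by
  constructor
  · intro h
    have key : ∀ a, Relation.ReflTransGen (Adj A) a y.1 →
        ∃ ha : a < n, StateReach A ⟨a, ha⟩ y := by
      intro a h
      induction h using Relation.ReflTransGen.head_induction_on with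
      | refl => exact ⟨y.2, .refl⟩
      | head h _ ih =>
        obtain ⟨hx, hy, hA⟩ := h
        obtain ⟨_, ih⟩ := ih
        exact ⟨hx, ih.head hA⟩
    exact (key x h).2
  · intro h
    exact h.lift (fun k : Fin n => k.1) fun a b hab => ⟨a.2, b.2, hab⟩

theorem stateReach_transpose {A : Matrix (Fin n) (Fin n) Bool} {x y : Fin n} :
    StateReach Aᵀ x y ↔ StateReach A y x :=
  Relation.reflTransGen_swap (r := fun j i => A i j = true)

theorem reach_adj_transpose_iff {A : Matrix (Fin n) (Fin n) Bool} {x y : Fin n} :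
    Relation.ReflTransGen (Adj Aᵀ) x y ↔ StateReach A y x :=
  reach_adj_iff.trans stateReach_transpose

variable {A : Matrix (Fin n) (Fin n) Bool} {base : ℕ} {ρ₁ ρ₂ ρ₃ : List ℕ}
  {m₁ r₁ m₂ r₂ m₃ r₃ : ℕ → ℕ}

/-- After a first sweep over all states and a second sweep over the roots of the first one in
reverse order, every state that reaches a root of the second sweep is reached by it: that state is
reached by a root `a` of the first sweep; if `a ≠ r`, then `a` comes after `r`, since the first
sweep gives `r` its own colour; but then the second sweep reaches `r` before treating it. -/
theorem Swept.reach_of_reach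
    (h₁ : Swept n base (Adj A) id (fun _ => True) n ρ₁ m₁ r₁)
    (h₂ : Swept n base (Adj A) (fun i => n - 1 - i) (· ∈ ρ₁) n ρ₂ m₂ r₂)
    {r x : Fin n} (hr : r.1 ∈ ρ₂) (hx : StateReach A x r) : StateReach A r x := by
  obtain ⟨a, ha, hax, -⟩ := h₁.cover x x.2 x.2 trivial
  have han := (h₁.mem a ha).1
  have hax' : StateReach A ⟨a, han⟩ x := reach_adj_iff.1 hax
  have har : Relation.ReflTransGen (Adj A) a r := reach_adj_iff.2 (hax'.trans hx)
  have hr₁ := (h₂.mem _ hr).2.1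
  have hle : ¬ a < r.1 := fun hlt => h₁.not_reach ha hr₁ hlt har
  rcases (not_lt.1 hle).lt_or_eq with hlt | heq
  · obtain ⟨b, hb, hba, hba'⟩ := h₂.cover a han (by omega) ha
    have hbn := (h₂.mem b hb).1
    have hlt' : n - 1 - b < n - 1 - r.1 := by have := r.2; omega
    exact absurd (hba.trans har) (h₂.not_reach hb hr hlt')
  · have : (⟨a, han⟩ : Fin n) = r := Fin.ext heq.symm
    rwa [this] at hax'

/-- The roots of the second sweep represent the non-top linked components, and a third sweep,
against the direction of the edges, colours every component with the number of its root. -/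
theorem Swept.exists_numbering
    (h₁ : Swept n base (Adj A) id (fun _ => True) n ρ₁ m₁ r₁)
    (h₂ : Swept n base (Adj A) (fun i => n - 1 - i) (· ∈ ρ₁) n ρ₂ m₂ r₂)
    (h₃ : Swept n base (Adj Aᵀ) id (· ∈ ρ₂) n ρ₃ m₃ r₃) :
    ρ₃.length = numNonTop A ∧
    ∃ ν : {N : Finset (Fin n) // N ∈ nonTopSCCs A} ≃ Fin (numNonTop A),
      (∀ (r : Fin n) (N : {N : Finset (Fin n) // N ∈ nonTopSCCs A}), r ∈ N.1 →
        m₃ r = base + ν N) ∧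
      ∀ r : Fin n, m₃ r ≠ 0 → ∃ N : {N : Finset (Fin n) // N ∈ nonTopSCCs A}, r ∈ N.1 := by
  have hback : ∀ {r x : Fin n}, r.1 ∈ ρ₂ → StateReach A x r → StateReach A r x :=
    fun hr hx => h₁.reach_of_reach h₂ hr hx
  have huniq : ∀ {r r' : Fin n}, r.1 ∈ ρ₂ → r'.1 ∈ ρ₂ → StateReach A r r' → r = r' := by
    intro r r' hr hr' h
    by_contra hne
    have hne' : r.1 ≠ r'.1 := fun h' => hne (Fin.ext h')
    rcases Nat.lt_or_gt_of_ne hne' with hlt | hlt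
    · refine h₂.not_reach hr' hr ?_ (reach_adj_iff.2 (hback hr' h))
      have := r'.2
      change n - 1 - r'.1 < n - 1 - r.1
      omega
    · refine h₂.not_reach hr hr' ?_ (reach_adj_iff.2 h)
      have := r.2
      change n - 1 - r.1 < n - 1 - r'.1
      omega
  have hlt : ∀ k (hk : k < ρ₃.length), ρ₃[k] < n := fun k hk =>
    (h₃.mem _ (List.getElem_mem hk)).1
  have hmem : ∀ k (hk : k < ρ₃.length), ρ₃[k] ∈ ρ₂ := fun k hk =>
    (h₃.mem _ (List.getElem_mem hk)).2.1
  have hnodup : ρ₃.Nodup := h₃.pairwise.imp fun {a b} h (hab : a = b) => h.1 (hab ▸ .refl)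
  let root : Fin ρ₃.length → Fin n := fun k => ⟨ρ₃[k.1], hlt k.1 k.2⟩
  have hroot : ∀ k, (root k).1 ∈ ρ₂ := fun k => hmem k.1 k.2
  have hrinj : Function.Injective root := by
    intro k l hkl
    have : ρ₃[k.1] = ρ₃[l.1] := congrArg Fin.val hkl
    exact Fin.ext ((hnodup.getElem_inj_iff).1 this)
  let f : Fin ρ₃.length → {N : Finset (Fin n) // N ∈ nonTopSCCs A} := fun k =>
    ⟨sccOf A (root k), sccOf_mem_nonTopSCCs fun x hx => hback (hroot k) hx⟩
  have hself : ∀ k, root k ∈ (f k).1 := fun k => mem_sccOf.2 ⟨.refl, .refl⟩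
  have hfinj : Function.Injective f := by
    intro k l hkl
    have h1 : root k ∈ (f l).1 := hkl ▸ hself k
    exact hrinj (huniq (hroot k) (hroot l) (mem_sccOf.1 h1).1)
  -- following the three sweeps back from a state of `N` never leaves `N`, which has no
  -- predecessors outside
  have hfsurj : Function.Surjective f := by
    rintro ⟨N, hN⟩
    obtain ⟨z, hz⟩ := nonempty_of_mem_nonTopSCCs hN
    obtain ⟨a, ha, haz, -⟩ := h₁.cover z z.2 z.2 trivial
    have han := (h₁.mem a ha).1
    obtain ⟨b, hb, hba, -⟩ := h₂.cover a han (by omega) ha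
    have hbn := (h₂.mem b hb).1
    have hbN : (⟨b, hbn⟩ : Fin n) ∈ N :=
      mem_of_stateReach_of_mem_nonTopSCCs hN hz (reach_adj_iff.1 (hba.trans haz))
    obtain ⟨c, hc, hcb, -⟩ := h₃.cover b hbn hbn hb
    obtain ⟨k, hk, rfl⟩ := List.getElem_of_mem hc
    have hbk : StateReach A ⟨b, hbn⟩ (root ⟨k, hk⟩) := reach_adj_transpose_iff.1 hcb
    have heq : (⟨b, hbn⟩ : Fin n) = root ⟨k, hk⟩ := huniq hb (hroot ⟨k, hk⟩) hbk
    exact ⟨⟨k, hk⟩, Subtype.ext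
      (eq_of_mem_nonTopSCCs (f ⟨k, hk⟩).2 hN (hself ⟨k, hk⟩) (heq ▸ hbN))⟩
  let F := Equiv.ofBijective f ⟨hfinj, hfsurj⟩
  have hlen : ρ₃.length = numNonTop A := by
    have := Fintype.card_congr F
    simpa [numNonTop] using this
  refine ⟨hlen, F.symm.trans (finCongr hlen), fun r N hrN => ?_, fun r hr => ?_⟩
  · obtain ⟨k, rfl⟩ := hfsurj N
    have hk : F.symm (f k) = k := F.symm_apply_apply k
    have hrk := mem_sccOf.1 hrN
    have h0 := (h₃.least k.1 k.2 r (reach_adj_transpose_iff.2 hrk.1)).1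
    obtain ⟨l, hl, hm, hrl⟩ := h₃.colour r h0
    have hrl' : StateReach A r (root ⟨l, hl⟩) := reach_adj_transpose_iff.1 hrl
    have := hrinj (huniq (hroot k) (hroot ⟨l, hl⟩) (hrk.2.trans hrl'))
    rw [hm, Equiv.trans_apply, hk, this]
    rfl
  · obtain ⟨l, hl, -, hrl⟩ := h₃.colour r hr
    have hrl' : StateReach A r (root ⟨l, hl⟩) := reach_adj_transpose_iff.1 hrl
    exact ⟨f ⟨l, hl⟩, mem_sccOf.2 ⟨hrl', hback (hroot ⟨l, hl⟩) hrl'⟩⟩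

end RAM

namespace RAM

variable {n m : ℕ}

theorem flatten_apply {k l : ℕ} (M : Matrix (Fin k) (Fin l) Bool) (i : Fin k) (j : Fin l) :
    flatten M (i * l + j) = (M i j).toNat := by
  have h : (i * l + j : ℕ) = finProdFinEquiv (i, j) := by
    simp [finProdFinEquiv]; ring
  have hlt : (i * l + j : ℕ) < k * l := h ▸ (finProdFinEquiv (i, j)).2
  have e : finProdFinEquiv.symm ⟨i * l + j, hlt⟩ = (i, j) := by
    rw [Equiv.symm_apply_eq]
    exact Fin.ext h
  rw [flatten, dif_pos hlt, e]

theorem flatten_ne_zero_iff {k l : ℕ} (M : Matrix (Fin k) (Fin l) Bool) (i : Fin k) (j : Fin l) :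
    flatten M (i * l + j) ≠ 0 ↔ M i j = true := by
  rw [flatten_apply]
  cases M i j <;> simp

/-- The part of the memory that stays fixed until the edges have been listed: the input, the
number `2 + 2 n + 2 m` of the first component vertex in register 5, and the positions of the rows
of the two patterns in the arrays 4 and 5. -/
structure Env (A : Matrix (Fin n) (Fin n) Bool) (B : Matrix (Fin n) (Fin m) Bool)
    (p : Fin m → ℝ≥0) (S : State) : Prop where
  reg0 : S.reg 0 = n
  reg1 : S.reg 1 = m
  reg5 : S.reg 5 = 2 + 2 * n + 2 * m
  arr0 : S.arr 0 = flatten A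
  arr1 : S.arr 1 = flatten B
  arr4 : ∀ i ≤ n, S.arr 4 i = i * n
  arr5 : ∀ i ≤ n, S.arr 5 i = i * m
  wt0 : ∀ j : Fin m, S.wt 0 j = p j

variable {A : Matrix (Fin n) (Fin n) Bool} {B : Matrix (Fin n) (Fin m) Bool} {p : Fin m → ℝ≥0}

theorem Env.of_frame {P : Prog} {S S' : State} (h : Env A B p S) (hF : Frame P S S')
    (hr : ∀ r ∈ [0, 1, 5], r ∉ P.regs) (ha : ∀ a ∈ [0, 1, 4, 5], a ∉ P.arrs)
    (hw : 0 ∉ P.wts) : Env A B p S' := by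
  have a4 := hF.arr 4 (ha 4 (by simp))
  have a5 := hF.arr 5 (ha 5 (by simp))
  exact ⟨(hF.reg 0 (hr 0 (by simp))).trans h.reg0, (hF.reg 1 (hr 1 (by simp))).trans h.reg1,
    (hF.reg 5 (hr 5 (by simp))).trans h.reg5, (hF.arr 0 (ha 0 (by simp))).trans h.arr0,
    (hF.arr 1 (ha 1 (by simp))).trans h.arr1, fun i hi => a4 ▸ h.arr4 i hi,
    fun i hi => a5 ▸ h.arr5 i hi, fun j => (congrFun (hF.wt 0 hw) _).trans (h.wt0 j)⟩

theorem Env.of_frame_sweep {Mk Rt : ℕ} {adj pick cand : Exp} {S S' : State} (h : Env A B p S)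
    (hF : Frame (sweep Mk Rt adj pick cand) S S') (ha : ∀ a ∈ [0, 1, 4, 5], a ≠ Mk ∧ a ≠ Rt) :
    Env A B p S' := by
  refine h.of_frame hF (fun r hr hr' => ?_) (fun a ha' ha'' => ?_) ?_
  · have := sweep_regs _ _ _ _ _ hr'
    fin_cases hr <;> simp at this
  · have h1 := sweep_arrs _ _ _ _ _ ha''
    have h2 := ha a ha'
    fin_cases ha' <;> simp_all
  · rw [sweep_wts]; simp

/-- Compute the fixed part of the memory. -/
def initProg : Prog :=
  .seq (.setReg 5 (.add (.lit 2) (.add (.add (.reg 0) (.reg 0)) (.add (.reg 1) (.reg 1)))))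
    (.forTo 9 (.reg 0)
      (.seq (.setArr 4 (.add (.reg 9) (.lit 1)) (.add (.arr 4 (.reg 9)) (.reg 0)))
        (.setArr 5 (.add (.reg 9) (.lit 1)) (.add (.arr 5 (.reg 9)) (.reg 1)))))

theorem Ends.initProg (A : Matrix (Fin n) (Fin n) Bool) (B : Matrix (Fin n) (Fin m) Bool)
    (p : Fin m → ℝ≥0) : Ends initProg (inputState A B p) fun S T =>
      Env A B p S ∧ T ≤ 30 * n + 30 := by
  refine Ends.seq (Ends.setReg ?_)
  set S₁ := (inputState A B p).setReg 5
    ((Exp.add (.lit 2) (.add (.add (.reg 0) (.reg 0)) (.add (.reg 1) (.reg 1)))).eval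
      (inputState A B p)) with hS₁
  have e0 : S₁.reg 0 = n := by simp [hS₁, State.reg_setReg, inputState]
  have e1 : S₁.reg 1 = m := by simp [hS₁, State.reg_setReg, inputState]
  have e5 : S₁.reg 5 = 2 + 2 * n + 2 * m := by
    simp [hS₁, State.reg_setReg, inputState, Exp.eval]; ring
  have earr : S₁.arr = (inputState A B p).arr := rfl
  have hfr : ∀ {S}, Frame (Prog.forTo 9 (.reg 0)
      (.seq (.setArr 4 (.add (.reg 9) (.lit 1)) (.add (.arr 4 (.reg 9)) (.reg 0)))
        (.setArr 5 (.add (.reg 9) (.lit 1)) (.add (.arr 5 (.reg 9)) (.reg 1))))) S₁ S →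
      S.reg 0 = n ∧ S.reg 1 = m ∧ S.reg 5 = 2 + 2 * n + 2 * m ∧ S.arr 0 = flatten A ∧
        S.arr 1 = flatten B ∧ S.wt = (inputState A B p).wt := by
    intro S hF
    refine ⟨(hF.reg 0 (by simp [Prog.forTo, Prog.regs])).trans e0,
      (hF.reg 1 (by simp [Prog.forTo, Prog.regs])).trans e1,
      (hF.reg 5 (by simp [Prog.forTo, Prog.regs])).trans e5,
      (hF.arr 0 (by simp [Prog.forTo, Prog.arrs])).trans ?_,
      (hF.arr 1 (by simp [Prog.forTo, Prog.arrs])).trans ?_,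
      funext fun a => (hF.wt a (by simp [Prog.forTo, Prog.wts])).trans rfl⟩
    · funext i; simp [earr, inputState]
    · funext i; simp [earr, inputState]
  refine Ends.forTo (N := n) (fun i S t => (∀ k ≤ i, S.arr 4 k = k * n ∧ S.arr 5 k = k * m) ∧
    t ≤ 30 * i) ?_ ?_ ?_ ?_ ?_
  · simp [Prog.regs]
  · intro S hF; exact (hfr hF).1
  · simp [earr, inputState]
  · rintro i S t hi hF hr ⟨h1, h2⟩
    obtain ⟨f0, f1, -⟩ := hfr hF
    refine Ends.seq (Ends.setArr (Ends.setArr ⟨fun k hk => ?_, ?_⟩))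
    · obtain ⟨h4, h5⟩ := h1 i le_rfl
      rcases Nat.lt_or_ge k (i + 1) with hlt | hge
      · simp [State.arr_setArr, Exp.eval, hr, Function.update_of_ne hlt.ne, h1 k (by omega)]
      · have : k = i + 1 := by omega
        subst this
        simp [State.arr_setArr, Exp.eval, hr, f0, f1, h4, h5, add_mul]
    · simp [Exp.steps]; omega
  · rintro S t hF ⟨h1, h2⟩
    obtain ⟨f0, f1, f5, fa, fb, fw⟩ := hfr hF
    refine ⟨⟨f0, f1, f5, fa, fb, fun i hi => (h1 i hi).1, fun i hi => (h1 i hi).2, ?_⟩, ?_⟩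
    · intro j
      simp [fw, inputState]
    · simp [Exp.steps]; omega

/-- The entry of `A` in the row given by register 12 and the column given by register 11. -/
def adjForward : Exp := .arr 0 (.add (.arr 4 (.reg 12)) (.reg 11))

/-- The entry of `A` in the row given by register 11 and the column given by register 12. -/
def adjBackward : Exp := .arr 0 (.add (.arr 4 (.reg 11)) (.reg 12))

theorem Env.adjForward_iff {S : State} (h : Env A B p S) (h₁ : S.reg 11 < n)
    (h₂ : S.reg 12 < n) : adjForward.eval S ≠ 0 ↔ Adj A (S.reg 11) (S.reg 12) := by
  simp only [adjForward, Exp.eval, h.arr0, h.arr4 _ h₂.le]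
  rw [flatten_ne_zero_iff A ⟨_, h₂⟩ ⟨_, h₁⟩]
  simp [Adj, h₁, h₂]

theorem Env.adjBackward_iff {S : State} (h : Env A B p S) (h₁ : S.reg 11 < n)
    (h₂ : S.reg 12 < n) : adjBackward.eval S ≠ 0 ↔ Adj Aᵀ (S.reg 11) (S.reg 12) := by
  simp only [adjBackward, Exp.eval, h.arr0, h.arr4 _ h₁.le]
  rw [flatten_ne_zero_iff A ⟨_, h₁⟩ ⟨_, h₂⟩]
  simp [Adj, h₁, h₂]

theorem Adj.lt {x y : ℕ} (h : Adj A x y) : x < n ∧ y < n := by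
  obtain ⟨hx, hy, -⟩ := h
  exact ⟨hx, hy⟩

/-- Sweep forward over all states. -/
def sweep₁ : Prog := sweep 7 8 adjForward (.reg 9) (.lit 1)

/-- Sweep forward over the roots of `sweep₁`, in reverse order. -/
def sweep₂ : Prog :=
  sweep 9 10 adjForward (.sub (.sub (.reg 0) (.lit 1)) (.reg 9)) (.arr 8 (.reg 10))

/-- Sweep backward over the roots of `sweep₂`. -/
def sweep₃ : Prog := sweep 3 11 adjBackward (.reg 9) (.arr 10 (.reg 10))

/-- The array 3 holds the numbers of the components of the states, and register 6 the total number
of vertices. -/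
def HasComponents (A : Matrix (Fin n) (Fin n) Bool) (m : ℕ)
    (ν : {N : Finset (Fin n) // N ∈ nonTopSCCs A} ≃ Fin (numNonTop A)) (S : State) : Prop :=
  S.reg 6 = 2 + 2 * n + 2 * m + numNonTop A ∧
  (∀ (r : Fin n) (N : {N : Finset (Fin n) // N ∈ nonTopSCCs A}), r ∈ N.1 →
    S.arr 3 r = 2 + 2 * n + 2 * m + ν N) ∧
  ∀ r : Fin n, S.arr 3 r ≠ 0 → ∃ N : {N : Finset (Fin n) // N ∈ nonTopSCCs A}, r ∈ N.1

/-- The initialization and the three sweeps. -/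
def prepareProg : Prog := .seq initProg (.seq sweep₁ (.seq sweep₂ sweep₃))

theorem Ends.prepareProg (A : Matrix (Fin n) (Fin n) Bool) (B : Matrix (Fin n) (Fin m) Bool)
    (p : Fin m → ℝ≥0) : Ends prepareProg (inputState A B p) fun S T =>
      Env A B p S ∧ (∀ i, S.arr 12 i = 0) ∧ (∃ ν, HasComponents A m ν S) ∧
      T ≤ 105 * (n * n) + 300 * n + 90 := by
  have hin : ∀ a, a ≠ 0 → a ≠ 1 → ∀ i, (inputState A B p).arr a i = 0 := by
    intro a h0 h1 i; simp [inputState, h0, h1]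
  refine Ends.seq ((Ends.initProg A B p).mono ?_)
  rintro S₁ T₁ hF₁ ⟨hE₁, hT₁⟩
  have hz₁ : ∀ a, 5 < a ∨ a = 3 → ∀ i, S₁.arr a i = 0 := by
    intro a ha i
    rw [hF₁.arr a (by simp [RAM.initProg, Prog.forTo, Prog.arrs]; omega)]
    exact hin a (by omega) (by omega) i
  have setup₁ : SweepSetup n (2 + 2 * n + 2 * m) (Adj A) 7 8 adjForward (.reg 9) (.lit 1)
      id (fun _ => True) (Env A B p) :=
    { mk_ne := by decide
      rt_ne := by decide
      mk_rt := by decide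
      base_ne := by omega
      lt := fun x y h => h.lt
      next_lt := fun i hi => hi
      next_next := fun i _ => rfl
      frame := fun S S' hF hE => hE.of_frame_sweep hF (by simp)
      reg0 := fun S hE => hE.reg0
      reg5 := fun S hE => hE.reg5
      adj_iff := fun S hE => hE.adjForward_iff
      pick_eq := fun S _ => rfl
      cand_iff := fun S _ _ => by simp [Exp.eval] }
  refine Ends.seq ((setup₁.sweep hE₁ (hz₁ 7 (by omega)) (hz₁ 8 (by omega))).mono ?_)
  rintro S₂ T₂ hF₂ ⟨⟨ρ₁, h₁, -⟩, hT₂⟩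
  have hE₂ := setup₁.frame _ _ hF₂ hE₁
  have hz₂ : ∀ a, 8 < a ∨ a = 3 → ∀ i, S₂.arr a i = 0 := by
    intro a ha i
    rw [hF₂.arr a fun h => ?_]
    · exact hz₁ a (by omega) i
    · have := sweep_arrs _ _ _ _ _ h
      simp at this; omega
  have setup₂ : SweepSetup n (2 + 2 * n + 2 * m) (Adj A) 9 10 adjForward
      (.sub (.sub (.reg 0) (.lit 1)) (.reg 9)) (.arr 8 (.reg 10))
      (fun i => n - 1 - i) (· ∈ ρ₁) (fun S => Env A B p S ∧ S.arr 8 = S₂.arr 8) :=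
    { mk_ne := by decide
      rt_ne := by decide
      mk_rt := by decide
      base_ne := by omega
      lt := fun x y h => h.lt
      next_lt := fun i hi => by omega
      next_next := fun i hi => by omega
      frame := fun S S' hF hE => ⟨hE.1.of_frame_sweep hF (by simp),
        (hF.arr 8 fun h => by simpa using sweep_arrs _ _ _ _ _ h).trans hE.2⟩
      reg0 := fun S hE => hE.1.reg0
      reg5 := fun S hE => hE.1.reg5
      adj_iff := fun S hE => hE.1.adjForward_iff
      pick_eq := fun S hE => by simp [Exp.eval, hE.1.reg0]
      cand_iff := fun S hE _ => by simp only [Exp.eval, hE.2]; exact h₁.root_iff _ }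
  refine Ends.seq ((setup₂.sweep ⟨hE₂, rfl⟩ (hz₂ 9 (by omega)) (hz₂ 10 (by omega))).mono ?_)
  rintro S₃ T₃ hF₃ ⟨⟨ρ₂, h₂, -⟩, hT₃⟩
  have hE₃ := (setup₂.frame _ _ hF₃ ⟨hE₂, rfl⟩).1
  have hz₃ : ∀ a, 10 < a ∨ a = 3 → ∀ i, S₃.arr a i = 0 := by
    intro a ha i
    rw [hF₃.arr a fun h => ?_]
    · exact hz₂ a (by omega) i
    · have := sweep_arrs _ _ _ _ _ h
      simp at this; omega
  have setup₃ : SweepSetup n (2 + 2 * n + 2 * m) (Adj Aᵀ) 3 11 adjBackward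
      (.reg 9) (.arr 10 (.reg 10))
      id (· ∈ ρ₂) (fun S => Env A B p S ∧ S.arr 10 = S₃.arr 10) :=
    { mk_ne := by decide
      rt_ne := by decide
      mk_rt := by decide
      base_ne := by omega
      lt := fun x y h => h.lt
      next_lt := fun i hi => hi
      next_next := fun i _ => rfl
      frame := fun S S' hF hE => ⟨hE.1.of_frame_sweep hF (by simp),
        (hF.arr 10 fun h => by simpa using sweep_arrs _ _ _ _ _ h).trans hE.2⟩
      reg0 := fun S hE => hE.1.reg0
      reg5 := fun S hE => hE.1.reg5
      adj_iff := fun S hE => hE.1.adjBackward_iff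
      pick_eq := fun S _ => rfl
      cand_iff := fun S hE _ => by simp only [Exp.eval, hE.2]; exact h₂.root_iff _ }
  refine ((setup₃.sweep ⟨hE₃, rfl⟩ (hz₃ 3 (by omega)) (hz₃ 11 (by omega))).mono ?_)
  rintro S₄ T₄ hF₄ ⟨⟨ρ₃, h₃, h6⟩, hT₄⟩
  obtain ⟨hlen, ν, hν, hν'⟩ := h₁.exists_numbering h₂ h₃
  refine ⟨(setup₃.frame _ _ hF₄ ⟨hE₃, rfl⟩).1, fun i => ?_, ⟨ν, by rw [h6, hlen], hν, hν'⟩, ?_⟩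
  · rw [hF₄.arr 12 fun h => by simpa using sweep_arrs _ _ _ _ _ h]
    exact hz₃ 12 (by omega) i
  · simp only [adjForward, adjBackward, Exp.steps] at hT₂ hT₃ hT₄
    ring_nf at hT₂ hT₃ hT₄ ⊢
    omega

end RAM

/-! ### Listing the edges -/

namespace RAM

variable {n m : ℕ} {A : Matrix (Fin n) (Fin n) Bool} {B : Matrix (Fin n) (Fin m) Bool}
  {p : Fin m → ℝ≥0} {ν : {N : Finset (Fin n) // N ∈ nonTopSCCs A} ≃ Fin (numNonTop A)}

/-- The edges with the property `Q` are listed, once each, in the integer arrays 13 to 15 and the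
weight array 1, and register 13 contains their number. -/
def Listed (p : Fin m → ℝ≥0)
    (ν : {N : Finset (Fin n) // N ∈ nonTopSCCs A} ≃ Fin (numNonTop A)) (S : State)
    (Q : SysVertex m A × SysVertex m A → Prop) : Prop :=
  ∃ L : List (SysVertex m A × SysVertex m A), L.Nodup ∧ (∀ e, e ∈ L ↔ Q e) ∧
    S.reg 13 = L.length ∧ ∀ (k : ℕ) (h : k < L.length),
      S.arr 13 k = SysVertex.code ν L[k].1 ∧ S.arr 14 k = SysVertex.code ν L[k].2 ∧
      (S.arr 15 k : ℝ≥0) = SysVertex.capacity L[k] ∧ S.wt 1 k = SysVertex.edgeCost p L[k]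

theorem Listed.congr {S S' : State} {Q Q' : SysVertex m A × SysVertex m A → Prop}
    (h : Listed p ν S Q) (hQ : ∀ e, Q e ↔ Q' e) (h13 : S'.reg 13 = S.reg 13)
    (a13 : S'.arr 13 = S.arr 13) (a14 : S'.arr 14 = S.arr 14) (a15 : S'.arr 15 = S.arr 15)
    (w1 : S'.wt 1 = S.wt 1) : Listed p ν S' Q' := by
  obtain ⟨L, h1, h2, h3, h4⟩ := h
  refine ⟨L, h1, fun e => (h2 e).trans (hQ e), h13.trans h3, fun k hk => ?_⟩
  rw [a13, a14, a15, w1]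
  exact h4 k hk

/-- Append an edge from `a` to `b` to the list; its capacity is `c`, and `w` writes its cost. -/
def emit (a b c : Exp) (w : Prog) : Prog :=
  .seq (.setReg 14 a) (.seq (.setReg 15 b) (.seq (.setArr 15 (.reg 13) c)
    (.seq (.setArr 13 (.reg 13) (.reg 14)) (.seq (.setArr 14 (.reg 13) (.reg 15))
      (.seq w (.setReg 13 (.add (.reg 13) (.lit 1))))))))

/-- Append an edge with capacity `1` and cost `0`. -/
def emitUnit (a b : Exp) : Prog := emit a b (.lit 1) (.zeroWt 1 (.reg 13))

/-- Append an edge with capacity `n + 1` and the cost given by register 9. -/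
def emitCost (a b : Exp) : Prog :=
  emit a b (.add (.reg 0) (.lit 1)) (.copyWt 1 (.reg 13) 0 (.reg 9))

/-- Appending an entry to the arrays appends an edge to the list. -/
theorem Listed.snoc {S S' : State} {Q : SysVertex m A × SysVertex m A → Prop}
    (h : Listed p ν S Q) {e : SysVertex m A × SysVertex m A} (he : ¬ Q e) {x y z : ℕ} {w : ℝ≥0}
    (hx : x = SysVertex.code ν e.1) (hy : y = SysVertex.code ν e.2)
    (hz : (z : ℝ≥0) = SysVertex.capacity e) (hw : w = SysVertex.edgeCost p e)
    (a13 : S'.arr 13 = Function.update (S.arr 13) (S.reg 13) x)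
    (a14 : S'.arr 14 = Function.update (S.arr 14) (S.reg 13) y)
    (a15 : S'.arr 15 = Function.update (S.arr 15) (S.reg 13) z)
    (w1 : S'.wt 1 = Function.update (S.wt 1) (S.reg 13) w) (h13 : S'.reg 13 = S.reg 13 + 1) :
    Listed p ν S' fun e' => Q e' ∨ e' = e := by
  obtain ⟨L, h1, h2, h3, h4⟩ := h
  refine ⟨L ++ [e], ?_, fun e' => ?_, ?_, fun k hk => ?_⟩
  · rw [List.nodup_append]
    refine ⟨h1, List.nodup_singleton _, fun a ha b hb hab => he ?_⟩
    rw [List.mem_singleton] at hb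
    rw [← hb, ← hab]
    exact (h2 a).1 ha
  · rw [List.mem_append, List.mem_singleton, h2]
  · rw [h13, h3]; simp
  · rw [a13, a14, a15, w1, h3]
    by_cases hk' : k < L.length
    · rw [List.getElem_append_left hk']
      simpa only [Function.update_of_ne hk'.ne] using h4 k hk'
    · have : k = L.length := by simp at hk; omega
      subst this
      simp [hx, hy, hz, hw]

/-- In the context `C`, the program `P` appends the edges with the property `R` to the list, in
time at most `K`. -/
def Emits (p : Fin m → ℝ≥0) (ν : {N : Finset (Fin n) // N ∈ nonTopSCCs A} ≃ Fin (numNonTop A))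
    (C : State → Prop) (P : Prog) (R : SysVertex m A × SysVertex m A → Prop) (K : ℕ) : Prop :=
  ∀ (S : State) (Q : SysVertex m A × SysVertex m A → Prop), C S → (∀ e, R e → ¬ Q e) →
    Listed p ν S Q → Ends P S fun S' T => Listed p ν S' (fun e => Q e ∨ R e) ∧ T ≤ K ∧
      S'.reg 13 ≤ S.reg 13 + K

theorem Emits.mono_time {C : State → Prop} {P : Prog}
    {R : SysVertex m A × SysVertex m A → Prop} {K K' : ℕ} (h : Emits p ν C P R K) (hK : K ≤ K') :
    Emits p ν C P R K' := fun S Q hS hQ hL => (h S Q hS hQ hL).mono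
  fun _ _ _ h' => ⟨h'.1, h'.2.1.trans hK, h'.2.2.trans (Nat.add_le_add_left hK _)⟩

theorem Emits.seq {C : State → Prop} {P P' : Prog} {R R' : SysVertex m A × SysVertex m A → Prop}
    {K K' : ℕ} (h : Emits p ν C P R K) (h' : Emits p ν C P' R' K')
    (hC : ∀ S S', Frame P S S' → C S → C S') (hR : ∀ e, R' e → ¬ R e) :
    Emits p ν C (.seq P P') (fun e => R e ∨ R' e) (K + K') := by
  intro S Q hS hQ hL
  refine Ends.seq ((h S Q hS (fun e he => hQ e (Or.inl he)) hL).mono ?_)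
  rintro S' T hF ⟨hL', hT, h13⟩
  refine (h' S' _ (hC S S' hF hS) (fun e he => ?_) hL').mono ?_
  · rintro (h1 | h1)
    · exact hQ e (Or.inr he) h1
    · exact hR e he h1
  · rintro S'' T' - ⟨hL'', hT', h13'⟩
    exact ⟨hL''.congr (fun e => or_assoc) rfl rfl rfl rfl rfl, by omega, by omega⟩

theorem Emits.ite {C : State → Prop} {P : Prog} {R : SysVertex m A × SysVertex m A → Prop}
    {K : ℕ} {c : Exp} {q : Prop} (hc : ∀ S, C S → (c.eval S ≠ 0 ↔ q)) (h : Emits p ν C P R K) :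
    Emits p ν C (.ite c P .skip) (fun e => q ∧ R e) (c.steps + 2 + K) := by
  intro S Q hS hQ hL
  refine Ends.ite (fun h1 => ?_) (fun h1 => Ends.skip ⟨?_, by omega, by omega⟩)
  · have hq := (hc S hS).1 h1
    refine (h S Q hS (fun e he => hQ e ⟨hq, he⟩) hL).mono ?_
    rintro S' T - ⟨hL', hT, h13⟩
    exact ⟨hL'.congr (fun e => by simp [hq]) rfl rfl rfl rfl rfl, by omega, by omega⟩
  · have hq : ¬ q := fun hq => (hc S hS).2 hq h1
    exact hL.congr (fun e => by simp [hq]) rfl rfl rfl rfl rfl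

theorem Emits.forTo {C : State → Prop} {P : Prog} {N : ℕ}
    {R : Fin N → SysVertex m A × SysVertex m A → Prop} {K r : ℕ} {e : Exp}
    (hr : r ∉ P.regs) (hr13 : r ≠ 13) (he : ∀ S, C S → e.eval S = N)
    (hC : ∀ S S', Frame (Prog.forTo r e P) S S' → C S → C S')
    (hR : ∀ i j e, R i e → R j e → i = j)
    (h : ∀ i : Fin N, Emits p ν (fun S => C S ∧ S.reg r = i) P (R i) K) :
    Emits p ν C (Prog.forTo r e P) (fun e => ∃ i, R i e) (N * (K + e.steps + 7) + e.steps + 5) := by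
  intro S₀ Q hS₀ hQ hL₀
  have hset : ∀ (S : State) (v : ℕ), (S.setReg r v).reg 13 = S.reg 13 := by
    intro S v
    simp [State.reg_setReg, hr13.symm]
  refine Ends.forTo (N := N) (fun i S t =>
    Listed p ν S (fun e => Q e ∨ ∃ k : Fin N, k < i ∧ R k e) ∧ t ≤ i * (K + e.steps + 7) ∧
      S.reg 13 ≤ S₀.reg 13 + i * (K + e.steps + 7)) hr ?_ ?_ ?_ ?_
  · intro S hF; exact he S (hC _ _ hF hS₀)
  · refine ⟨hL₀.congr (fun e => by simp) (hset _ _) rfl rfl rfl rfl, by simp, ?_⟩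
    rw [hset]; simp
  · rintro i S t hi hF hri ⟨hL, ht, h13⟩
    refine ((h ⟨i, hi⟩) S _ ⟨hC _ _ hF hS₀, hri⟩ ?_ hL).mono ?_
    · rintro e' he' (h1 | ⟨k, hk, h1⟩)
      · exact hQ e' ⟨_, he'⟩ h1
      · have := hR _ _ _ h1 he'
        rw [this] at hk
        exact lt_irrefl _ hk
    · rintro S' T - ⟨hL', hT, h13'⟩
      refine ⟨hL'.congr (fun e' => ?_) (hset _ _) rfl rfl rfl rfl, ?_, ?_⟩
      · rw [or_assoc]
        refine or_congr_right ⟨?_, ?_⟩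
        · rintro (⟨k, hk, h1⟩ | h1)
          · exact ⟨k, by omega, h1⟩
          · exact ⟨⟨i, hi⟩, Nat.lt_succ_self i, h1⟩
        · rintro ⟨k, hk, h1⟩
          rcases Nat.lt_succ_iff_lt_or_eq.1 hk with hlt | heq
          · exact Or.inl ⟨k, hlt, h1⟩
          · have : k = ⟨i, hi⟩ := Fin.ext heq
            exact Or.inr (this ▸ h1)
      · rw [add_mul, one_mul]; omega
      · rw [hset, add_mul, one_mul]; omega
  · rintro S t hF ⟨hL, ht, h13⟩
    exact ⟨hL.congr (fun e' => by simp) rfl rfl rfl rfl rfl, by omega, by omega⟩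

theorem Emits.emitUnit {C : State → Prop} {a b : Exp} (e : SysVertex m A × SysVertex m A)
    (ha : ∀ S, C S → a.eval S = SysVertex.code ν e.1)
    (hb : ∀ S, C S → b.eval (S.setReg 14 (a.eval S)) = SysVertex.code ν e.2)
    (hcap : SysVertex.capacity e = 1) (hcost : SysVertex.edgeCost p e = 0) :
    Emits p ν C (emitUnit a b) (fun e' => e' = e) (a.steps + b.steps + 30) := by
  intro S Q hS hQ hL
  refine Ends.seq (Ends.setReg (Ends.seq (Ends.setReg (Ends.seq (Ends.setArr (Ends.seq
    (Ends.setArr (Ends.seq (Ends.setArr (Ends.seq (Ends.zeroWt (Ends.setReg ?_))))))))))))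
  refine ⟨hL.snoc (hQ e rfl) (ha S hS) (hb S hS) (z := 1) (by simp [hcap]) hcost.symm
    ?_ ?_ ?_ ?_ ?_, ?_, ?_⟩ <;>
  simp [State.arr_setArr, State.reg_setReg, State.wt_setWt, Exp.eval, Exp.steps]
  omega

theorem Emits.emitCost {C : State → Prop} {a b : Exp} (e : SysVertex m A × SysVertex m A)
    (ha : ∀ S, C S → a.eval S = SysVertex.code ν e.1)
    (hb : ∀ S, C S → b.eval (S.setReg 14 (a.eval S)) = SysVertex.code ν e.2)
    (hcap : ∀ S, C S → SysVertex.capacity e = S.reg 0 + 1)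
    (hcost : ∀ S, C S → S.wt 0 (S.reg 9) = SysVertex.edgeCost p e) :
    Emits p ν C (emitCost a b) (fun e' => e' = e) (a.steps + b.steps + 30) := by
  intro S Q hS hQ hL
  refine Ends.seq (Ends.setReg (Ends.seq (Ends.setReg (Ends.seq (Ends.setArr (Ends.seq
    (Ends.setArr (Ends.seq (Ends.setArr (Ends.seq (Ends.copyWt (Ends.setReg ?_))))))))))))
  refine ⟨hL.snoc (hQ e rfl) (ha S hS) (hb S hS) (z := S.reg 0 + 1)
    (by simp [hcap S hS]) (hcost S hS) ?_ ?_ ?_ ?_ ?_, ?_, ?_⟩ <;>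
  simp [State.arr_setArr, State.reg_setReg, State.wt_setWt, Exp.eval, Exp.steps]
  omega

end RAM

namespace RAM

variable {n m : ℕ} {A : Matrix (Fin n) (Fin n) Bool} {B : Matrix (Fin n) (Fin m) Bool}
  {p : Fin m → ℝ≥0} {ν : {N : Finset (Fin n) // N ∈ nonTopSCCs A} ≃ Fin (numNonTop A)}

/-- What listing the edges presupposes. -/
structure Ready (A : Matrix (Fin n) (Fin n) Bool) (B : Matrix (Fin n) (Fin m) Bool)
    (p : Fin m → ℝ≥0) (ν : {N : Finset (Fin n) // N ∈ nonTopSCCs A} ≃ Fin (numNonTop A))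
    (S : State) : Prop where
  env : Env A B p S
  comp : HasComponents A m ν S

theorem Ready.of_frame {P : Prog} {S S' : State} (h : Ready A B p ν S) (hF : Frame P S S')
    (hr : ∀ r ∈ [0, 1, 5, 6], r ∉ P.regs) (ha : ∀ a ∈ [0, 1, 3, 4, 5], a ∉ P.arrs)
    (hw : 0 ∉ P.wts) : Ready A B p ν S' := by
  have h6 := hF.reg 6 (hr 6 (by simp))
  have h3 := hF.arr 3 (ha 3 (by simp))
  refine ⟨h.env.of_frame hF (fun r h' => hr r ?_) (fun a h' => ha a ?_) hw, ?_⟩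
  · fin_cases h' <;> simp
  · fin_cases h' <;> simp
  · obtain ⟨c1, c2, c3⟩ := h.comp
    exact ⟨h6.trans c1, h3 ▸ c2, h3 ▸ c3⟩

theorem Ready.of_frame_reg {P : Prog} {S S' : State} {k : ℕ}
    (h : Ready A B p ν S ∧ S.reg 9 = k) (hF : Frame P S S')
    (hr : ∀ r ∈ [0, 1, 5, 6, 9], r ∉ P.regs) (ha : ∀ a ∈ [0, 1, 3, 4, 5], a ∉ P.arrs)
    (hw : 0 ∉ P.wts) : Ready A B p ν S' ∧ S'.reg 9 = k := by
  refine ⟨h.1.of_frame hF (fun r h' => hr r ?_) ha hw, (hF.reg 9 (hr 9 (by simp))).trans h.2⟩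
  fin_cases h' <;> simp

/-- The number of the vertex `x'_k`, where `k` is in register `i`. -/
def codeX' (i : ℕ) : Exp := .add (.lit 2) (.reg i)

/-- The number of the vertex `x_k`, where `k` is in register `i`. -/
def codeX (i : ℕ) : Exp := .add (.add (.lit 2) (.reg 0)) (.reg i)

/-- The number of the vertex `u_j`, where `j` is in register `i`. -/
def codeU (i : ℕ) : Exp := .add (.add (.add (.lit 2) (.reg 0)) (.reg 0)) (.reg i)

/-- The number of the vertex `u'_j`, where `j` is in register `i`. -/
def codeU' (i : ℕ) : Exp := .add (.add (.add (.add (.lit 2) (.reg 0)) (.reg 0)) (.reg 1)) (.reg i)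

/-- The entry of `B` in the row given by register `i` and the column given by register `j`. -/
def entryB (i j : ℕ) : Exp := .arr 1 (.add (.arr 5 (.reg i)) (.reg j))

/-- The entry of `A` in the row given by register 9 and the column given by register 10. -/
def entryA : Exp := .arr 0 (.add (.arr 4 (.reg 9)) (.reg 10))

theorem Env.entryA_iff {S : State} (h : Env A B p S) {k r : Fin n} (h₁ : S.reg 9 = k)
    (h₂ : S.reg 10 = r) : entryA.eval S ≠ 0 ↔ A k r = true := by
  simp only [entryA, Exp.eval, h.arr0, h₁, h₂, h.arr4 _ k.2.le]
  exact flatten_ne_zero_iff A k r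

theorem Env.entryB_iff {S : State} (h : Env A B p S) {i j : ℕ} {k : Fin n} {l : Fin m}
    (h₁ : S.reg i = k) (h₂ : S.reg j = l) : (entryB i j).eval S ≠ 0 ↔ B k l = true := by
  simp only [entryB, Exp.eval, h.arr1, h₁, h₂, h.arr5 _ k.2.le]
  exact flatten_ne_zero_iff B k l

/-- List the edges at the vertices `x'_k` and the edges `(x_k, t)`. -/
def statesProg : Prog :=
  .forTo 9 (.reg 0)
    (.seq (emitUnit (.lit 0) (codeX' 9))
      (.seq (emitUnit (codeX 9) (.lit 1))
        (.seq (.forTo 10 (.reg 0) (.ite entryA (emitUnit (codeX' 9) (codeX 10)) .skip))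
          (.forTo 10 (.reg 1) (.ite (entryB 9 10) (emitUnit (codeX' 9) (codeU 10)) .skip)))))

/-- List the edges `(u_j, u'_j)` and `(u'_j, t)`. -/
def inputsProg : Prog :=
  .forTo 9 (.reg 1) (.seq (emitUnit (codeU 9) (codeU' 9)) (emitCost (codeU' 9) (.lit 1)))

/-- List the edges `(s, 𝒩_i)`. -/
def componentsProg : Prog :=
  .forTo 9 (.sub (.reg 6) (.reg 5)) (emitUnit (.lit 0) (.add (.reg 5) (.reg 9)))

theorem emits_statesProg :
    Emits p ν (Ready A B p ν) statesProg (fun e => ∃ k : Fin n, e = (.s, .x' k) ∨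
      e = (.x k, .t) ∨ (∃ r, A k r = true ∧ e = (.x' k, .x r)) ∨
      ∃ j, B k j = true ∧ e = (.x' k, .u j))
      (n * (n * 70 + m * 70 + 130) + 10) := by
  have key : ∀ k : Fin n, Emits p ν (fun S => Ready A B p ν S ∧ S.reg 9 = k)
      (.seq (emitUnit (.lit 0) (codeX' 9))
      (.seq (emitUnit (codeX 9) (.lit 1))
        (.seq (.forTo 10 (.reg 0) (.ite entryA (emitUnit (codeX' 9) (codeX 10)) .skip))
          (.forTo 10 (.reg 1) (.ite (entryB 9 10) (emitUnit (codeX' 9) (codeU 10)) .skip)))))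
      (fun e => e = (.s, .x' k) ∨ e = (.x k, .t) ∨ (∃ r, A k r = true ∧ e = (.x' k, .x r)) ∨
      ∃ j, B k j = true ∧ e = (.x' k, .u j)) (n * 60 + m * 60 + 90) := by
    intro k
    refine Emits.mono_time (Emits.seq (Emits.emitUnit _ ?_ ?_ rfl rfl) (Emits.seq (Emits.emitUnit _ ?_ ?_ rfl rfl)
      (Emits.seq (Emits.forTo (N := n) ?_ ?_ ?_ ?_ ?_ fun r => Emits.ite (q := A k r = true) ?_
        (Emits.emitUnit _ ?_ ?_ rfl rfl))
      (Emits.forTo (N := m) ?_ ?_ ?_ ?_ ?_ fun j => Emits.ite (q := B k j = true) ?_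
        (Emits.emitUnit _ ?_ ?_ rfl rfl)) ?_ ?_) ?_ ?_) ?_ ?_) ?_
    · rintro S ⟨-, h9⟩; rfl
    · rintro S ⟨-, h9⟩; simp [codeX', Exp.eval, State.reg_setReg, h9, SysVertex.code]
    · rintro S ⟨h, h9⟩; simp [codeX, Exp.eval, h9, h.env.reg0, SysVertex.code]
    · rintro S ⟨-, h9⟩; rfl
    · decide
    · decide
    · rintro S ⟨h, -⟩; exact h.env.reg0
    · intro S S' hF hS
      exact Ready.of_frame_reg hS hF (by decide) (by decide) (by decide)
    · rintro i j e ⟨-, h⟩ ⟨-, h'⟩; simpa using h.symm.trans h'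
    · rintro S ⟨⟨h, h9⟩, h10⟩; exact h.env.entryA_iff h9 h10
    · rintro S ⟨⟨h, h9⟩, h10⟩; simp [codeX', Exp.eval, h9, SysVertex.code]
    · rintro S ⟨⟨h, h9⟩, h10⟩
      simp [codeX, Exp.eval, State.reg_setReg, h10, h.env.reg0, SysVertex.code]
    · decide
    · decide
    · rintro S ⟨h, -⟩; exact h.env.reg1
    · intro S S' hF hS
      exact Ready.of_frame_reg hS hF (by decide) (by decide) (by decide)
    · rintro i j e ⟨-, h⟩ ⟨-, h'⟩; simpa using h.symm.trans h'
    · rintro S ⟨⟨h, h9⟩, h10⟩; exact h.env.entryB_iff h9 h10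
    · rintro S ⟨⟨h, h9⟩, h10⟩; simp [codeX', Exp.eval, h9, SysVertex.code]
    · rintro S ⟨⟨h, h9⟩, h10⟩
      simp [codeU, Exp.eval, State.reg_setReg, h10, h.env.reg0, SysVertex.code]; ring
    · intro S S' hF hS
      exact Ready.of_frame_reg hS hF (by decide) (by decide) (by decide)
    · rintro e ⟨j, -, rfl⟩; simp
    · intro S S' hF hS
      exact Ready.of_frame_reg hS hF (by decide) (by decide) (by decide)
    · rintro e (⟨r, -, rfl⟩ | ⟨j, -, rfl⟩) <;> simp
    · intro S S' hF hS
      exact Ready.of_frame_reg hS hF (by decide) (by decide) (by decide)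
    · rintro e (rfl | ⟨r, -, rfl⟩ | ⟨j, -, rfl⟩) <;> simp
    · simp only [codeX', codeX, codeU, entryA, entryB, Exp.steps]
      omega
  have := Emits.forTo (C := Ready A B p ν) (N := n) (r := 9) (e := .reg 0) (by decide) (by decide)
    (fun S h => h.env.reg0)
    (fun S S' hF hS => hS.of_frame hF (by decide) (by decide) (by decide)) ?_ key
  · intro S Q hS hQ hL
    refine (this S Q hS hQ hL).mono ?_
    rintro S' T - ⟨h1, h2, h3⟩
    simp only [Exp.steps] at h2 h3
    ring_nf at h2 h3 ⊢
    exact ⟨h1, by omega, by omega⟩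
  · rintro i j e (rfl | rfl | ⟨r, -, rfl⟩ | ⟨l, -, rfl⟩) h' <;> simp_all

theorem emits_inputsProg :
    Emits p ν (Ready A B p ν) inputsProg (fun e => ∃ j : Fin m, e = (.u j, .u' j) ∨
      e = (.u' j, .t)) (m * 110 + 10) := by
  have key : ∀ j : Fin m, Emits p ν (fun S => Ready A B p ν S ∧ S.reg 9 = j)
      (.seq (emitUnit (codeU 9) (codeU' 9)) (emitCost (codeU' 9) (.lit 1)))
      (fun e => e = (.u j, .u' j) ∨ e = (.u' j, .t)) 90 := by
    intro j
    refine Emits.mono_time (Emits.seq (Emits.emitUnit _ ?_ ?_ rfl rfl)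
      (Emits.emitCost _ ?_ ?_ ?_ ?_) ?_ ?_) ?_
    · rintro S ⟨h, h9⟩; simp [codeU, Exp.eval, h9, h.env.reg0, SysVertex.code]; ring
    · rintro S ⟨h, h9⟩
      simp [codeU', Exp.eval, State.reg_setReg, h9, h.env.reg0, h.env.reg1, SysVertex.code]; ring
    · rintro S ⟨h, h9⟩
      simp [codeU', Exp.eval, h9, h.env.reg0, h.env.reg1, SysVertex.code]; ring
    · rintro S ⟨h, h9⟩; rfl
    · rintro S ⟨h, h9⟩; simp [SysVertex.capacity, h.env.reg0]
    · rintro S ⟨h, h9⟩; rw [h9, h.env.wt0]; rfl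
    · intro S S' hF hS
      exact Ready.of_frame_reg hS hF (by decide) (by decide) (by decide)
    · rintro e rfl; simp
    · simp [codeU, codeU', Exp.steps]
  have := Emits.forTo (C := Ready A B p ν) (N := m) (r := 9) (e := .reg 1) (by decide) (by decide)
    (fun S h => h.env.reg1)
    (fun S S' hF hS => hS.of_frame hF (by decide) (by decide) (by decide)) ?_ key
  · intro S Q hS hQ hL
    refine (this S Q hS hQ hL).mono ?_
    rintro S' T - ⟨h1, h2, h3⟩
    simp only [Exp.steps] at h2 h3
    exact ⟨h1, by omega, by omega⟩
  · rintro i j e (rfl | rfl) h' <;> simp_all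

theorem emits_componentsProg :
    Emits p ν (Ready A B p ν) componentsProg (fun e => ∃ i : Fin (numNonTop A),
      e = (.s, .scc (ν.symm i))) (numNonTop A * 50 + 10) := by
  have key : ∀ i : Fin (numNonTop A), Emits p ν (fun S => Ready A B p ν S ∧ S.reg 9 = i)
      (emitUnit (.lit 0) (.add (.reg 5) (.reg 9))) (fun e => e = (.s, .scc (ν.symm i))) 34 := by
    intro i
    refine Emits.emitUnit (a := .lit 0) (b := .add (.reg 5) (.reg 9)) _ ?_ ?_ rfl rfl
    · rintro S ⟨h, h9⟩; rfl
    · rintro S ⟨h, h9⟩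
      simp [Exp.eval, State.reg_setReg, h9, h.env.reg5, SysVertex.code]
  have := Emits.forTo (C := Ready A B p ν) (N := numNonTop A) (r := 9)
    (e := .sub (.reg 6) (.reg 5)) (by decide) (by decide)
    (fun S h => by simp [Exp.eval, h.comp.1, h.env.reg5])
    (fun S S' hF hS => hS.of_frame hF (by decide) (by decide) (by decide)) ?_ key
  · intro S Q hS hQ hL
    refine (this S Q hS hQ hL).mono ?_
    rintro S' T - ⟨h1, h2, h3⟩
    simp only [Exp.steps] at h2 h3
    exact ⟨h1, by omega, by omega⟩
  · rintro i j e rfl h'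
    simpa using h'

/-- Treat the state `r` in register 10 and the input `j` in register 9: if `j` acts on `r` and `r`
lies in a non-top linked component `N`, list the edge `(N, u'_j)`, unless it has been listed before.
The array 12 contains, at the number of `N`, the number `j + 1` of the last input `j` for which this
has happened. -/
def linkStep : Prog :=
  .ite (entryB 10 9)
    (.ite (.arr 3 (.reg 10))
      (.ite (.lt (.arr 12 (.arr 3 (.reg 10))) (.add (.reg 9) (.lit 1)))
        (.seq (.setArr 12 (.arr 3 (.reg 10)) (.add (.reg 9) (.lit 1)))
          (emitUnit (.arr 3 (.reg 10)) (codeU' 9)))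
        .skip)
      .skip)
    .skip

/-- List the edges `(𝒩_i, u'_j)`. -/
def linksProg : Prog := .forTo 9 (.reg 1) (.forTo 10 (.reg 0) linkStep)

/-- `(N, u'_l)` is an edge because of a pair of a state and an input that comes before the pair
`(i, j)`, in the lexicographic order in which the input is the first key. -/
def LinkBefore (B : Matrix (Fin n) (Fin m) Bool) (j i : ℕ)
    (e : SysVertex m A × SysVertex m A) : Prop :=
  ∃ (N : {N : Finset (Fin n) // N ∈ nonTopSCCs A}) (l : Fin m), e = (.scc N, .u' l) ∧
    ∃ r ∈ N.1, B r l = true ∧ (l.1 < j ∨ l.1 = j ∧ r.1 < i)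

theorem linkBefore_succ {j i : ℕ} {r : Fin n} {l : Fin m} (hr : r.1 = i) (hl : l.1 = j)
    (e : SysVertex m A × SysVertex m A) : LinkBefore B j (i + 1) e ↔ LinkBefore B j i e ∨
      ∃ N : {N : Finset (Fin n) // N ∈ nonTopSCCs A}, r ∈ N.1 ∧ B r l = true ∧
        e = (.scc N, .u' l) := by
  constructor
  · rintro ⟨N, l', rfl, r', hr', hB, h⟩
    rcases h with h | ⟨h, h'⟩
    · exact Or.inl ⟨N, l', rfl, r', hr', hB, Or.inl h⟩
    · rcases Nat.lt_succ_iff_lt_or_eq.1 h' with hlt | heq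
      · exact Or.inl ⟨N, l', rfl, r', hr', hB, Or.inr ⟨h, hlt⟩⟩
      · have e1 : r' = r := Fin.ext (heq.trans hr.symm)
        have e2 : l' = l := Fin.ext (h.trans hl.symm)
        subst e1 e2
        exact Or.inr ⟨N, hr', hB, rfl⟩
  · rintro (⟨N, l', rfl, r', hr', hB, h⟩ | ⟨N, hrN, hB, rfl⟩)
    · exact ⟨N, l', rfl, r', hr', hB, h.imp_right fun h => ⟨h.1, by omega⟩⟩
    · exact ⟨N, l, rfl, r, hrN, hB, Or.inr ⟨hl, by omega⟩⟩

theorem Ends.linkStep {j i : ℕ} {S : State} {Q : SysVertex m A × SysVertex m A → Prop}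
    (h : Ready A B p ν S) (hj : j < m) (hi : i < n) (h9 : S.reg 9 = j) (h10 : S.reg 10 = i)
    (hQ : ∀ N l, ¬ Q (.scc N, .u' l))
    (hL : Listed p ν S fun e => Q e ∨ LinkBefore B j i e)
    (h12 : ∀ N, S.arr 12 (2 + 2 * n + 2 * m + ν N) ≤ j + 1 ∧
      (S.arr 12 (2 + 2 * n + 2 * m + ν N) = j + 1 ↔ ∃ r ∈ N.1, r.1 < i ∧ B r ⟨j, hj⟩ = true)) :
    Ends linkStep S fun S' T => Listed p ν S' (fun e => Q e ∨ LinkBefore B j (i + 1) e) ∧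
      (∀ N, S'.arr 12 (2 + 2 * n + 2 * m + ν N) ≤ j + 1 ∧
        (S'.arr 12 (2 + 2 * n + 2 * m + ν N) = j + 1 ↔
          ∃ r ∈ N.1, r.1 < i + 1 ∧ B r ⟨j, hj⟩ = true)) ∧
      T ≤ 90 ∧ S'.reg 13 ≤ S.reg 13 + 90 := by
  have hB := h.env.entryB_iff (i := 10) (j := 9) (k := ⟨i, hi⟩) (l := ⟨j, hj⟩) h10 h9
  obtain ⟨-, c2, c3⟩ := h.comp
  have e3 : (Exp.arr 3 (.reg 10)).eval S = S.arr 3 i := by simp [Exp.eval, h10]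
  have hsucc := fun e => linkBefore_succ (A := A) (B := B) (r := ⟨i, hi⟩) (l := ⟨j, hj⟩) rfl rfl e
  have hex : ∀ N : {N : Finset (Fin n) // N ∈ nonTopSCCs A},
      (∃ r ∈ N.1, r.1 < i + 1 ∧ B r ⟨j, hj⟩ = true) ↔
      (∃ r ∈ N.1, r.1 < i ∧ B r ⟨j, hj⟩ = true) ∨
        (⟨i, hi⟩ ∈ N.1 ∧ B ⟨i, hi⟩ ⟨j, hj⟩ = true) := by
    intro N
    constructor
    · rintro ⟨r, hr, hri, hBr⟩
      rcases Nat.lt_succ_iff_lt_or_eq.1 hri with hlt | rfl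
      · exact Or.inl ⟨r, hr, hlt, hBr⟩
      · exact Or.inr ⟨hr, hBr⟩
    · rintro (⟨r, hr, hri, hBr⟩ | ⟨hr, hBr⟩)
      · exact ⟨r, hr, by omega, hBr⟩
      · exact ⟨_, hr, Nat.lt_succ_self i, hBr⟩
  -- the cases in which no edge is added
  have hskip : ∀ T, T ≤ 90 → (∀ N : {N : Finset (Fin n) // N ∈ nonTopSCCs A},
      ⟨i, hi⟩ ∈ N.1 → B ⟨i, hi⟩ ⟨j, hj⟩ = true →
        ∃ r ∈ N.1, r.1 < i ∧ B r ⟨j, hj⟩ = true) →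
      Listed p ν S (fun e => Q e ∨ LinkBefore B j (i + 1) e) ∧
      (∀ N, S.arr 12 (2 + 2 * n + 2 * m + ν N) ≤ j + 1 ∧
        (S.arr 12 (2 + 2 * n + 2 * m + ν N) = j + 1 ↔
          ∃ r ∈ N.1, r.1 < i + 1 ∧ B r ⟨j, hj⟩ = true)) ∧
      T ≤ 90 ∧ S.reg 13 ≤ S.reg 13 + 90 := by
    refine fun T hT hN => ⟨hL.congr (fun e => or_congr_right ?_) rfl rfl rfl rfl rfl,
      fun N => ⟨(h12 N).1, (h12 N).2.trans ?_⟩, hT, by omega⟩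
    · rw [hsucc]
      refine ⟨Or.inl, ?_⟩
      rintro (h' | ⟨N, hiN, hB', rfl⟩)
      · exact h'
      · obtain ⟨r, hr, hlt, hBr⟩ := hN N hiN hB'
        exact ⟨N, _, rfl, r, hr, hBr, Or.inr ⟨rfl, hlt⟩⟩
    · rw [hex]
      exact ⟨Or.inl, fun h' => h'.elim id fun h' => hN N h'.1 h'.2⟩
  refine Ends.ite (fun h1 => Ends.ite (fun h2 => Ends.ite (fun h3 => ?_)
    fun h3 => Ends.skip ?_) fun h2 => Ends.skip ?_) fun h1 => Ends.skip ?_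
  · have hBij := hB.1 h1
    rw [e3] at h2
    obtain ⟨N, hiN⟩ := c3 ⟨i, hi⟩ h2
    have hcode := c2 _ _ hiN
    simp only at hcode
    have hlt : S.arr 12 (2 + 2 * n + 2 * m + ν N) < j + 1 := by
      by_contra h0
      simp [Exp.eval, h9, h10, hcode, h0] at h3
    have hnew : ¬ ∃ r ∈ N.1, r.1 < i ∧ B r ⟨j, hj⟩ = true := fun h' =>
      hlt.ne ((h12 N).2.2 h')
    -- a state lies in at most one component
    have hN' : ∀ N' : {N : Finset (Fin n) // N ∈ nonTopSCCs A}, ⟨i, hi⟩ ∈ N'.1 → N' = N :=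
      fun N' h' => Subtype.ext (eq_of_mem_nonTopSCCs N'.2 N.2 h' hiN)
    refine Ends.seq (Ends.setArr ?_)
    have e9 : (Exp.add (.reg 9) (.lit 1)).eval S = j + 1 := by simp [Exp.eval, h9]
    rw [e3, e9, hcode]
    set S₁ := S.setArr 12 (2 + 2 * n + 2 * m + ν N) (j + 1) with hS₁
    have hL₁ : Listed p ν S₁ fun e => Q e ∨ LinkBefore B j i e :=
      hL.congr (fun _ => Iff.rfl) rfl (by simp [hS₁, State.arr_setArr])
        (by simp [hS₁, State.arr_setArr]) (by simp [hS₁, State.arr_setArr]) rfl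
    have hemit := Emits.emitUnit (p := p) (ν := ν) (C := (· = S₁)) (a := .arr 3 (.reg 10))
      (b := codeU' 9) (.scc N, .u' ⟨j, hj⟩) ?_ ?_ rfl rfl
    · refine (hemit S₁ _ rfl ?_ hL₁).mono ?_
      · rintro e rfl (h' | ⟨N', l, h', r, hr, hBr, hlt⟩)
        · exact hQ _ _ h'
        · simp only [Prod.mk.injEq, SysVertex.scc.injEq, SysVertex.u'.injEq] at h'
          obtain ⟨rfl, rfl⟩ := h'
          simp only [lt_irrefl, false_or] at hlt
          exact hnew ⟨r, hr, hlt.2, hBr⟩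
      · rintro S' T hF ⟨hL', hT, h13⟩
        have a12 : S'.arr 12 = S₁.arr 12 := hF.arr 12 (by simp [emitUnit, emit, Prog.arrs])
        refine ⟨hL'.congr (fun e => ?_) rfl rfl rfl rfl rfl, fun N' => ?_, ?_, ?_⟩
        · rw [hsucc, or_assoc]
          refine or_congr_right (or_congr_right ⟨?_, ?_⟩)
          · rintro rfl; exact ⟨N, hiN, hBij, rfl⟩
          · rintro ⟨N', hiN', -, rfl⟩; rw [hN' N' hiN']
        · rw [a12, hex, hS₁, State.arr_setArr, if_pos rfl]
          by_cases hNN : N' = N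
          · subst hNN
            simp [hiN, hBij]
          · have hne : 2 + 2 * n + 2 * m + (ν N' : ℕ) ≠ 2 + 2 * n + 2 * m + ν N := by
              intro h'
              exact hNN (ν.injective (Fin.ext (by omega)))
            rw [Function.update_of_ne hne]
            refine ⟨(h12 N').1, (h12 N').2.trans ⟨Or.inl, fun h' => h'.elim id fun h' => ?_⟩⟩
            exact absurd (hN' N' h'.1) hNN
        · simp [codeU', entryB, Exp.steps] at hT ⊢; omega
        · have : S₁.reg 13 = S.reg 13 := rfl
          simp [codeU', Exp.steps] at h13; omega
    · rintro _ rfl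
      simp [hS₁, Exp.eval, State.arr_setArr, h10, hcode, SysVertex.code]
    · rintro _ rfl
      simp [hS₁, codeU', Exp.eval, State.reg_setReg, h9, h.env.reg0, h.env.reg1, SysVertex.code]
      ring
  · refine hskip _ (by simp [entryB, Exp.steps]) fun N hiN hBij => (h12 N).2.1 ?_
    have hcode := c2 _ _ hiN
    simp only at hcode
    by_contra h0
    have := lt_of_le_of_ne (h12 N).1 h0
    simp [Exp.eval, h9, h10, hcode, this] at h3
  · refine hskip _ (by simp [entryB, Exp.steps]) fun N hiN => ?_
    have hcode := c2 _ _ hiN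
    rw [e3] at h2
    simp only at hcode
    omega
  · refine hskip _ (by simp [entryB, Exp.steps]) fun N _ hBij => ?_
    exact absurd h1 (hB.2 hBij)

theorem Ends.linksProg {S₀ : State} {Q : SysVertex m A × SysVertex m A → Prop}
    (h : Ready A B p ν S₀) (hQ : ∀ N l, ¬ Q (.scc N, .u' l)) (hL : Listed p ν S₀ Q)
    (h12 : ∀ i, S₀.arr 12 i = 0) :
    Ends linksProg S₀ fun S T => Listed p ν S (fun e => Q e ∨ ∃ N l, e = (.scc N, .u' l) ∧
        ∃ r ∈ N.1, B r l = true) ∧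
      T ≤ m * (n * 100 + 20) + 10 ∧ S.reg 13 ≤ S₀.reg 13 + (m * (n * 100 + 20) + 10) := by
  have hset9 : ∀ (S : State) (v : ℕ), (S.setReg 9 v).reg 13 = S.reg 13 := by
    simp [State.reg_setReg]
  have hset10 : ∀ (S : State) (v : ℕ), (S.setReg 10 v).reg 13 = S.reg 13 := by
    simp [State.reg_setReg]
  refine Ends.forTo (N := m) (fun j S t => Listed p ν S (fun e => Q e ∨ LinkBefore B j 0 e) ∧
    (∀ N, S.arr 12 (2 + 2 * n + 2 * m + ν N) ≤ j) ∧ t ≤ j * (n * 100 + 20) ∧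
      S.reg 13 ≤ S₀.reg 13 + j * (n * 100 + 20)) (by decide) ?_ ?_ ?_ ?_
  · intro S hF
    exact (h.of_frame hF (by decide) (by decide) (by decide)).env.reg1
  · refine ⟨hL.congr (fun e => ?_) (hset9 _ _) rfl rfl rfl rfl, by simp [h12], by simp,
      by simp [hset9]⟩
    simp [LinkBefore]
  · rintro j S t hj hF h9 ⟨hLS, h12S, ht, h13⟩
    have hR := h.of_frame hF (by decide) (by decide) (by decide)
    have inner : Ends (.forTo 10 (.reg 0) RAM.linkStep) S fun S' T =>
        Listed p ν S' (fun e => Q e ∨ LinkBefore B j n e) ∧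
        (∀ N, S'.arr 12 (2 + 2 * n + 2 * m + ν N) ≤ j + 1 ∧
          (S'.arr 12 (2 + 2 * n + 2 * m + ν N) = j + 1 ↔
            ∃ r ∈ N.1, r.1 < n ∧ B r ⟨j, hj⟩ = true)) ∧ T ≤ n * 100 + 6 ∧
        S'.reg 13 ≤ S.reg 13 + n * 100 := by
      refine Ends.forTo (N := n) (fun i S' t' =>
        Listed p ν S' (fun e => Q e ∨ LinkBefore B j i e) ∧
        (∀ N, S'.arr 12 (2 + 2 * n + 2 * m + ν N) ≤ j + 1 ∧
          (S'.arr 12 (2 + 2 * n + 2 * m + ν N) = j + 1 ↔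
            ∃ r ∈ N.1, r.1 < i ∧ B r ⟨j, hj⟩ = true)) ∧ t' ≤ i * 100 ∧
        S'.reg 13 ≤ S.reg 13 + i * 100) (by decide) ?_ ?_ ?_ fun S' t' _ h' =>
        ⟨h'.1, h'.2.1, by simp only [Exp.steps]; omega, h'.2.2.2⟩
      · intro S' hF'
        exact (hR.of_frame hF' (by decide) (by decide) (by decide)).env.reg0
      · refine ⟨hLS.congr (fun _ => Iff.rfl) (hset10 _ _) rfl rfl rfl rfl, fun N => ?_, by simp,
          by simp [hset10]⟩
        have := h12S N
        simp only [State.arr_setReg]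
        refine ⟨by omega, ⟨fun h' => by omega, ?_⟩⟩
        rintro ⟨r, -, hr, -⟩
        omega
      · rintro i S' t' hi hF' h10 ⟨hL', h12', ht', h13'⟩
        have hR' := Ready.of_frame_reg ⟨hR, h9⟩ hF' (by decide) (by decide) (by decide)
        refine (Ends.linkStep hR'.1 hj hi hR'.2 h10 hQ hL' h12').mono ?_
        rintro S'' T - ⟨g1, g2, g3, g4⟩
        refine ⟨g1.congr (fun _ => Iff.rfl) (hset10 _ _) rfl rfl rfl rfl, g2, ?_, ?_⟩
        · simp [Exp.steps]; omega
        · rw [hset10]; omega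
    refine inner.mono ?_
    rintro S' T - ⟨g1, g2, g3, g4⟩
    refine ⟨g1.congr (fun e => or_congr_right ?_) (hset9 _ _) rfl rfl rfl rfl,
      fun N => (g2 N).1, ?_, ?_⟩
    · constructor
      · rintro ⟨N, l, rfl, r, hr, hB, h'⟩
        exact ⟨N, l, rfl, r, hr, hB, Or.inl (by omega)⟩
      · rintro ⟨N, l, rfl, r, hr, hB, h'⟩
        refine ⟨N, l, rfl, r, hr, hB, ?_⟩
        have := r.2
        omega
    · rw [add_mul, one_mul]
      simp only [Exp.steps] at g3 ⊢
      omega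
    · rw [hset9, add_mul, one_mul]
      omega
  · rintro S t hF ⟨hLS, -, ht, h13⟩
    refine ⟨hLS.congr (fun e => or_congr_right ?_) rfl rfl rfl rfl rfl, ?_, by omega⟩
    · constructor
      · rintro ⟨N, l, he, r, hr, hB, -⟩
        exact ⟨N, l, he, r, hr, hB⟩
      · rintro ⟨N, l, he, r, hr, hB⟩
        exact ⟨N, l, he, r, hr, hB, Or.inl l.2⟩
    · simp only [Exp.steps]; omega

/-- List all edges. -/
def edgesProg : Prog :=
  .seq (.setReg 13 (.lit 0)) (.seq (.seq statesProg (.seq inputsProg componentsProg)) linksProg)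

theorem Ends.edgesProg {S₀ : State} (h : Ready A B p ν S₀) (h12 : ∀ i, S₀.arr 12 i = 0) :
    Ends edgesProg S₀ fun S T => Ready A B p ν S ∧
      Listed p ν S (fun e => SysVertex.IsEdge B e.1 e.2) ∧
      T ≤ 200 * (n * n) + 300 * (n * m) + 200 * n + 200 * m + 100 ∧
      S.reg 13 ≤ 200 * (n * n) + 300 * (n * m) + 200 * n + 200 * m + 100 := by
  have hq := numNonTop_le A
  have hfr : ∀ {S}, Frame RAM.edgesProg S₀ S → Ready A B p ν S := fun hF =>
    h.of_frame hF (by decide) (by decide) (by decide)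
  refine (Ends.mono (Φ := fun S T => Listed p ν S (fun e => SysVertex.IsEdge B e.1 e.2) ∧
      T ≤ 200 * (n * n) + 300 * (n * m) + 200 * n + 200 * m + 100 ∧
      S.reg 13 ≤ 200 * (n * n) + 300 * (n * m) + 200 * n + 200 * m + 100) ?_
    fun S T hF h' => ⟨hfr hF, h'⟩)
  refine Ends.seq (Ends.setReg (Ends.seq ?_))
  have hR₁ : Ready A B p ν (S₀.setReg 13 ((Exp.lit 0).eval S₀)) :=
    h.of_frame (Runs.setReg S₀ 13 (.lit 0)).frame (by decide) (by decide) (by decide)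
  have hL₁ : Listed p ν (S₀.setReg 13 ((Exp.lit 0).eval S₀)) fun _ => False :=
    ⟨[], by simp, by simp, by simp [State.reg_setReg, Exp.eval], by simp⟩
  have hem := (emits_statesProg (A := A) (B := B) (p := p) (ν := ν)).seq
    (emits_inputsProg.seq emits_componentsProg
      (fun S S' hF hS => hS.of_frame hF (by decide) (by decide) (by decide)) ?_)
    (fun S S' hF hS => hS.of_frame hF (by decide) (by decide) (by decide)) ?_
  · refine (hem _ _ hR₁ (fun _ _ => id) hL₁).mono ?_
    rintro S₂ T₂ hF₂ ⟨hL₂, hT₂, h13₂⟩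
    refine (Ends.linksProg (hR₁.of_frame hF₂ (by decide) (by decide) (by decide)) ?_ hL₂ ?_).mono
      ?_
    · simp
    · intro i
      rw [hF₂.arr 12 (by decide)]
      exact h12 i
    · rintro S₃ T₃ - ⟨hL₃, hT₃, h13₃⟩
      refine ⟨hL₃.congr (fun e => ?_) rfl rfl rfl rfl rfl, ?_, ?_⟩
      · rcases e with ⟨_ | _ | N | k | r | j | j, _ | _ | N' | k' | r' | j' | j'⟩ <;>
          simp [SysVertex.IsEdge]
        · exact ⟨ν N', by simp⟩
        · exact eq_comm
      · simp only [Exp.steps]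
        ring_nf at hT₂ hT₃ ⊢
        omega
      · have : (S₀.setReg 13 ((Exp.lit 0).eval S₀)).reg 13 = 0 := by
          simp [State.reg_setReg, Exp.eval]
        rw [this] at h13₂
        ring_nf at h13₂ h13₃ ⊢
        omega
  · rintro e ⟨i, rfl⟩; simp
  · rintro e (⟨j, rfl | rfl⟩ | ⟨i, rfl⟩) <;> simp

end RAM

/-! ### The whole program -/

namespace RAM

variable {n m : ℕ} {A : Matrix (Fin n) (Fin n) Bool} {B : Matrix (Fin n) (Fin m) Bool}
  {p : Fin m → ℝ≥0} {ν : {N : Finset (Fin n) // N ∈ nonTopSCCs A} ≃ Fin (numNonTop A)}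

/-- Copy the list of edges to its final position. -/
def copyProg : Prog :=
  .forTo 9 (.reg 13) (.seq (.setArr 0 (.reg 9) (.arr 13 (.reg 9)))
    (.seq (.setArr 1 (.reg 9) (.arr 14 (.reg 9)))
      (.seq (.setArr 2 (.reg 9) (.arr 15 (.reg 9))) (.copyWt 0 (.reg 9) 1 (.reg 9)))))

theorem Ends.copyProg (S₀ : State) : Ends copyProg S₀ fun S T =>
    (∀ k < S₀.reg 13, S.arr 0 k = S₀.arr 13 k ∧ S.arr 1 k = S₀.arr 14 k ∧
      S.arr 2 k = S₀.arr 15 k ∧ S.wt 0 k = S₀.wt 1 k) ∧ T ≤ S₀.reg 13 * 30 + 6 := by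
  refine Ends.forTo (N := S₀.reg 13) (fun i S t => (∀ k < i, S.arr 0 k = S₀.arr 13 k ∧
    S.arr 1 k = S₀.arr 14 k ∧ S.arr 2 k = S₀.arr 15 k ∧ S.wt 0 k = S₀.wt 1 k) ∧ t ≤ i * 30)
    (by decide) ?_ (by simp) ?_ ?_
  · intro S hF
    exact hF.reg 13 (by decide)
  · rintro i S t - hF h9 ⟨hS, ht⟩
    refine Ends.seq (Ends.setArr (Ends.seq (Ends.setArr (Ends.seq (Ends.setArr (Ends.copyWt
      ⟨fun k hk => ?_, ?_⟩))))))
    · have h13 := congrFun (hF.arr 13 (by decide)) i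
      have h14 := congrFun (hF.arr 14 (by decide)) i
      have h15 := congrFun (hF.arr 15 (by decide)) i
      have h1 := congrFun (hF.wt 1 (by decide)) i
      rcases Nat.lt_succ_iff_lt_or_eq.1 hk with hlt | rfl
      · simpa [State.arr_setArr, State.wt_setWt, Exp.eval, h9, Function.update_of_ne hlt.ne]
          using hS k hlt
      · simp [State.arr_setArr, State.wt_setWt, Exp.eval, h9, h13, h14, h15, h1]
    · simp [Exp.steps]; omega
  · rintro S t - ⟨hS, ht⟩
    exact ⟨hS, by simp [Exp.steps]; omega⟩

/-- Write the numbers of vertices and edges, the source, the sink and the flow requirement. -/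
def headerProg : Prog :=
  .seq (.setReg 4 (.add (.sub (.reg 6) (.reg 5)) (.reg 0))) (.seq (.setReg 0 (.reg 6))
    (.seq (.setReg 1 (.lit 0)) (.seq (.setReg 2 (.lit 1)) (.setReg 3 (.reg 13)))))

theorem Ends.headerProg (S₀ : State) : Ends headerProg S₀ fun S T =>
    S.arr = S₀.arr ∧ S.wt = S₀.wt ∧ S.reg 0 = S₀.reg 6 ∧ S.reg 1 = 0 ∧ S.reg 2 = 1 ∧
      S.reg 3 = S₀.reg 13 ∧ S.reg 4 = S₀.reg 6 - S₀.reg 5 + S₀.reg 0 ∧ T ≤ 14 := by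
  refine Ends.seq (Ends.setReg (Ends.seq (Ends.setReg (Ends.seq (Ends.setReg (Ends.seq
    (Ends.setReg (Ends.setReg ⟨rfl, rfl, ?_⟩))))))))
  simp [State.reg_setReg, Exp.eval, Exp.steps]

/-- The program that constructs the flow network. -/
def networkProg : Prog := .seq prepareProg (.seq edgesProg (.seq copyProg headerProg))

theorem code_injective : Function.Injective (SysVertex.code (m := m) ν) := by
  rintro (_ | _ | N | k | r | j | j) (_ | _ | N' | k' | r' | j' | j') h <;>
    simp only [SysVertex.code] at h <;> first | rfl | (exfalso; omega) | skip
  · have : ν N = ν N' := Fin.ext (by omega)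
    rw [ν.injective this]
  all_goals
    congr 1
    ext
    omega

theorem code_lt (v : SysVertex m A) : SysVertex.code ν v < Fintype.card (SysVertex m A) := by
  rw [SysVertex.card_eq]
  rcases v with _ | _ | N | k | r | j | j <;> simp only [SysVertex.code] <;> omega

/-- A duplicate free list of the edges gives the enumeration that the encoding of a network asks
for. -/
theorem Listed.exists_edge {S : State}
    (h : Listed p ν S fun e => SysVertex.IsEdge B e.1 e.2) :
    S.reg 13 = (systemNetwork A B p).edges.card ∧
    ∃ edge : Fin (systemNetwork A B p).edges.card ≃ {e // e ∈ (systemNetwork A B p).edges},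
      ∀ k : Fin (systemNetwork A B p).edges.card,
        S.arr 13 k = SysVertex.code ν (edge k).1.1 ∧ S.arr 14 k = SysVertex.code ν (edge k).1.2 ∧
        (S.arr 15 k : ℝ≥0) = SysVertex.capacity (edge k).1 ∧
        S.wt 1 k = SysVertex.edgeCost p (edge k).1 := by
  obtain ⟨L, hnd, hmem, hlen, hL⟩ := h
  have hmem' : ∀ e, e ∈ L ↔ e ∈ (systemNetwork A B p).edges := fun e =>
    (hmem e).trans mem_edges.symm
  have hcard : L.length = (systemNetwork A B p).edges.card := by
    rw [← List.toFinset_card_of_nodup hnd]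
    congr 1
    ext e
    rw [List.mem_toFinset, hmem']
  refine ⟨hlen.trans hcard, (finCongr hcard.symm).trans
    ((hnd.getEquiv L).trans (Equiv.subtypeEquivRight hmem')), fun k => ?_⟩
  exact hL k (k.2.trans_eq hcard.symm)

theorem Ends.networkProg (A : Matrix (Fin n) (Fin n) Bool) (B : Matrix (Fin n) (Fin m) Bool)
    (p : Fin m → ℝ≥0) : Ends networkProg (inputState A B p) fun S T => HoldsInstance A B p S ∧
      T ≤ 7000 * (n * n) + 10000 * (n * m) + 7000 * n + 7000 * m + 4000 := by
  refine Ends.seq ((Ends.prepareProg A B p).mono ?_)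
  rintro S₁ T₁ - ⟨hE, h12, ⟨ν, hν⟩, hT₁⟩
  refine Ends.seq ((Ends.edgesProg ⟨hE, hν⟩ h12).mono ?_)
  rintro S₂ T₂ - ⟨hR, hL, hT₂, h13⟩
  refine Ends.seq ((Ends.copyProg S₂).mono ?_)
  rintro S₃ T₃ hF₃ ⟨hS₃, hT₃⟩
  refine (Ends.headerProg S₃).mono ?_
  rintro S₄ T₄ - ⟨ha, hw, h0, h1, h2, h3, h4, hT₄⟩
  have f6 : S₃.reg 6 = S₂.reg 6 := hF₃.reg 6 (by decide)
  have f5 : S₃.reg 5 = S₂.reg 5 := hF₃.reg 5 (by decide)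
  have f0 : S₃.reg 0 = S₂.reg 0 := hF₃.reg 0 (by decide)
  have f13 : S₃.reg 13 = S₂.reg 13 := hF₃.reg 13 (by decide)
  have a3 : S₃.arr 3 = S₂.arr 3 := hF₃.arr 3 (by decide)
  obtain ⟨c1, c2, c3⟩ := hR.comp
  obtain ⟨hcard, edge, hedge⟩ := hL.exists_edge
  refine ⟨⟨ν, ⟨code_injective, code_lt, ?_, ?_, ?_, ?_, edge, fun k => ?_⟩, ?_, ?_⟩, ?_⟩
  · rw [h0, f6, c1, SysVertex.card_eq]
  · exact h1
  · exact h2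
  · rw [h3, f13, hcard]
  · obtain ⟨e0, e1, e2, e3⟩ := hS₃ k (k.2.trans_eq hcard.symm)
    rw [ha, hw, e0, e1, e2, e3]
    exact hedge k
  · rw [h4, f6, f5, f0, c1, hR.env.reg5, hR.env.reg0]
    omega
  · intro r N
    rw [ha, a3]
    refine ⟨fun h => ?_, fun h => c2 r N h⟩
    -- the number of a component is not zero, hence `r` lies in some component
    obtain ⟨N', hN'⟩ := c3 r (by rw [h]; simp [SysVertex.code])
    have hNN : SysVertex.code (m := m) ν (.scc N') = SysVertex.code ν (.scc N) :=
      (c2 r N' hN').symm.trans h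
    have := code_injective hNN
    rw [SysVertex.scc.injEq] at this
    rwa [this] at hN'
  · ring_nf at hT₁ hT₂ hT₃ hT₄ h13 ⊢
    omega

end RAM

theorem mainTheorem2 :
    -- the network is constructible in `O(n²)` computations, the number of inputs being `O(n)`
    (∃ (P : RAM.Prog) (C : ℕ), ∀ (n m : ℕ) (A : Matrix (Fin n) (Fin n) Bool)
      (B : Matrix (Fin n) (Fin m) Bool) (p : Fin m → ℝ≥0),
      ∃ (S : RAM.State) (T : ℕ), RAM.Runs P (RAM.inputState A B p) S T ∧
        RAM.HoldsInstance A B p S ∧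
        (0 < n → T ≤ C * (n * (n + m)) ∧ ∀ K : ℕ, m ≤ K * n → T ≤ C * (K + 1) * n ^ 2)) ∧
    -- optimal flows give optimal input selections, and the optimal values agree
    (∀ (n m : ℕ) (A : Matrix (Fin n) (Fin n) Bool) (B : Matrix (Fin n) (Fin m) Bool)
      (p : Fin m → ℝ≥0), StructurallyControllable A B →
      (∀ f : SysVertex m A × SysVertex m A → ℝ≥0,
        (systemNetwork A B p).IsMCFFOptimal ((numNonTop A + n : ℕ) : ℝ≥0) f →
        IsOptimalSelection A B p (flowInputs f)) ∧
      IsLeast (selectionCosts A B p) (pStar A B p) ∧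
      IsLeast ((systemNetwork A B p).mcffCosts ((numNonTop A + n : ℕ) : ℝ≥0))
        ((systemNetwork A B p).mcffOptimum ((numNonTop A + n : ℕ) : ℝ≥0)) ∧
      pStar A B p = (systemNetwork A B p).mcffOptimum ((numNonTop A + n : ℕ) : ℝ≥0)) := by
  refine ⟨⟨RAM.networkProg, 40000, fun n m A B p => ?_⟩, fun n m A B p h =>
    ⟨fun f hf => isOptimalSelection_flowInputs hf, isLeast_pStar h, isLeast_mcffOptimum h,
      pStar_eq_mcffOptimum h⟩⟩
  obtain ⟨S, T, hr, hS, hT⟩ := RAM.Ends.networkProg A B p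
  refine ⟨S, T, hr, hS, fun hn => ?_⟩
  -- the terms of lower order are absorbed because `n` is positive
  have h1 : n ≤ n * n := Nat.le_mul_of_pos_left n hn
  have h2 : m ≤ n * m := Nat.le_mul_of_pos_left m hn
  have hT' : T ≤ 40000 * (n * (n + m)) := by
    rw [mul_add n n m]
    omega
  refine ⟨hT', fun K hK => hT'.trans ?_⟩
  calc 40000 * (n * (n + m)) ≤ 40000 * (n * (n + K * n)) := by gcongr
    _ = 40000 * (K + 1) * n ^ 2 := by ring
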